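/- **Setting.** Norms are Euclidean for vectors and spectral for matrices; $v_+=\max\{v,0\}$ componentwise. Let $\mathcal X\subset\mathbb R^{d_x}$ be closed and convex, and let $f_1:\mathbb R^{d_y}\to\mathbb R$, $f_2:\mathbb R^{d_x}\to\mathbb R^{d_y}$, $g_1:\mathbb R^{d_z}\to\mathbb R^m$, $g_2:\mathbb R^{d_x}\to\mathbb R^{d_z}$ have convex components, with $f_1,g_1$ differentiable. Put $F=f_1\circ f_2$, $G=g_1\circ g_2$ and consider $\min_{x\in\mathcal X}F(x)$ subject to $G(x)\le 0$. Assume that the Lagrangian $F(x)+\langle G(x),\lambda\rangle$ has a saddle point $(x^*,\lambda^*)$ on $\mathcal X\times\mathbb R^m_+$. Here $\nabla g_1\in\mathbb R^{d_z\times m}$, and a matrix lies in $\partial f_2(x)$ (or $\partial g_2(x)$) if its $j$-th column is a subgradient at $x$ of the $j$-th component, for all $j$. **Assumptions.** There are positive constants $C_{f_1},C_{f_2},\sigma_{f_1},\sigma_{f_2},L_{f_1},D_X,C_{g_1},C_{g_2},\sigma_{g_1},\sigma_{g_2},L_{g_1}$ such that $\|x-x^*\|\le D_X$ on $\mathcal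 X$; $\nabla f_1$ is $L_{f_1}$-Lipschitz and $\nabla g_1$ is $L_{g_1}$-Lipschitz; for all $x\in\mathcal X$, $y\in\mathbb R^{d_y}$, $z\in\mathbb R^{d_z}$ the (jointly measurable) sample values $f_1(y,\xi_1),f_2(x,\xi_2),g_1(z,\zeta_1),g_2(x,\zeta_2)$ are unbiased for $f_1(y),f_2(x),g_1(z),g_2(x)$ with mean squared errors at most $\sigma_{f_1}^2,\sigma_{f_2}^2,\sigma_{g_1}^2,\sigma_{g_2}^2$; and the sample (sub)gradients satisfy $\mathbb E\nabla f_1(y,\xi_1)=\nabla f_1(y)$, $\mathbb E\,\partial f_2(x,\xi_2)\in\partial f_2(x)$, $\mathbb E\nabla g_1(z,\zeta_1)=\nabla g_1(z)$, $\mathbb E\,\partial g_2(x,\zeta_2)\in\partial g_2(x)$, with $\mathbb E\|\cdot\|^2$ at most $C_{f_1}^2,C_{f_2}^2,C_{g_1}^2,C_{g_2}^2$ respectively. If $f_2$ is not affine, then $\nabla f_1\ge 0$ everywhere. For all $j,i$: if $g_2^{(i)}$ is not affine, then $\partial g_1^{(j)}/\partial z_i\ge 0$ everywhere. **Algorithm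 (CC-SCGD).** Let $x_0\in\mathcal X$, $y_0=0$, $z_0=0$, $\lambda_0=0$. For $t=0,\dots,N-1$, with all samples mutually independent, $$y_{t+1}=\frac{f_2(x_t,\xi_{2,t}^1)+\tau_ty_t}{1+\tau_t},\qquad z_{t+1}=\frac{g_2(x_t,\zeta_{2,t}^1)+\rho_tz_t}{1+\rho_t},$$ $$x_{t+1}=\mathrm{Proj}_{\mathcal X}\Big[x_t-\tfrac1{\eta_t}\big(\partial f_2(x_t,\xi_{2,t}^0)\nabla f_1(y_{t+1},\xi_{1,t}^0)+\partial g_2(x_t,\zeta_{2,t}^0)\nabla g_1(z_{t+1},\zeta_{1,t}^0)\lambda_t\big)\Big],$$ $$H_{t+1}=g_1(z_{t+1},\zeta_{1,t}^1)-\nabla g_1(z_{t+1},\zeta_{1,t}^1)^\top z_{t+1}+\nabla g_1(z_{t+1},\zeta_{1,t}^1)^\top g_2(x_t,\zeta_{2,t}^2),\qquad \lambda_{t+1}=[\lambda_t+H_{t+1}/\alpha_t]_+ ,$$ and $\bar x_N=\frac1N\sum_{t=1}^Nx_t$. Take $\tau_t=\rho_t=t/2$, $\alpha_t=2\sqrt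 N$, $\eta_t=\frac{5\sqrt N}2$, and $N\ge 2C_{g_1}^2C_{g_2}^2$. **Conclusion.** $F(\bar x_N)$ and $\|G(\bar x_N)_+\|$ are integrable. Write $V_t=\mathbb E\big\|H_{t+1}-\big(g_1(z_{t+1})+\nabla g_1(z_{t+1})^\top(g_2(x_t)-z_{t+1})\big)\big\|^2$ for the mean variance of $H_{t+1}$ given $x_t,z_{t+1}$. Then $V_t\le\sigma_H^2$ for all $t<N$ holds with the positive constant $\sigma_H^2=2\sigma_{g_1}^2+5C_{g_1}^2\sigma_{g_2}^2+16C_{g_1}^2C_{g_2}^2D_X^2$, which does not depend on $N$. For every $\sigma_H>0$ such that $V_t\le\sigma_H^2$ for all $t<N$, with $$Q=2L_{g_1}\sigma_{g_2}^2\|\lambda^*\|+3C_{g_1}\sigma_{g_2}\|\lambda^*\|+\|\lambda^*\|\sigma_H+2L_{f_1}\sigma_{f_2}^2+3C_{f_1}\sigma_{f_2},$$ $$R=18C_{g_1}^2C_{g_2}^2\|\lambda^*\|+19C_{f_1}^2C_{f_2}^2+\tfrac{D_X^2C_{g_1}^2C_{g_2}^2+\sigma_H^2}2+\tfrac54\|x_0-x^*\|^2+\|\lambda_0-\lambda^*\|^2+Q,\qquad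 \ell=\|\lambda^*\|+1,$$ both the optimality gap and the feasibility residual are $O(1/\sqrt N)$, explicitly $$\mathbb E[F(\bar x_N)]-F(x^*)\le\frac1{\sqrt N}\Big(\tfrac54\|x_0-x^*\|^2+19C_{f_1}^2C_{f_2}^2+\tfrac{D_X^2C_{g_1}^2C_{g_2}^2+\sigma_H^2}2+2L_{f_1}\sigma_{f_2}^2+3C_{f_1}\sigma_{f_2}\Big)+\frac{4C_{g_1}^2C_{g_2}^2}{\sqrt N}\Big(\|\lambda^*\|^2+2Re^{6C_{g_1}^2C_{g_2}^2}\Big),$$ $$\begin{aligned}\mathbb E\|G(\bar x_N)_+\|\le{}&\frac1{\sqrt N}\Big(16C_{g_1}^2C_{g_2}^2\ell^2+2L_{g_1}\sigma_{g_2}^2\ell+3C_{g_1}\sigma_{g_2}\ell+\tfrac54\|x_0-x^*\|^2+19C_{f_1}^2C_{f_2}^2\Big)\\&+\frac1{\sqrt N}\Big(\tfrac{D_X^2C_{g_1}^2C_{g_2}^2+\sigma_H^2}2+\ell^2+\sigma_H\ell+2L_{f_1}\sigma_{f_2}^2+3C_{f_1}\sigma_{f_2}\Big)\\&+\frac{3C_{g_1}^2C_{g_2}^2}{\sqrt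 N}\Big(\ell+\|\lambda^*\|^2+2Re^{6C_{g_1}^2C_{g_2}^2}\Big).\end{aligned}$$ -/

import Mathlib

open MeasureTheory ProbabilityTheory

/-- Euclidean space `ℝⁿ` with its Euclidean norm. -/
abbrev Eu (n : ℕ) : Type := EuclideanSpace ℝ (Fin n)

/-- A `p × q` real matrix, as the linear map `ℝ^q → ℝ^p`; its norm is the spectral norm. -/
abbrev Mat (p q : ℕ) : Type := Eu q →L[ℝ] Eu p

/-- The transpose of a matrix. -/
noncomputable abbrev Mat.tr {p q : ℕ} (A : Mat p q) : Mat q p := ContinuousLinearMap.adjoint A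

/-- The gradient `∇g(z) ∈ ℝ^{p × q}` of `g : ℝ^p → ℝ^q`, the transpose of the Jacobian:
its `j`-th column is the gradient of the `j`-th component of `g`. -/
noncomputable def gradMat {p q : ℕ} (g : Eu p → Eu q) (z : Eu p) : Mat p q :=
  Mat.tr (fderiv ℝ g z)

/-- `A ∈ ∂h(x)` for `h : ℝ^p → ℝ^q` with convex components: the `j`-th column of `A` is a
subgradient at `x` of the `j`-th component of `h`, for every `j`. -/
def IsSubgradient {p q : ℕ} (h : Eu p → Eu q) (x : Eu p) (A : Mat p q) : Prop :=
  ∀ (j : Fin q) (u : Eu p), h x j + (Mat.tr A (u - x)) j ≤ h u j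

/-- Every component of `h` is convex on `ℝ^p`. -/
def CompConvex {p q : ℕ} (h : Eu p → Eu q) : Prop :=
  ∀ j : Fin q, ConvexOn ℝ Set.univ (fun x => h x j)

/-- The componentwise positive part `v₊ = max {v, 0}`. -/
noncomputable def posVec {n : ℕ} (v : Eu n) : Eu n := WithLp.toLp 2 (fun j => max (v j) 0)

/-- The Euclidean projection onto `X` (well defined for closed convex nonempty `X`). -/
noncomputable def projOn {n : ℕ} (X : Set (Eu n)) (v : Eu n) : Eu n :=
  Classical.epsilon (fun u => u ∈ X ∧ ∀ w ∈ X, ‖v - u‖ ≤ ‖v - w‖)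

/-- The data of a compositional expected value constrained problem
`min_{x ∈ X} f₁ (f₂ x)` subject to `g₁ (g₂ x) ≤ 0`, with its sampling oracle. The random outcomes
`ξ₁, ξ₂, ζ₁, ζ₂` live in `Ξ₁, Ξ₂, Z₁, Z₂`; the fields `s…` are what the oracle returns at a point
for a given outcome: sample values, sample gradients and sample subgradients. -/
structure CoCProblem (dx dy dz m : ℕ) (Ξ₁ Ξ₂ Z₁ Z₂ : Type*) [MeasurableSpace Ξ₁]
    [MeasurableSpace Ξ₂] [MeasurableSpace Z₁] [MeasurableSpace Z₂] where
  X : Set (Eu dx)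
  f₁ : Eu dy → ℝ
  f₂ : Eu dx → Eu dy
  g₁ : Eu dz → Eu m
  g₂ : Eu dx → Eu dz
  lawξ₁ : Measure Ξ₁
  lawξ₂ : Measure Ξ₂
  lawζ₁ : Measure Z₁
  lawζ₂ : Measure Z₂
  sf₁ : Eu dy → Ξ₁ → ℝ
  sgradf₁ : Eu dy → Ξ₁ → Eu dy
  sf₂ : Eu dx → Ξ₂ → Eu dy
  ssubf₂ : Eu dx → Ξ₂ → Mat dx dy
  sg₁ : Eu dz → Z₁ → Eu m
  sgradg₁ : Eu dz → Z₁ → Mat dz m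
  sg₂ : Eu dx → Z₂ → Eu dz
  ssubg₂ : Eu dx → Z₂ → Mat dx dz

/-- The constants `C_{f₁}, C_{f₂}, σ_{f₁}, σ_{f₂}, L_{f₁}, D_X` and
`C_{g₁}, C_{g₂}, σ_{g₁}, σ_{g₂}, L_{g₁}`. -/
structure CoCConsts where
  Cf₁ : ℝ
  Cf₂ : ℝ
  σf₁ : ℝ
  σf₂ : ℝ
  Lf₁ : ℝ
  DX : ℝ
  Cg₁ : ℝ
  Cg₂ : ℝ
  σg₁ : ℝ
  σg₂ : ℝ
  Lg₁ : ℝ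

namespace CoCProblem

variable {dx dy dz m : ℕ} {Ξ₁ Ξ₂ Z₁ Z₂ : Type*} [MeasurableSpace Ξ₁] [MeasurableSpace Ξ₂]
  [MeasurableSpace Z₁] [MeasurableSpace Z₂]

/-- The objective `F = f₁ ∘ f₂`. -/
def F (P : CoCProblem dx dy dz m Ξ₁ Ξ₂ Z₁ Z₂) (x : Eu dx) : ℝ := P.f₁ (P.f₂ x)

/-- The constraint function `G = g₁ ∘ g₂`. -/
def G (P : CoCProblem dx dy dz m Ξ₁ Ξ₂ Z₁ Z₂) (x : Eu dx) : Eu m := P.g₁ (P.g₂ x)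

/-- The Lagrangian `F(x) + ⟨G(x), lam⟩`. -/
noncomputable def lagr (P : CoCProblem dx dy dz m Ξ₁ Ξ₂ Z₁ Z₂) (x : Eu dx) (lam : Eu m) : ℝ :=
  P.F x + inner ℝ (P.G x) lam

/-- `(xs, ls)` is a saddle point of the Lagrangian on `X × ℝ₊^m`. -/
structure IsSaddle (P : CoCProblem dx dy dz m Ξ₁ Ξ₂ Z₁ Z₂) (xs : Eu dx) (ls : Eu m) : Prop where
  mem : xs ∈ P.X
  nonneg : ∀ j, 0 ≤ ls j
  le_left : ∀ lam : Eu m, (∀ j, 0 ≤ lam j) → P.lagr xs lam ≤ P.lagr xs ls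
  le_right : ∀ x ∈ P.X, P.lagr xs ls ≤ P.lagr x ls

/-- The laws are probability measures and the oracle answers are measurable. -/
structure MeasurableOracle (P : CoCProblem dx dy dz m Ξ₁ Ξ₂ Z₁ Z₂) : Prop where
  probξ₁ : IsProbabilityMeasure P.lawξ₁
  probξ₂ : IsProbabilityMeasure P.lawξ₂
  probζ₁ : IsProbabilityMeasure P.lawζ₁
  probζ₂ : IsProbabilityMeasure P.lawζ₂
  sf₁ : Measurable (Function.uncurry P.sf₁)
  sgradf₁ : Measurable (Function.uncurry P.sgradf₁)
  sf₂ : Measurable (Function.uncurry P.sf₂)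
  ssubf₂ : Measurable (Function.uncurry P.ssubf₂)
  sg₁ : Measurable (Function.uncurry P.sg₁)
  sgradg₁ : Measurable (Function.uncurry P.sgradg₁)
  sg₂ : Measurable (Function.uncurry P.sg₂)
  ssubg₂ : Measurable (Function.uncurry P.ssubg₂)

/-- Assumptions on the feasible set and on the objective. -/
structure ObjectiveAssumption (P : CoCProblem dx dy dz m Ξ₁ Ξ₂ Z₁ Z₂) (c : CoCConsts)
    (xs : Eu dx) : Prop where
  Cf₁_pos : 0 < c.Cf₁
  Cf₂_pos : 0 < c.Cf₂
  σf₁_pos : 0 < c.σf₁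
  σf₂_pos : 0 < c.σf₂
  Lf₁_pos : 0 < c.Lf₁
  DX_pos : 0 < c.DX
  X_convex : Convex ℝ P.X
  X_closed : IsClosed P.X
  X_bounded : ∀ x ∈ P.X, ‖x - xs‖ ≤ c.DX
  f₁_convex : ConvexOn ℝ Set.univ P.f₁
  f₂_convex : CompConvex P.f₂
  f₁_diff : Differentiable ℝ P.f₁
  f₁_smooth : ∀ y₁ y₂, ‖gradient P.f₁ y₁ - gradient P.f₁ y₂‖ ≤ c.Lf₁ * ‖y₁ - y₂‖
  f₂_L2 : ∀ x ∈ P.X, MemLp (P.sf₂ x) 2 P.lawξ₂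
  f₂_unbiased : ∀ x ∈ P.X, ∫ ξ, P.sf₂ x ξ ∂P.lawξ₂ = P.f₂ x
  f₂_var : ∀ x ∈ P.X, ∫ ξ, ‖P.sf₂ x ξ - P.f₂ x‖ ^ 2 ∂P.lawξ₂ ≤ c.σf₂ ^ 2
  f₁_L2 : ∀ y, MemLp (P.sf₁ y) 2 P.lawξ₁
  f₁_unbiased : ∀ y, ∫ ξ, P.sf₁ y ξ ∂P.lawξ₁ = P.f₁ y
  f₁_var : ∀ y, ∫ ξ, ‖P.sf₁ y ξ - P.f₁ y‖ ^ 2 ∂P.lawξ₁ ≤ c.σf₁ ^ 2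
  subf₂_L2 : ∀ x ∈ P.X, MemLp (P.ssubf₂ x) 2 P.lawξ₂
  subf₂_unbiased : ∀ x ∈ P.X, IsSubgradient P.f₂ x (∫ ξ, P.ssubf₂ x ξ ∂P.lawξ₂)
  subf₂_moment : ∀ x ∈ P.X, ∫ ξ, ‖P.ssubf₂ x ξ‖ ^ 2 ∂P.lawξ₂ ≤ c.Cf₂ ^ 2
  gradf₁_L2 : ∀ y, MemLp (P.sgradf₁ y) 2 P.lawξ₁
  gradf₁_unbiased : ∀ y, ∫ ξ, P.sgradf₁ y ξ ∂P.lawξ₁ = gradient P.f₁ y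
  gradf₁_moment : ∀ y, ∫ ξ, ‖P.sgradf₁ y ξ‖ ^ 2 ∂P.lawξ₁ ≤ c.Cf₁ ^ 2

/-- If `f₂` is not affine, then `∇f₁` is componentwise nonnegative everywhere. -/
def MonotoneAssumption (P : CoCProblem dx dy dz m Ξ₁ Ξ₂ Z₁ Z₂) : Prop :=
  (¬ ∃ A : Eu dx →ᵃ[ℝ] Eu dy, ∀ x, P.f₂ x = A x) → ∀ (y : Eu dy) (i : Fin dy), 0 ≤ gradient P.f₁ y i

/-- Assumptions on the compositional constraint. -/
structure ConstraintAssumption (P : CoCProblem dx dy dz m Ξ₁ Ξ₂ Z₁ Z₂) (c : CoCConsts) :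
    Prop where
  Cg₁_pos : 0 < c.Cg₁
  Cg₂_pos : 0 < c.Cg₂
  σg₁_pos : 0 < c.σg₁
  σg₂_pos : 0 < c.σg₂
  Lg₁_pos : 0 < c.Lg₁
  g₁_convex : CompConvex P.g₁
  g₂_convex : CompConvex P.g₂
  g₁_L2 : ∀ z, MemLp (P.sg₁ z) 2 P.lawζ₁
  g₁_unbiased : ∀ z, ∫ ζ, P.sg₁ z ζ ∂P.lawζ₁ = P.g₁ z
  g₁_var : ∀ z, ∫ ζ, ‖P.sg₁ z ζ - P.g₁ z‖ ^ 2 ∂P.lawζ₁ ≤ c.σg₁ ^ 2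
  g₂_L2 : ∀ x ∈ P.X, MemLp (P.sg₂ x) 2 P.lawζ₂
  g₂_unbiased : ∀ x ∈ P.X, ∫ ζ, P.sg₂ x ζ ∂P.lawζ₂ = P.g₂ x
  g₂_var : ∀ x ∈ P.X, ∫ ζ, ‖P.sg₂ x ζ - P.g₂ x‖ ^ 2 ∂P.lawζ₂ ≤ c.σg₂ ^ 2
  subg₂_L2 : ∀ x ∈ P.X, MemLp (P.ssubg₂ x) 2 P.lawζ₂
  subg₂_unbiased : ∀ x ∈ P.X, IsSubgradient P.g₂ x (∫ ζ, P.ssubg₂ x ζ ∂P.lawζ₂)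
  subg₂_moment : ∀ x ∈ P.X, ∫ ζ, ‖P.ssubg₂ x ζ‖ ^ 2 ∂P.lawζ₂ ≤ c.Cg₂ ^ 2
  gradg₁_L2 : ∀ z, MemLp (P.sgradg₁ z) 2 P.lawζ₁
  gradg₁_unbiased : ∀ z, ∫ ζ, P.sgradg₁ z ζ ∂P.lawζ₁ = gradMat P.g₁ z
  gradg₁_moment : ∀ z, ∫ ζ, ‖P.sgradg₁ z ζ‖ ^ 2 ∂P.lawζ₁ ≤ c.Cg₁ ^ 2
  g₁_diff : Differentiable ℝ P.g₁
  g₁_smooth : ∀ z₁ z₂, ‖gradMat P.g₁ z₁ - gradMat P.g₁ z₂‖ ≤ c.Lg₁ * ‖z₁ - z₂‖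
  /-- The `j`-th outer function is nondecreasing in every coordinate `i` whose inner function is
  not affine. (A coordinate on which it does not depend is harmless.) -/
  g_monotone : ∀ (j : Fin m) (i : Fin dz),
    (¬ ∃ A : Eu dx →ᵃ[ℝ] ℝ, ∀ x, P.g₂ x i = A x) →
      ∀ z : Eu dz, 0 ≤ (gradMat P.g₁ z (EuclideanSpace.single j 1)) i

end CoCProblem

/-- The outcomes drawn by the oracle in one iteration, in the order
`ξ₂⁰, ξ₂¹, ξ₁⁰, ζ₂⁰, ζ₂¹, ζ₂², ζ₁⁰, ζ₁¹`. -/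
abbrev Draw (Ξ₁ Ξ₂ Z₁ Z₂ : Type*) : Type _ := Ξ₂ × Ξ₂ × Ξ₁ × Z₂ × Z₂ × Z₂ × Z₁ × Z₁

namespace Draw

variable {Ξ₁ Ξ₂ Z₁ Z₂ : Type*}

def ξ₂0 (s : Draw Ξ₁ Ξ₂ Z₁ Z₂) : Ξ₂ := s.1
def ξ₂1 (s : Draw Ξ₁ Ξ₂ Z₁ Z₂) : Ξ₂ := s.2.1
def ξ₁0 (s : Draw Ξ₁ Ξ₂ Z₁ Z₂) : Ξ₁ := s.2.2.1
def ζ₂0 (s : Draw Ξ₁ Ξ₂ Z₁ Z₂) : Z₂ := s.2.2.2.1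
def ζ₂1 (s : Draw Ξ₁ Ξ₂ Z₁ Z₂) : Z₂ := s.2.2.2.2.1
def ζ₂2 (s : Draw Ξ₁ Ξ₂ Z₁ Z₂) : Z₂ := s.2.2.2.2.2.1
def ζ₁0 (s : Draw Ξ₁ Ξ₂ Z₁ Z₂) : Z₁ := s.2.2.2.2.2.2.1
def ζ₁1 (s : Draw Ξ₁ Ξ₂ Z₁ Z₂) : Z₁ := s.2.2.2.2.2.2.2

end Draw

/-- The variables `(x_t, y_t, z_t, lam_t)` of the algorithm. -/
structure CoCState (dx dy dz m : ℕ) where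
  x : Eu dx
  y : Eu dy
  z : Eu dz
  lam : Eu m

namespace CoCProblem

variable {dx dy dz m : ℕ} {Ξ₁ Ξ₂ Z₁ Z₂ : Type*} [MeasurableSpace Ξ₁] [MeasurableSpace Ξ₂]
  [MeasurableSpace Z₁] [MeasurableSpace Z₂]

/-- The law of the outcomes of one iteration: all eight are independent of each other. -/
noncomputable def drawLaw (P : CoCProblem dx dy dz m Ξ₁ Ξ₂ Z₁ Z₂) : Measure (Draw Ξ₁ Ξ₂ Z₁ Z₂) :=
  P.lawξ₂.prod (P.lawξ₂.prod (P.lawξ₁.prod (P.lawζ₂.prod (P.lawζ₂.prod (P.lawζ₂.prod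
    (P.lawζ₁.prod P.lawζ₁))))))

/-- The outcomes of the successive iterations are i.i.d. with law `drawLaw`, so all oracle
queries are mutually independent. -/
structure IsSampling (P : CoCProblem dx dy dz m Ξ₁ Ξ₂ Z₁ Z₂) {Ω : Type*} [MeasurableSpace Ω]
    (μ : Measure Ω) (S : ℕ → Ω → Draw Ξ₁ Ξ₂ Z₁ Z₂) : Prop where
  meas : ∀ t, Measurable (S t)
  indep : iIndepFun S μ
  law : ∀ t, μ.map (S t) = P.drawLaw

/-- `y_{t+1} = (f₂(x_t, ξ₂¹) + τ_t y_t) / (1 + τ_t)`. -/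
noncomputable def nextY (P : CoCProblem dx dy dz m Ξ₁ Ξ₂ Z₁ Z₂) (τ : ℝ)
    (st : CoCState dx dy dz m) (s : Draw Ξ₁ Ξ₂ Z₁ Z₂) : Eu dy :=
  (1 + τ)⁻¹ • (P.sf₂ st.x s.ξ₂1 + τ • st.y)

/-- `z_{t+1} = (g₂(x_t, ζ₂¹) + ρ_t z_t) / (1 + ρ_t)`. -/
noncomputable def nextZ (P : CoCProblem dx dy dz m Ξ₁ Ξ₂ Z₁ Z₂) (ρ : ℝ)
    (st : CoCState dx dy dz m) (s : Draw Ξ₁ Ξ₂ Z₁ Z₂) : Eu dz :=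
  (1 + ρ)⁻¹ • (P.sg₂ st.x s.ζ₂1 + ρ • st.z)

/-- `x_{t+1} = Proj_X [x_t - (∂f₂(x_t, ξ₂⁰) ∇f₁(y_{t+1}, ξ₁⁰)
  + ∂g₂(x_t, ζ₂⁰) ∇g₁(z_{t+1}, ζ₁⁰) lam_t) / η_t]`. -/
noncomputable def nextX (P : CoCProblem dx dy dz m Ξ₁ Ξ₂ Z₁ Z₂) (η τ ρ : ℝ)
    (st : CoCState dx dy dz m) (s : Draw Ξ₁ Ξ₂ Z₁ Z₂) : Eu dx :=
  projOn P.X (st.x - η⁻¹ •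
    (P.ssubf₂ st.x s.ξ₂0 (P.sgradf₁ (P.nextY τ st s) s.ξ₁0)
      + P.ssubg₂ st.x s.ζ₂0 (P.sgradg₁ (P.nextZ ρ st s) s.ζ₁0 st.lam)))

/-- `H_{t+1} = g₁(z_{t+1}, ζ₁¹) - ∇g₁(z_{t+1}, ζ₁¹)ᵀ z_{t+1} + ∇g₁(z_{t+1}, ζ₁¹)ᵀ g₂(x_t, ζ₂²)`. -/
noncomputable def nextH (P : CoCProblem dx dy dz m Ξ₁ Ξ₂ Z₁ Z₂) (ρ : ℝ)
    (st : CoCState dx dy dz m) (s : Draw Ξ₁ Ξ₂ Z₁ Z₂) : Eu m :=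
  P.sg₁ (P.nextZ ρ st s) s.ζ₁1
    - Mat.tr (P.sgradg₁ (P.nextZ ρ st s) s.ζ₁1) (P.nextZ ρ st s)
    + Mat.tr (P.sgradg₁ (P.nextZ ρ st s) s.ζ₁1) (P.sg₂ st.x s.ζ₂2)

/-- `lam_{t+1} = [lam_t + H_{t+1} / α_t]₊`. -/
noncomputable def nextLam (P : CoCProblem dx dy dz m Ξ₁ Ξ₂ Z₁ Z₂) (α ρ : ℝ)
    (st : CoCState dx dy dz m) (s : Draw Ξ₁ Ξ₂ Z₁ Z₂) : Eu m :=
  posVec (st.lam + α⁻¹ • P.nextH ρ st s)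

/-- The iterates of CC-SCGD with step sizes `α, η, τ, ρ`, started at `x₀`, `y₀ = 0`, `z₀ = 0`,
`lam₀`, when the oracle draws the outcomes `s 0, s 1, …`; iteration `t = 0, 1, …` turns the state
number `t` into the state number `t + 1`. -/
noncomputable def iter (P : CoCProblem dx dy dz m Ξ₁ Ξ₂ Z₁ Z₂) (α η τ ρ : ℕ → ℝ)
    (x₀ : Eu dx) (lam₀ : Eu m) (s : ℕ → Draw Ξ₁ Ξ₂ Z₁ Z₂) : ℕ → CoCState dx dy dz m
  | 0 => ⟨x₀, 0, 0, lam₀⟩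
  | t + 1 =>
    let st := P.iter α η τ ρ x₀ lam₀ s t
    ⟨P.nextX (η t) (τ t) (ρ t) st (s t), P.nextY (τ t) st (s t), P.nextZ (ρ t) st (s t),
      P.nextLam (α t) (ρ t) st (s t)⟩

/-- The output `x̄_N = (1/N) ∑_{t=1}^N x_t`. -/
noncomputable def xbar (P : CoCProblem dx dy dz m Ξ₁ Ξ₂ Z₁ Z₂) (α η τ ρ : ℕ → ℝ)
    (x₀ : Eu dx) (lam₀ : Eu m) (s : ℕ → Draw Ξ₁ Ξ₂ Z₁ Z₂) (N : ℕ) : Eu dx :=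
  (N : ℝ)⁻¹ • ∑ t ∈ Finset.Icc 1 N, (P.iter α η τ ρ x₀ lam₀ s t).x

/-- The value at `x` of the linearisation `g₁(z) + ∇g₁(z)ᵀ (g₂(x) - z)` of the constraint. It is
the composite Lagrangian `v₁ᵀ (v₂ᵀ x - g₂*(v₂)) - g₁*(v₁)` for `v₁ = ∇g₁(z)`, `v₂ ∈ ∂g₂(x)`,
and for `x = x_t`, `z = z_{t+1}` it is the conditional mean of `H_{t+1}` given `x_t, z_{t+1}`. -/
noncomputable def linG (P : CoCProblem dx dy dz m Ξ₁ Ξ₂ Z₁ Z₂) (x : Eu dx) (z : Eu dz) : Eu m :=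
  P.g₁ z + Mat.tr (gradMat P.g₁ z) (P.g₂ x - z)

/-- The mean variance `𝔼 ‖H_{t+1} - 𝔼[H_{t+1} | x_t, z_{t+1}]‖²`, in `[0, ∞]`. -/
noncomputable def varH (P : CoCProblem dx dy dz m Ξ₁ Ξ₂ Z₁ Z₂) (α η τ ρ : ℕ → ℝ)
    (x₀ : Eu dx) (lam₀ : Eu m) {Ω : Type*} [MeasurableSpace Ω] (μ : Measure Ω)
    (S : ℕ → Ω → Draw Ξ₁ Ξ₂ Z₁ Z₂) (t : ℕ) : ENNReal :=
  ∫⁻ ω, ‖P.nextH (ρ t) (P.iter α η τ ρ x₀ lam₀ (fun k => S k ω) t) (S t ω)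
      - P.linG (P.iter α η τ ρ x₀ lam₀ (fun k => S k ω) t).x
          (P.iter α η τ ρ x₀ lam₀ (fun k => S k ω) (t + 1)).z‖ₑ ^ 2 ∂μ

end CoCProblem

namespace CoCConsts

/-- An admissible value of the variance constant `σ_H`:
`σ_H² = 2 σ_{g₁}² + 5 C_{g₁}² σ_{g₂}² + 16 C_{g₁}² C_{g₂}² D_X²`. -/
noncomputable def sigmaH (c : CoCConsts) : ℝ :=
  √(2 * c.σg₁ ^ 2 + 5 * c.Cg₁ ^ 2 * c.σg₂ ^ 2 + 16 * c.Cg₁ ^ 2 * c.Cg₂ ^ 2 * c.DX ^ 2)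

/-- The constant `Q`, as a function of `σ_H` and `‖λ*‖`. -/
noncomputable def Q (c : CoCConsts) (σH nls : ℝ) : ℝ :=
  2 * c.Lg₁ * c.σg₂ ^ 2 * nls + 3 * c.Cg₁ * c.σg₂ * nls + nls * σH + 2 * c.Lf₁ * c.σf₂ ^ 2
    + 3 * c.Cf₁ * c.σf₂

/-- The constant `R`, as a function of `σ_H`, `‖λ*‖`, `‖x₀ - x*‖` and `‖λ₀ - λ*‖`. -/
noncomputable def R (c : CoCConsts) (σH nls dist_x dist_l : ℝ) : ℝ :=
  18 * c.Cg₁ ^ 2 * c.Cg₂ ^ 2 * nls + 19 * c.Cf₁ ^ 2 * c.Cf₂ ^ 2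
    + (c.DX ^ 2 * c.Cg₁ ^ 2 * c.Cg₂ ^ 2 + σH ^ 2) / 2
    + 5 / 4 * dist_x ^ 2 + dist_l ^ 2 + c.Q σH nls

end CoCConsts

/-! The core is a pathwise inequality in which the comparison multiplier w ≥ 0 is free and may even
be random. It bounds T (F(x̄) - F(x*) + ⟨w, G(x̄)⟩), where x̄ averages the first T primal iterates,
and it retains √N ‖λ_T - w‖² on the left.

To obtain it, the outer functions f₁ and ⟨w, g₁⟩ are replaced by their linearisations at the tracked
points y_{t+1}, z_{t+1}. With the weights t/2 the tracking recursion telescopes: the sum of the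
linearisations taken at these moving points dominates the sum taken at any single fixed point
(`sum_linAt_le`). Taking the inner value of x̄ as the fixed point, and applying Jensen to the inner
function weighted by the outer gradient, bounds the composite value at x̄ by the moving
linearisations, the lengths of the primal steps and accumulated sampling errors (`sum_comp_le`). The
monotonicity assumptions enter by making the weighted inner functions convex.

The moving linearisations are controlled by one primal-dual step (`step_le`). In the dual step the
linearised constraint is split as its value at g₂(x*), which is at most G(x*) ≤ 0 and can be
discarded because multipliers stay nonnegative, plus a remainder of norm at most C_{g₁} C_{g₂} D_X.
Hence no bound on G or on the multipliers is required. The remainder paired with λ_t is dominated by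
the constraint part of the mean primal direction, so it cancels against the primal step. Summation
gives `path_bound`.

In expectation, a sampling error tested against something known before its draw vanishes. Tests
against quantities that depend on the whole path, namely the outer gradient at x̄ and the multiplier
w, are pulled out of the sum and cost the norm of a sum of orthogonal increments, of order √N. The
outer gradient at y_{t+1} depends on the current error, and smoothness lets it be replaced by a
gradient that does not, at a cost proportional to (1 + t/2)⁻¹.

The inequality is used with three choices of w. For w = λ*, the saddle property makes the left side
at least √N ‖λ_T - λ*‖², and Grönwall bounds the multipliers in mean square
(`integral_norm_L_sub_sq_le`). For w = 0 it gives the optimality gap. For w of length ‖λ*‖ + 1 in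
the direction of G(x̄)₊ it gives the feasibility residual, since F(x̄) - F(x*) ≥ -‖λ*‖ ‖G(x̄)₊‖. -/

/-! ### Weighted subgradients and linearisations. -/

/-- Every coordinate of `v` is nonnegative unless the same component of `h` is affine. -/
def AdmissibleWeight {p q : ℕ} (h : Eu p → Eu q) (v : Eu q) : Prop :=
  ∀ i, 0 ≤ v i ∨ ∃ A : Eu p →ᵃ[ℝ] ℝ, ∀ x, h x i = A x

/-- The linearisation of `φ` at `a`. -/
noncomputable def linAt {q : ℕ} (φ : Eu q → ℝ) (a w : Eu q) : ℝ :=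
  φ a + inner ℝ (gradient φ a) (w - a)

lemma inner_eq_sum_coord {q : ℕ} (v w : Eu q) : inner ℝ v w = ∑ i, v i * w i := by
  simp [PiLp.inner_apply, mul_comm]

lemma norm_le_of_coord_le {q : ℕ} {v w : Eu q} (h0 : ∀ j, 0 ≤ v j) (h : ∀ j, v j ≤ w j) :
    ‖v‖ ≤ ‖w‖ := by
  rw [EuclideanSpace.norm_eq, EuclideanSpace.norm_eq]
  refine Real.sqrt_le_sqrt (Finset.sum_le_sum fun j _ => ?_)
  rw [Real.norm_of_nonneg (h0 j), Real.norm_of_nonneg ((h0 j).trans (h j))]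
  exact pow_le_pow_left₀ (h0 j) (h j) 2

lemma inner_nonpos_of_coord {q : ℕ} {v w : Eu q} (hv : ∀ j, v j ≤ 0) (hw : ∀ j, 0 ≤ w j) :
    inner ℝ v w ≤ 0 := by
  rw [inner_eq_sum_coord]
  exact Finset.sum_nonpos fun j _ => mul_nonpos_of_nonpos_of_nonneg (hv j) (hw j)

lemma inner_mat_apply {p q : ℕ} (A : Mat p q) (v : Eu q) (d : Eu p) :
    inner ℝ (A v) d = inner ℝ v (Mat.tr A d) :=
  (ContinuousLinearMap.adjoint_inner_right A v d).symm

lemma norm_tr_le {p q : ℕ} (A : Mat p q) (d : Eu p) : ‖Mat.tr A d‖ ≤ ‖A‖ * ‖d‖ := by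
  have := (Mat.tr A).le_opNorm d
  rwa [Mat.tr, LinearIsometryEquiv.norm_map] at this

/-- Reflecting u through x turns the subgradient inequality at 2x - u into the reverse inequality at
u, because an affine function is odd about x up to a constant. -/
lemma IsSubgradient.eq_of_affine {p q : ℕ} {h : Eu p → Eu q} {x : Eu p} {A : Mat p q}
    (hA : IsSubgradient h x A) {i : Fin q} {a : Eu p →ᵃ[ℝ] ℝ} (ha : ∀ x, h x i = a x) (u : Eu p) :
    h u i = h x i + (Mat.tr A (u - x)) i := by
  refine le_antisymm ?_ (hA i u)
  have h1 := hA i (x - (u - x))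
  have h2 : x - (u - x) - x = -(u - x) := by abel
  rw [h2, map_neg, PiLp.neg_apply] at h1
  have h3 : a (x - (u - x)) = 2 * a x - a u := by
    have e1 : a (x - (u - x)) = a (-(u - x) +ᵥ x) := by congr 1; simp [sub_eq_add_neg, add_comm]
    have e2 : a u = a ((u - x) +ᵥ x) := by congr 1; simp
    rw [e1, e2, a.map_vadd, a.map_vadd, map_neg]
    simp only [vadd_eq_add]; ring
  rw [ha] at h1 ⊢
  rw [ha, h3] at h1
  rw [ha]
  linarith

/-- A nonnegative weight preserves the subgradient inequality of its coordinate; a weight of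
arbitrary sign is harmless on an affine coordinate, where that inequality is an equality. -/
lemma IsSubgradient.inner_le {p q : ℕ} {h : Eu p → Eu q} {x : Eu p} {A : Mat p q}
    (hA : IsSubgradient h x A) {v : Eu q} (hv : AdmissibleWeight h v) (u : Eu p) :
    inner ℝ (A v) (u - x) ≤ inner ℝ v (h u - h x) := by
  rw [inner_mat_apply, inner_eq_sum_coord, inner_eq_sum_coord]
  refine Finset.sum_le_sum fun i _ => ?_
  rcases hv i with h0 | ⟨a, ha⟩
  · refine mul_le_mul_of_nonneg_left ?_ h0
    have := hA i u
    simp only [PiLp.sub_apply]; linarith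
  · have := hA.eq_of_affine ha u
    simp only [PiLp.sub_apply]; rw [this]; apply le_of_eq; ring

lemma AdmissibleWeight.convexOn_inner {p q : ℕ} {h : Eu p → Eu q} (hh : CompConvex h) {v : Eu q}
    (hv : AdmissibleWeight h v) : ConvexOn ℝ Set.univ (fun x => inner ℝ v (h x)) := by
  simp only [inner_eq_sum_coord]
  have key : ∀ s : Finset (Fin q), ConvexOn ℝ Set.univ (fun x => ∑ i ∈ s, v i * h x i) := by
    intro s
    induction s using Finset.induction_on with
    | empty => simpa using convexOn_const (0 : ℝ) convex_univ
    | insert i s hi ih =>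
      simp only [Finset.sum_insert hi]
      refine ConvexOn.add ?_ ih
      rcases hv i with h0 | ⟨a, ha⟩
      · exact (hh i).smul h0
      · refine ⟨convex_univ, fun x _ y _ b c _ _ hbc => le_of_eq ?_⟩
        simp only [ha]
        rw [Convex.combo_affine_apply hbc]
        simp only [smul_eq_mul]; ring
  exact key Finset.univ

lemma linAt_le {q : ℕ} {φ : Eu q → ℝ} (hφ : ConvexOn ℝ Set.univ φ) (hd : Differentiable ℝ φ)
    (a w : Eu q) : linAt φ a w ≤ φ w := by
  -- The gradient inequality reduces to one variable: on the segment from a to w, the derivative at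
  -- 0 is at most the slope of the chord over [0, 1].
  have hline : ConvexOn ℝ Set.univ (fun t : ℝ => φ (AffineMap.lineMap a w t)) := by
    have := hφ.comp_affineMap (AffineMap.lineMap a w)
    rwa [Set.preimage_univ] at this
  have hder : HasDerivAt (fun t : ℝ => φ (AffineMap.lineMap a w t))
      (inner ℝ (gradient φ a) (w - a)) 0 := by
    have h1 : HasFDerivAt φ (fderiv ℝ φ a) (AffineMap.lineMap a w (0 : ℝ)) := by
      simpa using (hd a).hasFDerivAt
    have h2 : HasDerivAt (fun t : ℝ => AffineMap.lineMap a w t) (w - a) (0 : ℝ) :=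
      AffineMap.hasDerivAt_lineMap
    have h3 := h1.comp_hasDerivAt (0 : ℝ) h2
    have h4 : inner ℝ (gradient φ a) (w - a) = fderiv ℝ φ a (w - a) := by
      rw [gradient, InnerProductSpace.toDual_symm_apply]
    rw [h4]; exact h3
  have := hline.le_slope_of_hasDerivAt (Set.mem_univ 0) (Set.mem_univ 1) one_pos hder
  rw [slope_def_field] at this
  simp only [AffineMap.lineMap_apply_one, AffineMap.lineMap_apply_zero, sub_zero, div_one] at this
  unfold linAt; linarith

/-! ### The tracking recursion and the composite gap. -/

/-- Averaging steps with weights `τ_t = t/2` never lose against a fixed linearisation. -/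
lemma sum_linAt_le {q : ℕ} {φ : Eu q → ℝ} (hφ : ConvexOn ℝ Set.univ φ)
    (hd : Differentiable ℝ φ) (a : Eu q) (s y : ℕ → Eu q) (T : ℕ)
    (hy : ∀ t < T, y (t + 1) = (1 + (t : ℝ) / 2)⁻¹ • (s t + ((t : ℝ) / 2) • y t)) :
    ∑ t ∈ Finset.range T, linAt φ a (s t) ≤
      ∑ t ∈ Finset.range T, linAt φ (y (t + 1)) (s t) := by
  -- The potential (n/2)(φ(y_n) - linAt φ a (y_n)) is nonnegative and starts at 0. Writing s_n as (1
  -- + n/2) y_{n+1} - (n/2) y_n, the only estimate needed to pass to n + 1 is linAt φ (y_{n+1})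
  -- (y_n) ≤ φ(y_n). The new potential then appears with coefficient 1 + n/2, which exceeds the
  -- required (n + 1)/2.
  have key : ∀ n ≤ T, ∑ t ∈ Finset.range n, (linAt φ a (s t) - linAt φ (y (t + 1)) (s t))
      + (n : ℝ) / 2 * (φ (y n) - linAt φ a (y n)) ≤ 0 := by
    intro n
    induction n with
    | zero => intro _; simp
    | succ n ih =>
      intro hn
      have ih' := ih (by omega)
      rw [Finset.sum_range_succ]
      have hn0 : (0 : ℝ) ≤ n := Nat.cast_nonneg n
      have hne : (1 + (n : ℝ) / 2) ≠ 0 := by positivity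
      have hs : s n = (1 + (n : ℝ) / 2) • y (n + 1) - ((n : ℝ) / 2) • y n := by
        rw [hy n (by omega), smul_smul, mul_inv_cancel₀ hne, one_smul, add_sub_cancel_right]
      have lin : ∀ b : Eu q, linAt φ b (s n) =
          (1 + (n : ℝ) / 2) * linAt φ b (y (n + 1)) - (n : ℝ) / 2 * linAt φ b (y n) := by
        intro b
        simp only [linAt, hs, inner_sub_right, inner_smul_right]; ring
      have l1 : linAt φ (y (n + 1)) (y (n + 1)) = φ (y (n + 1)) := by simp [linAt]
      have l2 := linAt_le hφ hd (y (n + 1)) (y n)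
      have l3 := linAt_le hφ hd a (y (n + 1))
      rw [lin a, lin (y (n + 1)), l1]
      push_cast
      nlinarith [mul_nonneg hn0 (sub_nonneg.2 l2)]
  have h := key T le_rfl
  have h2 : 0 ≤ (T : ℝ) / 2 * (φ (y T) - linAt φ a (y T)) :=
    mul_nonneg (by positivity) (sub_nonneg.2 (linAt_le hφ hd a (y T)))
  rw [Finset.sum_sub_distrib] at h
  linarith

/-- The compositional gap of the averaged point, for one outer function `φ`. -/
lemma sum_comp_le {p q : ℕ} {φ : Eu q → ℝ} (hφ : ConvexOn ℝ Set.univ φ)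
    (hd : Differentiable ℝ φ) {h : Eu p → Eu q} (hh : CompConvex h)
    (hadm : ∀ a, AdmissibleWeight h (gradient φ a)) {C C₂ : ℝ} (hC0 : 0 ≤ C)
    (hC : ∀ a, ‖gradient φ a‖ ≤ C)
    {X : Set (Eu p)} (hL : ∀ u ∈ X, ∀ w ∈ X, ‖h u - h w‖ ≤ C₂ * ‖u - w‖)
    (x : ℕ → Eu p) (hx : ∀ t, x t ∈ X) (e y : ℕ → Eu q) (T : ℕ)
    (hy : ∀ t < T, y (t + 1) = (1 + (t : ℝ) / 2)⁻¹ • (h (x t) + e t + ((t : ℝ) / 2) • y t)) :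
    (T : ℝ) * φ (h ((T : ℝ)⁻¹ • ∑ t ∈ Finset.range T, x (t + 1))) ≤
      ∑ t ∈ Finset.range T, (linAt φ (y (t + 1)) (h (x t))
        + inner ℝ (gradient φ (y (t + 1))) (e t) + C * C₂ * ‖x (t + 1) - x t‖)
      + C * ‖∑ t ∈ Finset.range T, e t‖ := by
  rcases Nat.eq_zero_or_pos T with rfl | hT
  · simp
  have hT' : (0 : ℝ) < T := Nat.cast_pos.2 hT
  set xb := (T : ℝ)⁻¹ • ∑ t ∈ Finset.range T, x (t + 1) with hxb
  -- The fixed comparison point is the inner value at the average, where the linearisation is exact.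
  -- It depends on the whole sequence.
  set a := h xb
  have hconv := (hadm a).convexOn_inner hh
  have jensen : (T : ℝ) * inner ℝ (gradient φ a) (h xb) ≤
      ∑ t ∈ Finset.range T, inner ℝ (gradient φ a) (h (x (t + 1))) := by
    have := hconv.map_sum_le (t := Finset.range T) (w := fun _ => (T : ℝ)⁻¹)
      (p := fun t => x (t + 1)) (fun _ _ => by positivity)
      (by simp [hT'.ne']) (fun _ _ => Set.mem_univ _)
    rw [← Finset.smul_sum, ← hxb] at this
    simp only [smul_eq_mul, ← Finset.mul_sum] at this
    calc _ ≤ (T : ℝ) * ((T : ℝ)⁻¹ * ∑ t ∈ Finset.range T, inner ℝ (gradient φ a) (h (x (t + 1)))) :=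
          mul_le_mul_of_nonneg_left this hT'.le
      _ = _ := by rw [← mul_assoc, mul_inv_cancel₀ hT'.ne', one_mul]
  have main := sum_linAt_le hφ hd a (fun t => h (x t) + e t) y T hy
  have e1 : ∀ t, linAt φ a (h (x t) + e t) = φ a - inner ℝ (gradient φ a) a
      + inner ℝ (gradient φ a) (h (x (t + 1)))
      - inner ℝ (gradient φ a) (h (x (t + 1)) - h (x t)) + inner ℝ (gradient φ a) (e t) := by
    intro t; simp only [linAt, inner_sub_right, inner_add_right]; ring
  have e2 : ∀ t, linAt φ (y (t + 1)) (h (x t) + e t) =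
      linAt φ (y (t + 1)) (h (x t)) + inner ℝ (gradient φ (y (t + 1))) (e t) := by
    intro t; simp only [linAt, inner_sub_right, inner_add_right]; ring
  simp only [e1, e2, Finset.sum_add_distrib, Finset.sum_sub_distrib, Finset.sum_const,
    Finset.card_range, nsmul_eq_mul] at main
  -- Jensen produces h at x_{t+1} while the recursion feeds in h at x_t; the shift costs the length
  -- of the step.
  have m1 : ∑ t ∈ Finset.range T, inner ℝ (gradient φ a) (h (x (t + 1)) - h (x t)) ≤
      ∑ t ∈ Finset.range T, C * C₂ * ‖x (t + 1) - x t‖ := by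
    refine Finset.sum_le_sum fun t _ => (real_inner_le_norm _ _).trans ?_
    rw [mul_assoc]
    exact mul_le_mul (hC a) (hL _ (hx _) _ (hx _)) (norm_nonneg _) hC0
  -- The gradient at a is the same for all t, so it leaves the sum and only the norm of the
  -- accumulated error remains.
  have m2 : -(C * ‖∑ t ∈ Finset.range T, e t‖) ≤
      ∑ t ∈ Finset.range T, inner ℝ (gradient φ a) (e t) := by
    rw [← inner_sum]
    have := (abs_real_inner_le_norm (gradient φ a) (∑ t ∈ Finset.range T, e t)).trans
      (mul_le_mul_of_nonneg_right (hC a) (norm_nonneg _))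
    exact (abs_le.1 this).1
  rw [Finset.sum_add_distrib, Finset.sum_add_distrib]
  linarith

/-- Along a fine partition of the segment, each increment of h lies between the subgradients at the
two endpoints of its piece, coordinate by coordinate. The differences telescope, so the total defect
has norm O(1/n), and what is left is an average of vectors of norm at most C‖u - w‖. Working with
whole vectors keeps the spectral constant C; coordinatewise Lipschitz bounds would bring in a
dimensional factor. -/
lemma lipschitz_of_subgradient {p q : ℕ} {h : Eu p → Eu q} {X : Set (Eu p)} (hX : Convex ℝ X)
    {A : Eu p → Mat p q} {C : ℝ} (hA : ∀ x ∈ X, IsSubgradient h x (A x))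
    (hC : ∀ x ∈ X, ‖A x‖ ≤ C) {u w : Eu p} (hu : u ∈ X) (hw : w ∈ X) :
    ‖h u - h w‖ ≤ C * ‖u - w‖ := by
  set v := u - w with hv
  have hC0 : 0 ≤ C := (norm_nonneg _).trans (hC u hu)
  have step : ∀ n : ℕ, 0 < n → ‖h u - h w‖ ≤ C * ‖v‖ + 2 * (C * ‖v‖) * (n : ℝ)⁻¹ := by
    intro n hn
    have hn' : (0 : ℝ) < n := Nat.cast_pos.2 hn
    let c : ℕ → Eu p := fun k => w + ((k : ℝ) / n) • v
    have hc : ∀ k ≤ n, c k ∈ X := by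
      intro k hk
      exact hX.add_smul_sub_mem hw hu ⟨by positivity, div_le_one_of_le₀ (by exact_mod_cast hk) hn'.le⟩
    have hcs : ∀ k, c (k + 1) - c k = (n : ℝ)⁻¹ • v := by
      intro k
      simp only [c, add_sub_add_left_eq_sub, ← sub_smul]
      congr 1; push_cast; field_simp; ring
    let Q : ℕ → Eu q := fun k => Mat.tr (A (c k)) v
    have hQ : ∀ k ≤ n, ‖Q k‖ ≤ C * ‖v‖ := fun k hk =>
      (norm_tr_le _ _).trans (mul_le_mul_of_nonneg_right (hC _ (hc k hk)) (norm_nonneg _))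
    have low : ∀ k < n, ∀ j, 0 ≤ (h (c (k + 1)) - h (c k) - (n : ℝ)⁻¹ • Q k) j := by
      intro k hk j
      have := hA _ (hc k hk.le) j (c (k + 1))
      rw [hcs, map_smul, PiLp.smul_apply] at this
      simp only [PiLp.sub_apply, PiLp.smul_apply, Q]; linarith
    have high : ∀ k < n, ∀ j, (h (c (k + 1)) - h (c k) - (n : ℝ)⁻¹ • Q k) j ≤
        ((n : ℝ)⁻¹ • (Q (k + 1) - Q k)) j := by
      intro k hk j
      have := hA _ (hc (k + 1) hk) j (c k)
      rw [← neg_sub (c (k + 1)) (c k), hcs, map_neg, map_smul, PiLp.neg_apply,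
        PiLp.smul_apply] at this
      simp only [PiLp.sub_apply, PiLp.smul_apply, Q, smul_eq_mul] at this ⊢; linarith
    set r : Eu q := ∑ k ∈ Finset.range n, (h (c (k + 1)) - h (c k) - (n : ℝ)⁻¹ • Q k) with hr
    -- The defect has nonnegative coordinates bounded by those of the telescoped difference, so the
    -- norms compare as well.
    have hr2 : ‖r‖ ≤ ‖(n : ℝ)⁻¹ • (Q n - Q 0)‖ := by
      refine norm_le_of_coord_le (fun j => ?_) (fun j => ?_)
      · rw [hr, WithLp.ofLp_sum, Finset.sum_apply]
        exact Finset.sum_nonneg fun k hk => low k (Finset.mem_range.1 hk) j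
      · rw [← Finset.sum_range_sub, Finset.smul_sum, hr, WithLp.ofLp_sum, Finset.sum_apply,
          WithLp.ofLp_sum, Finset.sum_apply]
        exact Finset.sum_le_sum fun k hk => high k (Finset.mem_range.1 hk) j
    have hsum : h u - h w = r + (n : ℝ)⁻¹ • ∑ k ∈ Finset.range n, Q k := by
      rw [hr, Finset.sum_sub_distrib, Finset.sum_range_sub (fun k => h (c k)), ← Finset.smul_sum,
        sub_add_cancel]
      simp [c, hn'.ne', hv]
    rw [hsum]
    have b1 : ‖(n : ℝ)⁻¹ • ∑ k ∈ Finset.range n, Q k‖ ≤ C * ‖v‖ := by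
      rw [norm_smul, Real.norm_of_nonneg (by positivity)]
      have : ‖∑ k ∈ Finset.range n, Q k‖ ≤ n * (C * ‖v‖) := by
        refine (norm_sum_le _ _).trans ((Finset.sum_le_sum fun k hk =>
          hQ k (Finset.mem_range.1 hk).le).trans (le_of_eq (by simp)))
      calc _ ≤ (n : ℝ)⁻¹ * (n * (C * ‖v‖)) := by gcongr
        _ = _ := by field_simp
    have b2 : ‖(n : ℝ)⁻¹ • (Q n - Q 0)‖ ≤ 2 * (C * ‖v‖) * (n : ℝ)⁻¹ := by
      rw [norm_smul, Real.norm_of_nonneg (by positivity), mul_comm]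
      gcongr
      refine (norm_sub_le _ _).trans ?_
      linarith [hQ n le_rfl, hQ 0 (Nat.zero_le _)]
    linarith [norm_add_le r ((n : ℝ)⁻¹ • ∑ k ∈ Finset.range n, Q k)]
  have lim : Filter.Tendsto (fun n : ℕ => C * ‖v‖ + 2 * (C * ‖v‖) * (n : ℝ)⁻¹) Filter.atTop
      (nhds (C * ‖v‖ + 2 * (C * ‖v‖) * 0)) :=
    (tendsto_const_nhds).add (tendsto_inv_atTop_nhds_zero_nat.const_mul _)
  have := ge_of_tendsto lim (Filter.eventually_atTop.2 ⟨1, fun n hn => step n hn⟩)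
  simpa using this

/-! ### Projection, and the primal and dual one-step inequalities. -/

lemma projOn_spec {n : ℕ} {X : Set (Eu n)} (hne : X.Nonempty) (hcl : IsClosed X)
    (hc : Convex ℝ X) (v : Eu n) :
    projOn X v ∈ X ∧ ∀ w ∈ X, inner ℝ (v - projOn X v) (w - projOn X v) ≤ 0 := by
  have hex : ∃ u, u ∈ X ∧ ∀ w ∈ X, ‖v - u‖ ≤ ‖v - w‖ := by
    obtain ⟨u, hu, h⟩ := hcl.exists_infDist_eq_dist hne v
    refine ⟨u, hu, fun w hw => ?_⟩
    rw [← dist_eq_norm, ← dist_eq_norm, ← h]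
    exact Metric.infDist_le_dist_of_mem hw
  have hs := Classical.epsilon_spec hex
  -- The minimal distance property is converted into the variational inequality by convexity.
  refine ⟨hs.1, (norm_eq_iInf_iff_real_inner_le_zero hc hs.1).1 ?_⟩
  have : Nonempty X := hne.to_subtype
  refine le_antisymm (le_ciInf fun w => hs.2 w w.2) ?_
  exact ciInf_le (f := fun w : X => ‖v - w‖) ⟨0, by rintro _ ⟨w, rfl⟩; exact norm_nonneg _⟩ ⟨_, hs.1⟩

/-- Adding the variational inequalities at the two projections gives nonexpansiveness. Continuity
serves only to make the iterates measurable. -/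
lemma continuous_projOn {n : ℕ} {X : Set (Eu n)} (hne : X.Nonempty) (hcl : IsClosed X)
    (hc : Convex ℝ X) : Continuous (projOn X) := by
  refine (LipschitzWith.of_dist_le_mul (K := 1) fun v w => ?_).continuous
  have h1 := (projOn_spec hne hcl hc v).2 _ (projOn_spec hne hcl hc w).1
  have h2 := (projOn_spec hne hcl hc w).2 _ (projOn_spec hne hcl hc v).1
  rw [NNReal.coe_one, one_mul, dist_eq_norm, dist_eq_norm]
  set a := projOn X v
  set b := projOn X w
  have h3 : ‖a - b‖ ^ 2 ≤ inner ℝ (v - w) (a - b) := by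
    rw [← real_inner_self_eq_norm_sq]
    simp only [inner_sub_left, inner_sub_right, real_inner_comm] at h1 h2 ⊢
    linarith
  have h4 := h3.trans (real_inner_le_norm _ _)
  by_contra! hlt
  nlinarith [norm_nonneg (v - w), norm_nonneg (a - b)]

lemma two_inner_three_point {n : ℕ} (a b w : Eu n) :
    2 * inner ℝ (a - b) (w - a) = ‖b - w‖ ^ 2 - ‖a - w‖ ^ 2 - ‖a - b‖ ^ 2 := by
  simp only [← real_inner_self_eq_norm_sq, inner_sub_left, inner_sub_right]
  rw [real_inner_comm a b, real_inner_comm w b, real_inner_comm w a]; ring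

/-- One projected step, with the length of the step weighted by `K` absorbed. -/
lemma proj_step {n : ℕ} {X : Set (Eu n)} (hcl : IsClosed X) (hc : Convex ℝ X) {η : ℝ} (hη : 0 < η)
    (x d : Eu n) {w : Eu n} (hw : w ∈ X) (K : ℝ) :
    inner ℝ d (x - w) + K * ‖projOn X (x - η⁻¹ • d) - x‖ ≤
      (‖d‖ + K) ^ 2 / (2 * η)
        + η / 2 * (‖x - w‖ ^ 2 - ‖projOn X (x - η⁻¹ • d) - w‖ ^ 2) := by
  have h := (projOn_spec ⟨w, hw⟩ hcl hc (x - η⁻¹ • d)).2 w hw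
  set a := projOn X (x - η⁻¹ • d)
  have h1 : inner ℝ d (a - w) ≤ η / 2 * (‖x - w‖ ^ 2 - ‖a - w‖ ^ 2 - ‖a - x‖ ^ 2) := by
    rw [← two_inner_three_point a x w]
    have e : inner ℝ (x - η⁻¹ • d - a) (w - a) =
        -inner ℝ (a - x) (w - a) + η⁻¹ * inner ℝ d (a - w) := by
      simp only [inner_sub_left, inner_sub_right, real_inner_smul_left]; ring
    rw [e] at h
    have h2 : η⁻¹ * inner ℝ d (a - w) ≤ inner ℝ (a - x) (w - a) := by linarith
    have h3 := mul_le_mul_of_nonneg_left h2 hη.le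
    rw [← mul_assoc, mul_inv_cancel₀ hη.ne', one_mul] at h3
    linarith
  have h2 : inner ℝ d (x - w) = inner ℝ d (a - w) + inner ℝ d (x - a) := by
    rw [← inner_add_right]; congr 1; abel
  have h3 : inner ℝ d (x - a) ≤ ‖d‖ * ‖a - x‖ := by
    rw [norm_sub_rev]; exact real_inner_le_norm _ _
  -- Young's inequality: the quadratic -(η/2)‖a - x‖² left by the three-point identity absorbs both
  -- the drift ‖d‖ and the extra weight K on the step length.
  have h4 : (‖d‖ + K) * ‖a - x‖ ≤ (‖d‖ + K) ^ 2 / (2 * η) + η / 2 * ‖a - x‖ ^ 2 := by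
    have e : (‖d‖ + K) ^ 2 / (2 * η) + η / 2 * ‖a - x‖ ^ 2 - (‖d‖ + K) * ‖a - x‖ =
        ((‖d‖ + K) - η * ‖a - x‖) ^ 2 / (2 * η) := by field_simp; ring
    have : 0 ≤ ((‖d‖ + K) - η * ‖a - x‖) ^ 2 / (2 * η) := by positivity
    linarith
  nlinarith

/-- One projected step of the multipliers, when a part `q ≤ 0` of the direction is discarded. -/
lemma posVec_step {n : ℕ} {α : ℝ} (hα : 0 < α) {q : Eu n} (hq : ∀ j, q j ≤ 0) (r v : Eu n)
    {w : Eu n} (hw : ∀ j, 0 ≤ w j) :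
    inner ℝ (q + r) w ≤ inner ℝ r v + ‖r‖ ^ 2 / (2 * α)
      + α / 2 * (‖v - w‖ ^ 2 - ‖posVec (v + α⁻¹ • (q + r)) - w‖ ^ 2) := by
  set a := posVec (v + α⁻¹ • (q + r)) with ha
  have ha0 : ∀ j, 0 ≤ a j := fun j => le_max_right _ _
  have h : inner ℝ (v + α⁻¹ • (q + r) - a) (w - a) ≤ 0 := by
    rw [inner_eq_sum_coord]
    refine Finset.sum_nonpos fun j _ => ?_
    have hj : a j = max ((v + α⁻¹ • (q + r)) j) 0 := rfl
    rw [PiLp.sub_apply, PiLp.sub_apply]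
    rcases le_total ((v + α⁻¹ • (q + r)) j) 0 with hle | hle
    · rw [hj, max_eq_right hle]
      exact mul_nonpos_of_nonpos_of_nonneg (by linarith) (by linarith [hw j])
    · rw [hj, max_eq_left hle]; simp
  have e : inner ℝ (v + α⁻¹ • (q + r) - a) (w - a) =
      -inner ℝ (a - v) (w - a) + α⁻¹ * inner ℝ (q + r) (w - a) := by
    simp only [inner_sub_left, inner_sub_right, real_inner_smul_left, inner_add_left]; ring
  rw [e] at h
  have h2 : α⁻¹ * inner ℝ (q + r) (w - a) ≤ inner ℝ (a - v) (w - a) := by linarith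
  have h3 := mul_le_mul_of_nonneg_left h2 hα.le
  rw [← mul_assoc, mul_inv_cancel₀ hα.ne', one_mul] at h3
  have tp := two_inner_three_point a v w
  -- The new multiplier a is nonnegative, so q pairs with it to something nonpositive and is
  -- dropped. Only r is paired with a - v, which is why ‖q‖ never enters the bound.
  have hqa := inner_nonpos_of_coord hq ha0
  have h4 : inner ℝ (q + r) (w - a) = inner ℝ (q + r) w - inner ℝ q a - inner ℝ r v
      - inner ℝ r (a - v) := by
    simp only [inner_sub_right, inner_add_left]; ring
  have h5 : inner ℝ r (a - v) ≤ ‖r‖ ^ 2 / (2 * α) + α / 2 * ‖a - v‖ ^ 2 := by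
    have e : ‖r‖ ^ 2 / (2 * α) + α / 2 * ‖a - v‖ ^ 2 - ‖r‖ * ‖a - v‖ =
        (‖r‖ - α * ‖a - v‖) ^ 2 / (2 * α) := by field_simp; ring
    have : 0 ≤ (‖r‖ - α * ‖a - v‖) ^ 2 / (2 * α) := by positivity
    linarith [real_inner_le_norm r (a - v)]
  nlinarith

/-! ### Second moments and orthogonal increments. -/

section SquareIntegrable

variable {Ω E : Type*} {mΩ : MeasurableSpace Ω} {μ : Measure Ω} [NormedAddCommGroup E]

lemma lintegral_enorm_sq_eq {f : Ω → E} (hf : MemLp f 2 μ) :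
    ∫⁻ ω, ‖f ω‖ₑ ^ 2 ∂μ = ENNReal.ofReal (∫ ω, ‖f ω‖ ^ 2 ∂μ) := by
  rw [ofReal_integral_eq_lintegral_ofReal ((memLp_two_iff_integrable_sq_norm hf.1).1 hf)
    (Filter.Eventually.of_forall fun ω => by positivity)]
  refine lintegral_congr fun ω => ?_
  rw [ENNReal.ofReal_pow (norm_nonneg _), ofReal_norm]

/-- Second moments of the iterates' errors are first bounded as Lebesgue integrals in [0, ∞];
integrability is then a consequence of the bound and needs no prior argument. -/
lemma memLp_two_of_lintegral_le {f : Ω → E} (hf : AEStronglyMeasurable f μ) {K : ℝ}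
    (h : ∫⁻ ω, ‖f ω‖ₑ ^ 2 ∂μ ≤ ENNReal.ofReal K) : MemLp f 2 μ := by
  rw [memLp_two_iff_integrable_sq_norm hf]
  refine ⟨hf.norm.pow 2, ?_⟩
  rw [hasFiniteIntegral_iff_enorm]
  refine lt_of_le_of_lt (le_of_eq (lintegral_congr fun ω => ?_)) (h.trans_lt ENNReal.ofReal_lt_top)
  rw [enorm_pow, enorm_norm]

lemma integral_sq_le_of_lintegral_le {f : Ω → E} (hf : AEStronglyMeasurable f μ) {K : ℝ}
    (hK : 0 ≤ K) (h : ∫⁻ ω, ‖f ω‖ₑ ^ 2 ∂μ ≤ ENNReal.ofReal K) : ∫ ω, ‖f ω‖ ^ 2 ∂μ ≤ K := by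
  have := memLp_two_of_lintegral_le hf h
  rwa [lintegral_enorm_sq_eq this, ENNReal.ofReal_le_ofReal_iff hK] at h

lemma MeasureTheory.MemLp.integrable_sq_norm {f : Ω → E} (hf : MemLp f 2 μ) :
    Integrable (fun ω => ‖f ω‖ ^ 2) μ := (memLp_two_iff_integrable_sq_norm hf.1).1 hf

lemma memLp_sum_range {e : ℕ → Ω → E} {T : ℕ} (he : ∀ t < T, MemLp (e t) 2 μ) :
    MemLp (fun ω => ∑ t ∈ Finset.range T, e t ω) 2 μ := by
  have := memLp_finsetSum' (Finset.range T) fun t ht => he t (Finset.mem_range.1 ht)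
  convert this using 1
  ext ω; simp

variable [IsProbabilityMeasure μ]

lemma MeasureTheory.MemLp.integrable_of_two {f : Ω → E} (hf : MemLp f 2 μ) : Integrable f μ :=
  hf.integrable (by norm_num)

lemma integral_norm_le_of_sq {f : Ω → E} (hf : MemLp f 2 μ) {C : ℝ} (hC : 0 ≤ C)
    (h : ∫ ω, ‖f ω‖ ^ 2 ∂μ ≤ C ^ 2) : ∫ ω, ‖f ω‖ ∂μ ≤ C := by
  -- The variance of ‖f‖ is nonnegative.
  have h1 : (∫ ω, ‖f ω‖ ∂μ) ^ 2 ≤ ∫ ω, ‖f ω‖ ^ 2 ∂μ := by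
    set a := ∫ ω, ‖f ω‖ ∂μ
    have h0 : 0 ≤ ∫ ω, (‖f ω‖ - a) ^ 2 ∂μ := integral_nonneg fun ω => sq_nonneg _
    have e : ∀ ω, (‖f ω‖ - a) ^ 2 = ‖f ω‖ ^ 2 - 2 * a * ‖f ω‖ + a ^ 2 := fun ω => by ring
    have i1 := hf.integrable_sq_norm
    have i2 := (hf.integrable_of_two.norm.const_mul (2 * a))
    simp only [e] at h0
    have e1 : ∫ ω, (‖f ω‖ ^ 2 - 2 * a * ‖f ω‖ + a ^ 2) ∂μ =
        ∫ ω, ‖f ω‖ ^ 2 ∂μ - 2 * a * a + a ^ 2 := by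
      rw [integral_add (f := fun ω => ‖f ω‖ ^ 2 - 2 * a * ‖f ω‖) (i1.sub i2) (integrable_const _),
        integral_sub i1 i2, integral_const_mul, integral_const]
      simp [a]
    rw [e1] at h0
    linarith
  exact (abs_le_of_sq_le_sq' (h1.trans h) hC).2

lemma norm_integral_le_of_sq [NormedSpace ℝ E] {f : Ω → E} (hf : MemLp f 2 μ) {C : ℝ}
    (hC : 0 ≤ C) (h : ∫ ω, ‖f ω‖ ^ 2 ∂μ ≤ C ^ 2) : ‖∫ ω, f ω ∂μ‖ ≤ C :=
  (norm_integral_le_integral_norm _).trans (integral_norm_le_of_sq hf hC h)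

end SquareIntegrable

section InnerProduct

variable {Ω E : Type*} {mΩ : MeasurableSpace Ω} {μ : Measure Ω} [NormedAddCommGroup E]
  [InnerProductSpace ℝ E]

lemma MeasureTheory.MemLp.integrable_inner_two {f g : Ω → E} (hf : MemLp f 2 μ)
    (hg : MemLp g 2 μ) : Integrable (fun ω => (inner ℝ (f ω) (g ω) : ℝ)) μ := by
  refine Integrable.mono' (hf.integrable_sq_norm.add hg.integrable_sq_norm)
    (hf.1.inner hg.1) (Filter.Eventually.of_forall fun ω => ?_)
  have := norm_inner_le_norm (𝕜 := ℝ) (f ω) (g ω)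
  simp only [Pi.add_apply]
  nlinarith [sq_nonneg (‖f ω‖ - ‖g ω‖), sq_nonneg (‖f ω‖), sq_nonneg ‖g ω‖]

lemma integral_sq_add_of_orthogonal {f g : Ω → E} (hf : MemLp f 2 μ) (hg : MemLp g 2 μ)
    (h : ∫ ω, (inner ℝ (f ω) (g ω) : ℝ) ∂μ = 0) :
    ∫ ω, ‖f ω + g ω‖ ^ 2 ∂μ = ∫ ω, ‖f ω‖ ^ 2 ∂μ + ∫ ω, ‖g ω‖ ^ 2 ∂μ := by
  simp only [norm_add_sq_real]
  rw [integral_add (f := fun ω => ‖f ω‖ ^ 2 + 2 * inner ℝ (f ω) (g ω))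
    (hf.integrable_sq_norm.add ((hf.integrable_inner_two hg).const_mul 2))
    hg.integrable_sq_norm, integral_add hf.integrable_sq_norm
    ((hf.integrable_inner_two hg).const_mul 2), integral_const_mul, h]
  ring

/-- A sum of `T` orthogonal increments of variance at most `σ²` has mean norm at most `σ √T`. -/
lemma integral_norm_sum_le [IsProbabilityMeasure μ] {e : ℕ → Ω → E} {T : ℕ} {σ : ℝ} (hσ : 0 ≤ σ)
    (he : ∀ t < T, MemLp (e t) 2 μ) (hsq : ∀ t < T, ∫ ω, ‖e t ω‖ ^ 2 ∂μ ≤ σ ^ 2)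
    (horth : ∀ t < T, ∫ ω, (inner ℝ (e t ω) (∑ k ∈ Finset.range t, e k ω) : ℝ) ∂μ = 0) :
    ∫ ω, ‖∑ t ∈ Finset.range T, e t ω‖ ∂μ ≤ σ * √T := by
  have key : ∀ n ≤ T, ∫ ω, ‖∑ t ∈ Finset.range n, e t ω‖ ^ 2 ∂μ ≤ n * σ ^ 2 := by
    intro n
    induction n with
    | zero => intro _; simp
    | succ n ih =>
      intro hn
      simp only [Finset.sum_range_succ, add_comm _ (e n _)]
      rw [integral_sq_add_of_orthogonal (he n (by omega))
        (memLp_sum_range fun t ht => he t (by omega)) (horth n (by omega))]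
      have := ih (by omega)
      have := hsq n (by omega)
      push_cast; linarith
  refine integral_norm_le_of_sq (memLp_sum_range he) (by positivity) ?_
  rw [mul_pow, Real.sq_sqrt (Nat.cast_nonneg T), mul_comm]
  exact key T le_rfl

end InnerProduct

/-! ### The past, fresh samples and conditional averaging. -/

section PastAlgebra

variable {Ω D : Type*} [MeasurableSpace D]

/-- The information carried by the draws before time `t`. -/
@[reducible]
def pastAlg (S : ℕ → Ω → D) (t : ℕ) : MeasurableSpace Ω :=
  ⨆ k ∈ Set.Iio t, MeasurableSpace.comap (S k) inferInstance

lemma pastAlg_mono (S : ℕ → Ω → D) {s t : ℕ} (h : s ≤ t) : pastAlg S s ≤ pastAlg S t :=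
  biSup_mono fun _ hk => lt_of_lt_of_le hk h

lemma measurable_pastAlg (S : ℕ → Ω → D) {k t : ℕ} (h : k < t) :
    Measurable[pastAlg S t] (S k) :=
  Measurable.mono (comap_measurable (S k))
    (le_biSup (fun k => MeasurableSpace.comap (S k) inferInstance) (show k ∈ Set.Iio t from h))
    le_rfl

variable {mΩ : MeasurableSpace Ω} {μ : Measure Ω} {S : ℕ → Ω → D}

lemma pastAlg_le (hS : ∀ t, Measurable (S t)) (t : ℕ) : pastAlg S t ≤ mΩ :=
  iSup₂_le fun k _ => (hS k).comap_le

lemma indep_pastAlg (hS : ∀ t, Measurable (S t)) (hi : iIndepFun S μ) (t : ℕ) :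
    Indep (pastAlg S t) (MeasurableSpace.comap (S t) inferInstance) μ := by
  have := indep_iSup_of_disjoint (fun k => (hS k).comap_le) hi
    (S := Set.Iio t) (T := {t}) (by simp)
  simpa [pastAlg] using this

end PastAlgebra

section Independence

/-- The sets a ∩ b form a π-system generating the supremum, so it suffices to check the product
formula on them. -/
lemma indep_sup_of_inter {Ω : Type*} {ℱ ℛ 𝒞 : MeasurableSpace Ω} {mΩ : MeasurableSpace Ω}
    {μ : Measure Ω} [IsProbabilityMeasure μ] (hℱ : ℱ ≤ mΩ) (hℛ : ℛ ≤ mΩ) (h𝒞 : 𝒞 ≤ mΩ)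
    (h : ∀ a b c, MeasurableSet[ℱ] a → MeasurableSet[ℛ] b → MeasurableSet[𝒞] c →
      μ (a ∩ b ∩ c) = μ (a ∩ b) * μ c) : Indep (ℱ ⊔ ℛ) 𝒞 μ := by
  have hg1 : MeasurableSpace.generateFrom
      {s | ∃ a b, MeasurableSet[ℱ] a ∧ MeasurableSet[ℛ] b ∧ s = a ∩ b} = ℱ ⊔ ℛ := by
    refine le_antisymm (MeasurableSpace.generateFrom_le ?_) (sup_le ?_ ?_)
    · rintro _ ⟨a, b, ha, hb, rfl⟩
      exact MeasurableSet.inter (le_sup_left (a := ℱ) (b := ℛ) a ha)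
        (le_sup_right (a := ℱ) (b := ℛ) b hb)
    · intro a ha
      exact MeasurableSpace.measurableSet_generateFrom
        ⟨a, Set.univ, ha, MeasurableSet.univ, by simp⟩
    · intro b hb
      exact MeasurableSpace.measurableSet_generateFrom
        ⟨Set.univ, b, MeasurableSet.univ, hb, by simp⟩
  have hg2 : MeasurableSpace.generateFrom {s | MeasurableSet[𝒞] s} = 𝒞 :=
    @MeasurableSpace.generateFrom_measurableSet _ 𝒞
  rw [← hg1, ← hg2]
  refine IndepSets.indep' ?_ ?_ ?_ ?_ ?_
  · rintro _ ⟨a, b, ha, hb, rfl⟩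
    exact (hℱ a ha).inter (hℛ b hb)
  · exact fun s hs => h𝒞 s hs
  · rintro _ ⟨a, b, ha, hb, rfl⟩ _ ⟨a', b', ha', hb', rfl⟩ _
    exact ⟨a ∩ a', b ∩ b', MeasurableSet.inter ha ha', MeasurableSet.inter hb hb',
      Set.inter_inter_inter_comm _ _ _ _⟩
  · exact fun s hs t ht _ => @MeasurableSet.inter _ 𝒞 _ _ hs ht
  · rw [IndepSets_iff]
    rintro _ c ⟨a, b, ha, hb, rfl⟩ hc
    exact h a b c ha hb hc

/-- If `Y` is independent of `ℱ` and `π` splits its law into a product, the second factor is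
independent of `ℱ` together with the first factor. -/
lemma indep_sup_fst_snd {Ω D R C : Type*} {ℱ : MeasurableSpace Ω} {mΩ : MeasurableSpace Ω}
    {μ : Measure Ω} [IsProbabilityMeasure μ] [MeasurableSpace D] [MeasurableSpace R]
    [MeasurableSpace C] (hℱ : ℱ ≤ mΩ) {Y : Ω → D} (hY : Measurable Y)
    (hi : Indep ℱ (MeasurableSpace.comap Y inferInstance) μ) {π : D → R × C} {ρ : Measure R}
    {κ : Measure C} [IsProbabilityMeasure ρ] [IsProbabilityMeasure κ]
    (hπ : MeasurePreserving π (μ.map Y) (ρ.prod κ)) :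
    Indep (ℱ ⊔ MeasurableSpace.comap (fun ω => (π (Y ω)).1) inferInstance)
      (MeasurableSpace.comap (fun ω => (π (Y ω)).2) inferInstance) μ := by
  have m1 : Measurable fun ω => (π (Y ω)).1 := (hπ.measurable.comp hY).fst
  have m2 : Measurable fun ω => (π (Y ω)).2 := (hπ.measurable.comp hY).snd
  refine indep_sup_of_inter hℱ m1.comap_le m2.comap_le ?_
  rintro a _ _ ha ⟨b, hb, rfl⟩ ⟨c, hc, rfl⟩
  -- On rectangles, independence of `Y` from ℱ and the product law through π factor the probability
  -- into three terms; taking b or c to be the whole space supplies all the other probabilities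
  -- needed.
  have key : ∀ b c, MeasurableSet b → MeasurableSet c →
      μ (a ∩ Y ⁻¹' (π ⁻¹' (b ×ˢ c))) = μ a * (ρ b * κ c) := by
    intro b c hb hc
    rw [Indep_iff] at hi
    rw [hi a _ ha ⟨_, hπ.measurable (hb.prod hc), rfl⟩,
      ← Measure.map_apply hY (hπ.measurable (hb.prod hc)),
      hπ.measure_preimage (hb.prod hc).nullMeasurableSet, Measure.prod_prod]
  have k2 : ∀ c, MeasurableSet c → μ ((fun ω => (π (Y ω)).2) ⁻¹' c) = κ c := by
    intro c hc
    have : (fun ω => (π (Y ω)).2) ⁻¹' c = Y ⁻¹' (π ⁻¹' (Set.univ ×ˢ c)) := by ext; simp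
    rw [this, ← Measure.map_apply hY (hπ.measurable (MeasurableSet.univ.prod hc)),
      hπ.measure_preimage (MeasurableSet.univ.prod hc).nullMeasurableSet, Measure.prod_prod]
    simp
  have e1 : a ∩ (fun ω => (π (Y ω)).1) ⁻¹' b ∩ (fun ω => (π (Y ω)).2) ⁻¹' c =
      a ∩ Y ⁻¹' (π ⁻¹' (b ×ˢ c)) := by ext; simp; tauto
  have e2 : a ∩ (fun ω => (π (Y ω)).1) ⁻¹' b = a ∩ Y ⁻¹' (π ⁻¹' (b ×ˢ Set.univ)) := by
    ext; simp
  rw [e1, e2, key b c hb hc, key b _ hb MeasurableSet.univ, k2 c hc]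
  simp [mul_assoc]

/-- A fresh sample: independent of `𝒢`, with law `κ`. -/
structure IsFresh {Ω C : Type*} [MeasurableSpace C] (𝒢 : MeasurableSpace Ω)
    {mΩ : MeasurableSpace Ω} (Y : Ω → C)
    (κ : Measure C) (μ : Measure Ω) : Prop where
  le : 𝒢 ≤ mΩ
  meas : Measurable Y
  indep : Indep 𝒢 (MeasurableSpace.comap Y inferInstance) μ
  law : μ.map Y = κ

namespace IsFresh

variable {Ω C α : Type*} [MeasurableSpace C] [MeasurableSpace α] {𝒢 : MeasurableSpace Ω}
  {mΩ : MeasurableSpace Ω} {μ : Measure Ω} [IsProbabilityMeasure μ]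
  {Y : Ω → C} {κ : Measure C} {V : Ω → α}

lemma map_prod (h : IsFresh 𝒢 Y κ μ) (hV : Measurable[𝒢] V) :
    μ.map (fun ω => (V ω, Y ω)) = (μ.map V).prod κ := by
  have hind : IndepFun V Y μ := by
    rw [IndepFun_iff_Indep]
    exact indep_of_indep_of_le_left h.indep hV.comap_le
  rw [← h.law]
  exact (indepFun_iff_map_prod_eq_prod_map_map (hV.mono h.le le_rfl).aemeasurable
    h.meas.aemeasurable).1 hind

/-- Tonelli for the product law of (V, Y): the fresh sample may be integrated out with V frozen.
This plays the role of conditional expectation throughout. -/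
lemma lintegral_eq (h : IsFresh 𝒢 Y κ μ) (hV : Measurable[𝒢] V) {φ : α → C → ENNReal}
    (hφ : Measurable (Function.uncurry φ)) :
    ∫⁻ ω, φ (V ω) (Y ω) ∂μ = ∫⁻ ω, ∫⁻ y, φ (V ω) y ∂κ ∂μ := by
  have hV' := hV.mono h.le le_rfl
  have : IsProbabilityMeasure κ := h.law ▸ Measure.isProbabilityMeasure_map h.meas.aemeasurable
  calc ∫⁻ ω, φ (V ω) (Y ω) ∂μ
      = ∫⁻ q, Function.uncurry φ q ∂(μ.map (fun ω => (V ω, Y ω))) :=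
        (lintegral_map hφ (hV'.prodMk h.meas)).symm
    _ = ∫⁻ v, ∫⁻ y, φ v y ∂κ ∂(μ.map V) := by
        rw [h.map_prod hV, lintegral_prod _ hφ.aemeasurable]; rfl
    _ = _ := lintegral_map hφ.lintegral_prod_right' hV'

lemma integral_eq (h : IsFresh 𝒢 Y κ μ) (hV : Measurable[𝒢] V) {φ : α → C → ℝ}
    (hφ : Measurable (Function.uncurry φ)) (hi : Integrable (fun ω => φ (V ω) (Y ω)) μ) :
    ∫ ω, φ (V ω) (Y ω) ∂μ = ∫ ω, ∫ y, φ (V ω) y ∂κ ∂μ := by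
  have hV' := hV.mono h.le le_rfl
  have : IsProbabilityMeasure κ := h.law ▸ Measure.isProbabilityMeasure_map h.meas.aemeasurable
  have : IsProbabilityMeasure (μ.map V) := Measure.isProbabilityMeasure_map hV'.aemeasurable
  have hVY := (hV'.prodMk h.meas).aemeasurable (μ := μ)
  have hs := hφ.stronglyMeasurable
  calc ∫ ω, φ (V ω) (Y ω) ∂μ
      = ∫ q, Function.uncurry φ q ∂(μ.map (fun ω => (V ω, Y ω))) :=
        (integral_map hVY hs.aestronglyMeasurable).symm
    _ = ∫ v, ∫ y, φ v y ∂κ ∂(μ.map V) := by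
        have hi' : Integrable (Function.uncurry φ) (μ.map (fun ω => (V ω, Y ω))) :=
          (integrable_map_measure hs.aestronglyMeasurable hVY).2 hi
        rw [h.map_prod hV] at hi' ⊢
        exact integral_prod _ hi'
    _ = _ := integral_map hV'.aemeasurable
        (StronglyMeasurable.integral_prod_right (f := φ) hs).aestronglyMeasurable

variable {E : Type*} [NormedAddCommGroup E] [InnerProductSpace ℝ E] [CompleteSpace E]
  [MeasurableSpace E] [BorelSpace E] [SecondCountableTopology E]

/-- Averaging a fresh sample inside an inner product. -/
lemma integral_inner_eq (h : IsFresh 𝒢 Y κ μ) (hV : Measurable[𝒢] V) {U : Ω → E}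
    (hU : Measurable[𝒢] U) {φ : α → C → E} (hφ : Measurable (Function.uncurry φ)) {ψ : Ω → E}
    (hφi : ∀ ω, Integrable (φ (V ω)) κ) (hψ : ∀ ω, ∫ y, φ (V ω) y ∂κ = ψ ω)
    (h2 : MemLp (fun ω => φ (V ω) (Y ω)) 2 μ) (hU2 : MemLp U 2 μ) :
    ∫ ω, (inner ℝ (φ (V ω) (Y ω)) (U ω) : ℝ) ∂μ = ∫ ω, (inner ℝ (ψ ω) (U ω) : ℝ) ∂μ := by
  have hm : Measurable (Function.uncurry fun (v : α × E) y => (inner ℝ (φ v.1 y) v.2 : ℝ)) := by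
    have : Measurable fun q : (α × E) × C => φ q.1.1 q.2 :=
      hφ.comp (measurable_fst.fst.prodMk measurable_snd)
    exact this.inner measurable_fst.snd
  rw [h.integral_eq (V := fun ω => (V ω, U ω)) (hV.prodMk hU)
    (φ := fun (v : α × E) y => (inner ℝ (φ v.1 y) v.2 : ℝ)) hm (h2.integrable_inner_two hU2)]
  refine integral_congr_ae (Filter.Eventually.of_forall fun ω => ?_)
  simp only
  rw [← hψ ω, ← real_inner_comm, ← integral_inner (hφi ω)]
  simp only [real_inner_comm]

lemma lintegral_sq_le (h : IsFresh 𝒢 Y κ μ) (hV : Measurable[𝒢] V) {F : Type*}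
    [NormedAddCommGroup F] [MeasurableSpace F] [OpensMeasurableSpace F]
    {φ : α → C → F} (hφ : Measurable (Function.uncurry φ)) {k : Ω → ENNReal}
    (hk : ∀ ω, ∫⁻ y, ‖φ (V ω) y‖ₑ ^ 2 ∂κ ≤ k ω) :
    ∫⁻ ω, ‖φ (V ω) (Y ω)‖ₑ ^ 2 ∂μ ≤ ∫⁻ ω, k ω ∂μ := by
  rw [h.lintegral_eq hV (φ := fun v y => ‖φ v y‖ₑ ^ 2) (hφ.enorm.pow_const 2)]
  exact lintegral_mono hk

end IsFresh

end Independence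

/-! ### Measurability of elementary operations and coordinates of the joint draw. -/

lemma CompConvex.continuous {p q : ℕ} {h : Eu p → Eu q} (hh : CompConvex h) : Continuous h := by
  have : Continuous fun x => (fun j => h x j : Fin q → ℝ) :=
    continuous_pi fun j => continuousOn_univ.1 ((hh j).continuousOn isOpen_univ)
  exact (PiLp.continuous_toLp 2 _).comp this

lemma Measurable.mat_apply {α : Type*} {mα : MeasurableSpace α} {p q : ℕ} {A : α → Mat p q}
    {v : α → Eu q} (hA : Measurable A) (hv : Measurable v) : Measurable fun a => A a (v a) :=
  (isBoundedBilinearMap_apply (𝕜 := ℝ) (E := Eu q) (F := Eu p)).continuous.measurable.comp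
    (hA.prodMk hv)

lemma Measurable.mat_tr {α : Type*} {mα : MeasurableSpace α} {p q : ℕ} {A : α → Mat p q}
    (hA : Measurable A) : Measurable fun a => Mat.tr (A a) :=
  (ContinuousLinearMap.adjoint (𝕜 := ℝ) (E := Eu q) (F := Eu p)).continuous.measurable.comp hA

lemma continuous_posVec {n : ℕ} : Continuous (posVec (n := n)) := by
  refine (PiLp.continuous_toLp 2 _).comp (continuous_pi fun j => ?_)
  exact (PiLp.continuous_apply 2 _ j).max continuous_const

section DrawLaw

/-- The joint law of a draw is a right-nested product. If one coordinate can be split off from the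
tail, reassociating splits it off from the whole; each iteration passes one more leading coordinate,
and a final swap isolates the desired one. -/
lemma measurePreserving_extract {A B R C : Type*} [MeasurableSpace A] [MeasurableSpace B]
    [MeasurableSpace R] [MeasurableSpace C] {a : Measure A} {b : Measure B} {ρ : Measure R}
    {κ : Measure C} [SFinite a] [SFinite b] [SFinite ρ] [SFinite κ] {π : B → R × C}
    (hπ : MeasurePreserving π b (ρ.prod κ)) :
    MeasurePreserving (fun p : A × B => ((p.1, (π p.2).1), (π p.2).2)) (a.prod b)
      ((a.prod ρ).prod κ) :=
  (measurePreserving_prodAssoc a ρ κ).symm.comp ((MeasurePreserving.id a).prod hπ)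

end DrawLaw

/-! ### The processes of a run and their error decomposition. -/

/-- An execution of the algorithm: the problem, the step sizes, the starting point and the
oracle's draws. -/
structure CoCRun (dx dy dz m : ℕ) (Ξ₁ Ξ₂ Z₁ Z₂ Ω : Type*) [MeasurableSpace Ξ₁]
    [MeasurableSpace Ξ₂] [MeasurableSpace Z₁] [MeasurableSpace Z₂] where
  P : CoCProblem dx dy dz m Ξ₁ Ξ₂ Z₁ Z₂
  α : ℕ → ℝ
  η : ℕ → ℝ
  τ : ℕ → ℝ
  ρ : ℕ → ℝ
  x₀ : Eu dx
  S : ℕ → Ω → Draw Ξ₁ Ξ₂ Z₁ Z₂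

namespace CoCRun

variable {dx dy dz m : ℕ} {Ξ₁ Ξ₂ Z₁ Z₂ Ω : Type*} [MeasurableSpace Ξ₁] [MeasurableSpace Ξ₂]
  [MeasurableSpace Z₁] [MeasurableSpace Z₂]

section Processes

variable (r : CoCRun dx dy dz m Ξ₁ Ξ₂ Z₁ Z₂ Ω) (t : ℕ) (ω : Ω)

/-- The state number `t`. -/
noncomputable def st : CoCState dx dy dz m :=
  r.P.iter r.α r.η r.τ r.ρ r.x₀ 0 (fun k => r.S k ω) t

noncomputable def X : Eu dx := (r.st t ω).x
noncomputable def Y : Eu dy := (r.st t ω).y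
noncomputable def Z : Eu dz := (r.st t ω).z
noncomputable def L : Eu m := (r.st t ω).lam

/-- The sampling error of `f₂(x_t)` in the tracking step. -/
noncomputable def eF : Eu dy := r.P.sf₂ (r.X t ω) (r.S t ω).ξ₂1 - r.P.f₂ (r.X t ω)
/-- The sampling error of `g₂(x_t)` in the tracking step. -/
noncomputable def eG : Eu dz := r.P.sg₂ (r.X t ω) (r.S t ω).ζ₂1 - r.P.g₂ (r.X t ω)
/-- The sampled gradient of `f₁`. -/
noncomputable def uHat : Eu dy := r.P.sgradf₁ (r.Y (t + 1) ω) (r.S t ω).ξ₁0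
/-- The sampled gradient of `g₁`, applied to the multiplier. -/
noncomputable def wHat : Eu dz := r.P.sgradg₁ (r.Z (t + 1) ω) (r.S t ω).ζ₁0 (r.L t ω)
/-- The direction of the primal step coming from the objective. -/
noncomputable def dF : Eu dx := r.P.ssubf₂ (r.X t ω) (r.S t ω).ξ₂0 (r.uHat t ω)
/-- The direction of the primal step coming from the constraint. -/
noncomputable def dG : Eu dx := r.P.ssubg₂ (r.X t ω) (r.S t ω).ζ₂0 (r.wHat t ω)
noncomputable def meanSubF : Mat dx dy := ∫ ξ, r.P.ssubf₂ (r.X t ω) ξ ∂r.P.lawξ₂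
noncomputable def meanSubG : Mat dx dz := ∫ ζ, r.P.ssubg₂ (r.X t ω) ζ ∂r.P.lawζ₂
noncomputable def gradF : Eu dy := gradient r.P.f₁ (r.Y (t + 1) ω)
noncomputable def gradG : Mat dz m := gradMat r.P.g₁ (r.Z (t + 1) ω)
noncomputable def H : Eu m := r.P.nextH (r.ρ t) (r.st t ω) (r.S t ω)
/-- The error of `H_{t+1}` as an estimate of the linearised constraint. -/
noncomputable def eH : Eu m := r.H t ω - r.P.linG (r.X t ω) (r.Z (t + 1) ω)
/-- The sampled gradient of `g₁` used in `H_{t+1}`. -/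
noncomputable def jac : Mat dz m := r.P.sgradg₁ (r.Z (t + 1) ω) (r.S t ω).ζ₁1
/-- The part of the error of `H_{t+1}` due to the outer sample. -/
noncomputable def eH₁ : Eu m :=
  r.P.sg₁ (r.Z (t + 1) ω) (r.S t ω).ζ₁1 - r.P.g₁ (r.Z (t + 1) ω)
    + (Mat.tr (r.jac t ω) (r.P.g₂ (r.X t ω) - r.Z (t + 1) ω)
      - Mat.tr (r.gradG t ω) (r.P.g₂ (r.X t ω) - r.Z (t + 1) ω))
/-- The part of the error of `H_{t+1}` due to the inner sample. -/
noncomputable def eH₂ : Eu m :=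
  Mat.tr (r.jac t ω) (r.P.sg₂ (r.X t ω) (r.S t ω).ζ₂2 - r.P.g₂ (r.X t ω))
/-- `∇g₁(z_{t+1})ᵀ (g₂(x_t) - g₂(x*))`. -/
noncomputable def pG (xs : Eu dx) : Eu m :=
  Mat.tr (r.gradG t ω) (r.P.g₂ (r.X t ω) - r.P.g₂ xs)

lemma L_zero : r.L 0 ω = 0 := rfl

lemma X_succ : r.X (t + 1) ω =
    projOn r.P.X (r.X t ω - (r.η t)⁻¹ • (r.dF t ω + r.dG t ω)) := rfl

lemma Y_succ' : r.Y (t + 1) ω =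
    (1 + r.τ t)⁻¹ • (r.P.sf₂ (r.X t ω) (r.S t ω).ξ₂1 + r.τ t • r.Y t ω) := rfl

lemma Z_succ' : r.Z (t + 1) ω =
    (1 + r.ρ t)⁻¹ • (r.P.sg₂ (r.X t ω) (r.S t ω).ζ₂1 + r.ρ t • r.Z t ω) := rfl

lemma Y_succ : r.Y (t + 1) ω =
    (1 + r.τ t)⁻¹ • (r.P.f₂ (r.X t ω) + r.eF t ω + r.τ t • r.Y t ω) := by
  rw [Y_succ', eF, add_sub_cancel]

lemma Z_succ : r.Z (t + 1) ω =
    (1 + r.ρ t)⁻¹ • (r.P.g₂ (r.X t ω) + r.eG t ω + r.ρ t • r.Z t ω) := by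
  rw [Z_succ', eG, add_sub_cancel]

lemma L_succ : r.L (t + 1) ω = posVec (r.L t ω + (r.α t)⁻¹ • r.H t ω) := rfl

lemma L_nonneg (j : Fin m) : 0 ≤ r.L t ω j := by
  cases t with
  | zero => simp [L_zero]
  | succ t => exact le_max_right _ _

/-- With the inner sample replaced by its mean, only the randomness of the outer sample remains in
`eH₁`; `eH₂` is the inner error carried through the sampled Jacobian. -/
lemma eH_eq : r.eH t ω = r.eH₁ t ω + r.eH₂ t ω := by
  have hH : r.H t ω = r.P.sg₁ (r.Z (t + 1) ω) (r.S t ω).ζ₁1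
    - Mat.tr (r.jac t ω) (r.Z (t + 1) ω)
    + Mat.tr (r.jac t ω) (r.P.sg₂ (r.X t ω) (r.S t ω).ζ₂2) := rfl
  have hl : r.P.linG (r.X t ω) (r.Z (t + 1) ω) = r.P.g₁ (r.Z (t + 1) ω)
    + Mat.tr (r.gradG t ω) (r.P.g₂ (r.X t ω) - r.Z (t + 1) ω) := rfl
  rw [eH, eH₁, eH₂, hH, hl]
  simp only [map_sub]
  abel

end Processes

/-- The standing assumptions of the convergence theorem. -/
structure Standing (r : CoCRun dx dy dz m Ξ₁ Ξ₂ Z₁ Z₂ Ω) (c : CoCConsts) (xs : Eu dx) (ls : Eu m)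
    (N : ℕ) {mΩ : MeasurableSpace Ω} (μ : Measure Ω) : Prop where
  saddle : r.P.IsSaddle xs ls
  oracle : r.P.MeasurableOracle
  obj : r.P.ObjectiveAssumption c xs
  mono : r.P.MonotoneAssumption
  con : r.P.ConstraintAssumption c
  sampling : r.P.IsSampling μ r.S
  x₀_mem : r.x₀ ∈ r.P.X
  N_pos : 0 < N
  hα : ∀ t < N, r.α t = 2 * √(N : ℝ)
  hη : ∀ t < N, r.η t = 5 * √(N : ℝ) / 2
  hτ : ∀ t < N, r.τ t = (t : ℝ) / 2
  hρ : ∀ t < N, r.ρ t = (t : ℝ) / 2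

/-! ### Adaptedness: the state at time t is a function of the earlier draws. -/

namespace Standing

section DrawMeasurability

variable {r : CoCRun dx dy dz m Ξ₁ Ξ₂ Z₁ Z₂ Ω}

lemma measurable_draw {𝒢 : MeasurableSpace Ω} {t : ℕ} (hS : Measurable[𝒢] (r.S t)) :
    (Measurable[𝒢] fun ω => (r.S t ω).ξ₂0) ∧ (Measurable[𝒢] fun ω => (r.S t ω).ξ₂1) ∧
    (Measurable[𝒢] fun ω => (r.S t ω).ξ₁0) ∧ (Measurable[𝒢] fun ω => (r.S t ω).ζ₂0) ∧
    (Measurable[𝒢] fun ω => (r.S t ω).ζ₂1) ∧ (Measurable[𝒢] fun ω => (r.S t ω).ζ₂2) ∧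
    (Measurable[𝒢] fun ω => (r.S t ω).ζ₁0) ∧ (Measurable[𝒢] fun ω => (r.S t ω).ζ₁1) :=
  ⟨hS.fst, hS.snd.fst, hS.snd.snd.fst, hS.snd.snd.snd.fst, hS.snd.snd.snd.snd.fst,
    hS.snd.snd.snd.snd.snd.fst, hS.snd.snd.snd.snd.snd.snd.fst, hS.snd.snd.snd.snd.snd.snd.snd⟩

lemma measurable_rest {R C D : Type*} [MeasurableSpace R] [MeasurableSpace D]
    (t : ℕ) {π : Draw Ξ₁ Ξ₂ Z₁ Z₂ → R × C} {g : R → D} (hg : Measurable g) :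
    Measurable[pastAlg r.S t ⊔ MeasurableSpace.comap (fun ω => (π (r.S t ω)).1) inferInstance]
      (fun ω => g (π (r.S t ω)).1) :=
  hg.comp ((comap_measurable _).mono le_sup_right le_rfl)

end DrawMeasurability

section Measurability

variable {r : CoCRun dx dy dz m Ξ₁ Ξ₂ Z₁ Z₂ Ω} {c : CoCConsts} {xs : Eu dx} {ls : Eu m} {N : ℕ}
  {𝒢 : MeasurableSpace Ω} {mΩ : MeasurableSpace Ω} {μ : Measure Ω}

lemma X_mem (h : r.Standing c xs ls N μ) (t : ℕ) (ω : Ω) : r.X t ω ∈ r.P.X := by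
  cases t with
  | zero => exact h.x₀_mem
  | succ t => exact (projOn_spec ⟨xs, h.saddle.mem⟩ h.obj.X_closed h.obj.X_convex _).1

lemma continuous_f₂ (h : r.Standing c xs ls N μ) : Continuous r.P.f₂ := h.obj.f₂_convex.continuous
lemma continuous_g₂ (h : r.Standing c xs ls N μ) : Continuous r.P.g₂ := h.con.g₂_convex.continuous

lemma continuous_gradient (h : r.Standing c xs ls N μ) : Continuous (gradient r.P.f₁) :=
  (LipschitzWith.of_dist_le_mul (K := ⟨c.Lf₁, h.obj.Lf₁_pos.le⟩) fun a b => by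
    rw [dist_eq_norm, dist_eq_norm]; exact h.obj.f₁_smooth a b).continuous

lemma continuous_gradMat (h : r.Standing c xs ls N μ) : Continuous (gradMat r.P.g₁) :=
  (LipschitzWith.of_dist_le_mul (K := ⟨c.Lg₁, h.con.Lg₁_pos.le⟩) fun a b => by
    rw [dist_eq_norm, dist_eq_norm]; exact h.con.g₁_smooth a b).continuous

variable {t : ℕ}

lemma measurable_Y_succ (h : r.Standing c xs ls N μ) (hX : Measurable[𝒢] (r.X t))
    (hY : Measurable[𝒢] (r.Y t)) (hξ : Measurable[𝒢] fun ω => (r.S t ω).ξ₂1) :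
    Measurable[𝒢] (r.Y (t + 1)) :=
  Measurable.const_smul
    (Measurable.add (h.oracle.sf₂.comp (hX.prodMk hξ)) (Measurable.const_smul hY (r.τ t)))
    (1 + r.τ t)⁻¹

lemma measurable_Z_succ (h : r.Standing c xs ls N μ) (hX : Measurable[𝒢] (r.X t))
    (hZ : Measurable[𝒢] (r.Z t)) (hζ : Measurable[𝒢] fun ω => (r.S t ω).ζ₂1) :
    Measurable[𝒢] (r.Z (t + 1)) :=
  Measurable.const_smul
    (Measurable.add (h.oracle.sg₂.comp (hX.prodMk hζ)) (Measurable.const_smul hZ (r.ρ t)))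
    (1 + r.ρ t)⁻¹

lemma measurable_eF (h : r.Standing c xs ls N μ) (hX : Measurable[𝒢] (r.X t))
    (hξ : Measurable[𝒢] fun ω => (r.S t ω).ξ₂1) : Measurable[𝒢] (r.eF t) :=
  Measurable.sub (h.oracle.sf₂.comp (hX.prodMk hξ)) (h.continuous_f₂.measurable.comp hX)

lemma measurable_eG (h : r.Standing c xs ls N μ) (hX : Measurable[𝒢] (r.X t))
    (hζ : Measurable[𝒢] fun ω => (r.S t ω).ζ₂1) : Measurable[𝒢] (r.eG t) :=
  Measurable.sub (h.oracle.sg₂.comp (hX.prodMk hζ)) (h.continuous_g₂.measurable.comp hX)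

lemma measurable_uHat (h : r.Standing c xs ls N μ) (hY : Measurable[𝒢] (r.Y (t + 1)))
    (hξ : Measurable[𝒢] fun ω => (r.S t ω).ξ₁0) : Measurable[𝒢] (r.uHat t) :=
  h.oracle.sgradf₁.comp (hY.prodMk hξ)

lemma measurable_wHat (h : r.Standing c xs ls N μ) (hZ : Measurable[𝒢] (r.Z (t + 1)))
    (hζ : Measurable[𝒢] fun ω => (r.S t ω).ζ₁0) (hL : Measurable[𝒢] (r.L t)) :
    Measurable[𝒢] (r.wHat t) :=
  Measurable.mat_apply (h.oracle.sgradg₁.comp (hZ.prodMk hζ)) hL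

lemma measurable_dF (h : r.Standing c xs ls N μ) (hX : Measurable[𝒢] (r.X t))
    (hξ : Measurable[𝒢] fun ω => (r.S t ω).ξ₂0) (hu : Measurable[𝒢] (r.uHat t)) :
    Measurable[𝒢] (r.dF t) :=
  Measurable.mat_apply (h.oracle.ssubf₂.comp (hX.prodMk hξ)) hu

lemma measurable_dG (h : r.Standing c xs ls N μ) (hX : Measurable[𝒢] (r.X t))
    (hζ : Measurable[𝒢] fun ω => (r.S t ω).ζ₂0) (hw : Measurable[𝒢] (r.wHat t)) :
    Measurable[𝒢] (r.dG t) :=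
  Measurable.mat_apply (h.oracle.ssubg₂.comp (hX.prodMk hζ)) hw

lemma measurable_meanSubF (h : r.Standing c xs ls N μ) (hX : Measurable[𝒢] (r.X t)) :
    Measurable[𝒢] (r.meanSubF t) := by
  have := h.oracle.probξ₂
  have hs := StronglyMeasurable.integral_prod_right (ν := r.P.lawξ₂) (f := r.P.ssubf₂)
    h.oracle.ssubf₂.stronglyMeasurable
  exact hs.measurable.comp hX

lemma measurable_meanSubG (h : r.Standing c xs ls N μ) (hX : Measurable[𝒢] (r.X t)) :
    Measurable[𝒢] (r.meanSubG t) := by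
  have := h.oracle.probζ₂
  have hs := StronglyMeasurable.integral_prod_right (ν := r.P.lawζ₂) (f := r.P.ssubg₂)
    h.oracle.ssubg₂.stronglyMeasurable
  exact hs.measurable.comp hX

lemma measurable_gradF (h : r.Standing c xs ls N μ) (hY : Measurable[𝒢] (r.Y (t + 1))) :
    Measurable[𝒢] (r.gradF t) := h.continuous_gradient.measurable.comp hY

lemma measurable_gradG (h : r.Standing c xs ls N μ) (hZ : Measurable[𝒢] (r.Z (t + 1))) :
    Measurable[𝒢] (r.gradG t) := h.continuous_gradMat.measurable.comp hZ

lemma measurable_jac (h : r.Standing c xs ls N μ) (hZ : Measurable[𝒢] (r.Z (t + 1)))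
    (hζ : Measurable[𝒢] fun ω => (r.S t ω).ζ₁1) : Measurable[𝒢] (r.jac t) :=
  h.oracle.sgradg₁.comp (hZ.prodMk hζ)

lemma measurable_gap (h : r.Standing c xs ls N μ) (hX : Measurable[𝒢] (r.X t))
    (hZ : Measurable[𝒢] (r.Z (t + 1))) :
    Measurable[𝒢] fun ω => r.P.g₂ (r.X t ω) - r.Z (t + 1) ω :=
  Measurable.sub (h.continuous_g₂.measurable.comp hX) hZ

lemma measurable_eH₁ (h : r.Standing c xs ls N μ) (hX : Measurable[𝒢] (r.X t))
    (hZ : Measurable[𝒢] (r.Z (t + 1))) (hζ : Measurable[𝒢] fun ω => (r.S t ω).ζ₁1) :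
    Measurable[𝒢] (r.eH₁ t) :=
  Measurable.add (Measurable.sub (h.oracle.sg₁.comp (hZ.prodMk hζ))
      (h.con.g₁_diff.continuous.measurable.comp hZ))
    (Measurable.sub ((h.measurable_jac hZ hζ).mat_tr.mat_apply (h.measurable_gap hX hZ))
      ((h.measurable_gradG hZ).mat_tr.mat_apply (h.measurable_gap hX hZ)))

lemma measurable_eH₂ (h : r.Standing c xs ls N μ) (hX : Measurable[𝒢] (r.X t))
    (hZ : Measurable[𝒢] (r.Z (t + 1))) (hζ : Measurable[𝒢] fun ω => (r.S t ω).ζ₁1)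
    (hζ₂ : Measurable[𝒢] fun ω => (r.S t ω).ζ₂2) : Measurable[𝒢] (r.eH₂ t) :=
  (h.measurable_jac hZ hζ).mat_tr.mat_apply
    (Measurable.sub (h.oracle.sg₂.comp (hX.prodMk hζ₂)) (h.continuous_g₂.measurable.comp hX))

lemma measurable_eH (h : r.Standing c xs ls N μ) (hX : Measurable[𝒢] (r.X t))
    (hZ : Measurable[𝒢] (r.Z (t + 1))) (hζ : Measurable[𝒢] fun ω => (r.S t ω).ζ₁1)
    (hζ₂ : Measurable[𝒢] fun ω => (r.S t ω).ζ₂2) : Measurable[𝒢] (r.eH t) := by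
  rw [show r.eH t = fun ω => r.eH₁ t ω + r.eH₂ t ω from funext (r.eH_eq t)]
  exact Measurable.add (h.measurable_eH₁ hX hZ hζ) (h.measurable_eH₂ hX hZ hζ hζ₂)

lemma measurable_H (h : r.Standing c xs ls N μ) (hX : Measurable[𝒢] (r.X t))
    (hZ : Measurable[𝒢] (r.Z (t + 1))) (hζ : Measurable[𝒢] fun ω => (r.S t ω).ζ₁1)
    (hζ₂ : Measurable[𝒢] fun ω => (r.S t ω).ζ₂2) : Measurable[𝒢] (r.H t) :=
  Measurable.add (Measurable.sub (h.oracle.sg₁.comp (hZ.prodMk hζ))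
    ((h.measurable_jac hZ hζ).mat_tr.mat_apply hZ))
    ((h.measurable_jac hZ hζ).mat_tr.mat_apply (h.oracle.sg₂.comp (hX.prodMk hζ₂)))

lemma measurable_state (h : r.Standing c xs ls N μ) (t : ℕ) :
    Measurable[pastAlg r.S t] (r.X t) ∧ Measurable[pastAlg r.S t] (r.Y t) ∧
    Measurable[pastAlg r.S t] (r.Z t) ∧ Measurable[pastAlg r.S t] (r.L t) := by
  induction t with
  | zero => exact ⟨measurable_const, measurable_const, measurable_const, measurable_const⟩
  | succ t ih =>
    obtain ⟨h1, h2, h3, h4, h5, h6, h7, h8⟩ :=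
      measurable_draw (measurable_pastAlg r.S (Nat.lt_succ_self t))
    have hle := pastAlg_mono r.S (Nat.le_succ t)
    have hX := ih.1.mono hle le_rfl
    have hL := ih.2.2.2.mono hle le_rfl
    have hY := h.measurable_Y_succ hX (ih.2.1.mono hle le_rfl) h2
    have hZ := h.measurable_Z_succ hX (ih.2.2.1.mono hle le_rfl) h5
    refine ⟨?_, hY, hZ, ?_⟩
    -- The primal update needs y_{t+1} and z_{t+1}, which use draws of the same iteration; all of
    -- them belong to the past of time t + 1.
    · rw [show r.X (t + 1) = fun ω => projOn r.P.X
        (r.X t ω - (r.η t)⁻¹ • (r.dF t ω + r.dG t ω)) from rfl]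
      refine (continuous_projOn ⟨xs, h.saddle.mem⟩ h.obj.X_closed h.obj.X_convex).measurable.comp
        (Measurable.sub hX (Measurable.const_smul (Measurable.add ?_ ?_) (r.η t)⁻¹))
      · exact h.measurable_dF hX h1 (h.measurable_uHat hY h3)
      · exact h.measurable_dG hX h4 (h.measurable_wHat hZ h7 hL)
    · exact continuous_posVec.measurable.comp
        (Measurable.add hL (Measurable.const_smul (h.measurable_H hX hZ h8 h6) (r.α t)⁻¹))

end Measurability

/-! ### Each coordinate of a draw is fresh given the past and the other coordinates. -/

section Fresh

variable {r : CoCRun dx dy dz m Ξ₁ Ξ₂ Z₁ Z₂ Ω} {c : CoCConsts} {xs : Eu dx} {ls : Eu m} {N : ℕ}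
  {mΩ : MeasurableSpace Ω} {μ : Measure Ω} [IsProbabilityMeasure μ]

lemma fresh_of_extract (h : r.Standing c xs ls N μ) (t : ℕ) {R C : Type*} [MeasurableSpace R]
    [MeasurableSpace C] {π : Draw Ξ₁ Ξ₂ Z₁ Z₂ → R × C} {ρ : Measure R} {κ : Measure C}
    [IsProbabilityMeasure ρ] [IsProbabilityMeasure κ]
    (hπ : MeasurePreserving π r.P.drawLaw (ρ.prod κ)) :
    IsFresh (pastAlg r.S t ⊔ MeasurableSpace.comap (fun ω => (π (r.S t ω)).1) inferInstance)
      (fun ω => (π (r.S t ω)).2) κ μ := by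
  have hS := h.sampling.meas
  have m1 : Measurable fun ω => (π (r.S t ω)).1 := (hπ.measurable.comp (hS t)).fst
  have m2 : Measurable fun ω => (π (r.S t ω)).2 := (hπ.measurable.comp (hS t)).snd
  have hπ' : MeasurePreserving π (μ.map (r.S t)) (ρ.prod κ) := by rwa [h.sampling.law t]
  refine ⟨sup_le (pastAlg_le hS t) m1.comap_le, m2,
    indep_sup_fst_snd (pastAlg_le hS t) (hS t) (indep_pastAlg hS h.sampling.indep t) hπ', ?_⟩
  have : (fun ω => (π (r.S t ω)).2) = Prod.snd ∘ π ∘ r.S t := rfl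
  rw [this, ← Measure.map_map measurable_snd (hπ.measurable.comp (hS t)),
    ← Measure.map_map hπ.measurable (hS t), hπ'.map_eq]
  exact Measure.map_snd_prod.trans (by simp)

/-- The conditioning σ-algebra must contain whatever else the sampled direction depends on: here
ξ₂¹, through y_{t+1}, and ξ₁⁰, through the sampled outer gradient. The companion statements record
the same kind of dependence for the other coordinates. -/
lemma fresh_ξ₂0 (h : r.Standing c xs ls N μ) (t : ℕ) :
    ∃ 𝒢, IsFresh 𝒢 (fun ω => (r.S t ω).ξ₂0) r.P.lawξ₂ μ ∧ pastAlg r.S t ≤ 𝒢 ∧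
      Measurable[𝒢] (fun ω => (r.S t ω).ξ₂1) ∧ Measurable[𝒢] (fun ω => (r.S t ω).ξ₁0) := by
  have := h.oracle.probξ₁
  have := h.oracle.probξ₂
  have := h.oracle.probζ₁
  have := h.oracle.probζ₂
  have hπ : MeasurePreserving _ r.P.drawLaw _ := Measure.measurePreserving_swap
  exact ⟨_, h.fresh_of_extract t hπ, le_sup_left, measurable_rest t (π := Prod.swap) measurable_fst,
    measurable_rest t (π := Prod.swap) measurable_snd.fst⟩

lemma fresh_ξ₂1 (h : r.Standing c xs ls N μ) (t : ℕ) :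
    ∃ 𝒢, IsFresh 𝒢 (fun ω => (r.S t ω).ξ₂1) r.P.lawξ₂ μ ∧ pastAlg r.S t ≤ 𝒢 := by
  have := h.oracle.probξ₁
  have := h.oracle.probξ₂
  have := h.oracle.probζ₁
  have := h.oracle.probζ₂
  have hπ : MeasurePreserving _ r.P.drawLaw _ :=
    measurePreserving_extract Measure.measurePreserving_swap
  exact ⟨_, h.fresh_of_extract t hπ, le_sup_left⟩

lemma fresh_ξ₁0 (h : r.Standing c xs ls N μ) (t : ℕ) :
    ∃ 𝒢, IsFresh 𝒢 (fun ω => (r.S t ω).ξ₁0) r.P.lawξ₁ μ ∧ pastAlg r.S t ≤ 𝒢 ∧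
      Measurable[𝒢] (fun ω => (r.S t ω).ξ₂1) := by
  have := h.oracle.probξ₁
  have := h.oracle.probξ₂
  have := h.oracle.probζ₁
  have := h.oracle.probζ₂
  have hπ : MeasurePreserving _ r.P.drawLaw _ :=
    measurePreserving_extract (measurePreserving_extract Measure.measurePreserving_swap)
  exact ⟨_, h.fresh_of_extract t hπ, le_sup_left,
    measurable_rest t (π := fun s => ((s.1, s.2.1, s.2.2.2), s.2.2.1)) measurable_snd.fst⟩

lemma fresh_ζ₂0 (h : r.Standing c xs ls N μ) (t : ℕ) :
    ∃ 𝒢, IsFresh 𝒢 (fun ω => (r.S t ω).ζ₂0) r.P.lawζ₂ μ ∧ pastAlg r.S t ≤ 𝒢 ∧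
      Measurable[𝒢] (fun ω => (r.S t ω).ζ₂1) ∧ Measurable[𝒢] (fun ω => (r.S t ω).ζ₁0) := by
  have := h.oracle.probξ₁
  have := h.oracle.probξ₂
  have := h.oracle.probζ₁
  have := h.oracle.probζ₂
  have hπ : MeasurePreserving _ r.P.drawLaw _ :=
    measurePreserving_extract (measurePreserving_extract (measurePreserving_extract
      Measure.measurePreserving_swap))
  exact ⟨_, h.fresh_of_extract t hπ, le_sup_left,
    measurable_rest t (π := fun s => ((s.1, s.2.1, s.2.2.1, s.2.2.2.2), s.2.2.2.1))
      measurable_snd.snd.snd.fst,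
    measurable_rest t (π := fun s => ((s.1, s.2.1, s.2.2.1, s.2.2.2.2), s.2.2.2.1))
      measurable_snd.snd.snd.snd.snd.fst⟩

lemma fresh_ζ₂1 (h : r.Standing c xs ls N μ) (t : ℕ) :
    ∃ 𝒢, IsFresh 𝒢 (fun ω => (r.S t ω).ζ₂1) r.P.lawζ₂ μ ∧ pastAlg r.S t ≤ 𝒢 := by
  have := h.oracle.probξ₁
  have := h.oracle.probξ₂
  have := h.oracle.probζ₁
  have := h.oracle.probζ₂
  have hπ : MeasurePreserving _ r.P.drawLaw _ :=
    measurePreserving_extract (measurePreserving_extract (measurePreserving_extract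
      (measurePreserving_extract Measure.measurePreserving_swap)))
  exact ⟨_, h.fresh_of_extract t hπ, le_sup_left⟩

lemma fresh_ζ₂2 (h : r.Standing c xs ls N μ) (t : ℕ) :
    ∃ 𝒢, IsFresh 𝒢 (fun ω => (r.S t ω).ζ₂2) r.P.lawζ₂ μ ∧ pastAlg r.S t ≤ 𝒢 ∧
      Measurable[𝒢] (fun ω => (r.S t ω).ζ₂1) ∧ Measurable[𝒢] (fun ω => (r.S t ω).ζ₁1) := by
  have := h.oracle.probξ₁
  have := h.oracle.probξ₂
  have := h.oracle.probζ₁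
  have := h.oracle.probζ₂
  have hπ : MeasurePreserving _ r.P.drawLaw _ :=
    measurePreserving_extract (measurePreserving_extract (measurePreserving_extract
      (measurePreserving_extract (measurePreserving_extract Measure.measurePreserving_swap))))
  exact ⟨_, h.fresh_of_extract t hπ, le_sup_left,
    measurable_rest t (π := fun s => ((s.1, s.2.1, s.2.2.1, s.2.2.2.1, s.2.2.2.2.1,
      s.2.2.2.2.2.2), s.2.2.2.2.2.1)) measurable_snd.snd.snd.snd.fst,
    measurable_rest t (π := fun s => ((s.1, s.2.1, s.2.2.1, s.2.2.2.1, s.2.2.2.2.1,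
      s.2.2.2.2.2.2), s.2.2.2.2.2.1)) measurable_snd.snd.snd.snd.snd.snd⟩

lemma fresh_ζ₁0 (h : r.Standing c xs ls N μ) (t : ℕ) :
    ∃ 𝒢, IsFresh 𝒢 (fun ω => (r.S t ω).ζ₁0) r.P.lawζ₁ μ ∧ pastAlg r.S t ≤ 𝒢 ∧
      Measurable[𝒢] (fun ω => (r.S t ω).ζ₂1) := by
  have := h.oracle.probξ₁
  have := h.oracle.probξ₂
  have := h.oracle.probζ₁
  have := h.oracle.probζ₂
  have hπ : MeasurePreserving _ r.P.drawLaw _ :=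
    measurePreserving_extract (measurePreserving_extract (measurePreserving_extract
      (measurePreserving_extract (measurePreserving_extract (measurePreserving_extract
        Measure.measurePreserving_swap)))))
  exact ⟨_, h.fresh_of_extract t hπ, le_sup_left,
    measurable_rest t (π := fun s => ((s.1, s.2.1, s.2.2.1, s.2.2.2.1, s.2.2.2.2.1,
      s.2.2.2.2.2.1, s.2.2.2.2.2.2.2), s.2.2.2.2.2.2.1)) measurable_snd.snd.snd.snd.fst⟩

lemma fresh_ζ₁1 (h : r.Standing c xs ls N μ) (t : ℕ) :
    ∃ 𝒢, IsFresh 𝒢 (fun ω => (r.S t ω).ζ₁1) r.P.lawζ₁ μ ∧ pastAlg r.S t ≤ 𝒢 ∧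
      Measurable[𝒢] (fun ω => (r.S t ω).ζ₂1) := by
  have := h.oracle.probξ₁
  have := h.oracle.probξ₂
  have := h.oracle.probζ₁
  have := h.oracle.probζ₂
  -- The wanted coordinate is last, so the innermost pair is already in the right order and the
  -- identity takes the place of the swap.
  have hπ : MeasurePreserving _ r.P.drawLaw _ :=
    measurePreserving_extract (measurePreserving_extract (measurePreserving_extract
      (measurePreserving_extract (measurePreserving_extract (measurePreserving_extract
        (MeasurePreserving.id _))))))
  exact ⟨_, h.fresh_of_extract t hπ, le_sup_left,
    measurable_rest t (π := fun s => ((s.1, s.2.1, s.2.2.1, s.2.2.2.1, s.2.2.2.2.1,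
      s.2.2.2.2.2.1, s.2.2.2.2.2.2.1), s.2.2.2.2.2.2.2)) measurable_snd.snd.snd.snd.fst⟩

end Fresh

end Standing

end CoCRun

/-! ### Sampled matrices and centred noise. -/

section L2Matrices

variable {Ω : Type*} {mΩ : MeasurableSpace Ω} {μ : Measure Ω} {p q : ℕ}

lemma MeasureTheory.MemLp.mat_apply_of_bounded {A : Ω → Mat p q} {U : Ω → Eu q} {K : ℝ}
    (hA : Measurable A) (hK : ∀ ω, ‖A ω‖ ≤ K) (hU : MemLp U 2 μ) (hUm : Measurable U) :
    MemLp (fun ω => A ω (U ω)) 2 μ := by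
  refine MemLp.of_le_mul (c := K) hU (hA.mat_apply hUm).aestronglyMeasurable
    (Filter.Eventually.of_forall fun ω => ?_)
  exact ((A ω).le_opNorm _).trans (mul_le_mul_of_nonneg_right (hK ω) (norm_nonneg _))

/-- Centred part and mean are orthogonal, so subtracting the mean only lowers the second moment.
This gives the Jacobian fluctuation the bound C_{g₁}² without an extra factor. -/
lemma integral_sq_sub_mean_le {E : Type*} [NormedAddCommGroup E] [InnerProductSpace ℝ E]
    [CompleteSpace E] [IsProbabilityMeasure μ] {f : Ω → E} (hf : MemLp f 2 μ) :
    ∫ ω, ‖f ω - ∫ ω', f ω' ∂μ‖ ^ 2 ∂μ ≤ ∫ ω, ‖f ω‖ ^ 2 ∂μ := by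
  set a := ∫ ω', f ω' ∂μ
  have i1 := hf.integrable_of_two
  have h1 : MemLp (fun ω => f ω - a) 2 μ := hf.sub (memLp_const a)
  have horth : ∫ ω, (inner ℝ (f ω - a) a : ℝ) ∂μ = 0 := by
    simp only [real_inner_comm a]
    rw [integral_inner (f := fun ω => f ω - a) (i1.sub (integrable_const a)),
      integral_sub i1 (integrable_const a)]
    simp [a]
  have := integral_sq_add_of_orthogonal h1 (memLp_const a) horth
  simp only [sub_add_cancel] at this
  rw [this]
  linarith [integral_nonneg (μ := μ) (f := fun _ : Ω => ‖a‖ ^ 2) fun _ => sq_nonneg _]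

end L2Matrices

namespace IsFresh

variable {Ω C : Type*} [MeasurableSpace C] {𝒢 : MeasurableSpace Ω} {mΩ : MeasurableSpace Ω}
  {μ : Measure Ω} [IsProbabilityMeasure μ] {Y : Ω → C} {κ : Measure C} {n p q : ℕ}

lemma isProbabilityMeasure (h : IsFresh 𝒢 Y κ μ) : IsProbabilityMeasure κ :=
  h.law ▸ Measure.isProbabilityMeasure_map h.meas.aemeasurable

section Matrices

variable {A : Eu n → C → Mat p q} {x : Ω → Eu n} {U : Ω → Eu q} {K : ℝ}

lemma sq_mat_le (h : IsFresh 𝒢 Y κ μ) (hA : Measurable (Function.uncurry A))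
    (hx : Measurable[𝒢] x) (hL2 : ∀ ω, MemLp (A (x ω)) 2 κ)
    (hK : ∀ ω, ∫ y, ‖A (x ω) y‖ ^ 2 ∂κ ≤ K ^ 2) :
    MemLp (fun ω => A (x ω) (Y ω)) 2 μ ∧ ∫ ω, ‖A (x ω) (Y ω)‖ ^ 2 ∂μ ≤ K ^ 2 := by
  have hm : AEStronglyMeasurable (fun ω => A (x ω) (Y ω)) μ :=
    (hA.comp ((hx.mono h.le le_rfl).prodMk h.meas)).aestronglyMeasurable
  have : ∫⁻ ω, ‖A (x ω) (Y ω)‖ₑ ^ 2 ∂μ ≤ ENNReal.ofReal (K ^ 2) := by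
    refine (h.lintegral_sq_le hx hA (k := fun _ => ENNReal.ofReal (K ^ 2)) fun ω => ?_).trans
      (by simp)
    rw [lintegral_enorm_sq_eq (hL2 ω)]
    exact ENNReal.ofReal_le_ofReal (hK ω)
  exact ⟨memLp_two_of_lintegral_le hm this, integral_sq_le_of_lintegral_le hm (sq_nonneg K) this⟩

/-- With the past frozen, the operator norm separates the fresh matrix from the vector U, so second
moments multiply although the matrix law depends on x. -/
lemma sq_apply_le (h : IsFresh 𝒢 Y κ μ) (hA : Measurable (Function.uncurry A))
    (hx : Measurable[𝒢] x) (hU : Measurable[𝒢] U) (hL2 : ∀ ω, MemLp (A (x ω)) 2 κ)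
    (hK : ∀ ω, ∫ y, ‖A (x ω) y‖ ^ 2 ∂κ ≤ K ^ 2) (hU2 : MemLp U 2 μ) :
    MemLp (fun ω => A (x ω) (Y ω) (U ω)) 2 μ ∧
      ∫ ω, ‖A (x ω) (Y ω) (U ω)‖ ^ 2 ∂μ ≤ K ^ 2 * ∫ ω, ‖U ω‖ ^ 2 ∂μ := by
  have hm : AEStronglyMeasurable (fun ω => A (x ω) (Y ω) (U ω)) μ :=
    ((hA.comp ((hx.mono h.le le_rfl).prodMk h.meas)).mat_apply
      (hU.mono h.le le_rfl)).aestronglyMeasurable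
  have hφ : Measurable (Function.uncurry fun (v : Eu n × Eu q) y => A v.1 y v.2) := by
    have h1 : Measurable fun w : (Eu n × Eu q) × C => A w.1.1 w.2 :=
      hA.comp (measurable_fst.fst.prodMk measurable_snd)
    exact h1.mat_apply measurable_fst.snd
  have : ∫⁻ ω, ‖A (x ω) (Y ω) (U ω)‖ₑ ^ 2 ∂μ ≤
      ENNReal.ofReal (K ^ 2 * ∫ ω, ‖U ω‖ ^ 2 ∂μ) := by
    refine (h.lintegral_sq_le (V := fun ω => (x ω, U ω)) (hx.prodMk hU) hφ
      (k := fun ω => ENNReal.ofReal (K ^ 2) * ‖U ω‖ₑ ^ 2) fun ω => ?_).trans ?_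
    · calc ∫⁻ y, ‖A (x ω) y (U ω)‖ₑ ^ 2 ∂κ ≤ ∫⁻ y, ‖A (x ω) y‖ₑ ^ 2 * ‖U ω‖ₑ ^ 2 ∂κ := by
            refine lintegral_mono fun y => ?_
            rw [← mul_pow]
            exact pow_le_pow_left₀ zero_le ((A (x ω) y).le_opENorm _) 2
        _ = (∫⁻ y, ‖A (x ω) y‖ₑ ^ 2 ∂κ) * ‖U ω‖ₑ ^ 2 :=
            lintegral_mul_const' _ _ (by simp)
        _ ≤ _ := by
            gcongr
            rw [lintegral_enorm_sq_eq (hL2 ω)]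
            exact ENNReal.ofReal_le_ofReal (hK ω)
    · rw [lintegral_const_mul' _ _ ENNReal.ofReal_ne_top, lintegral_enorm_sq_eq hU2,
        ENNReal.ofReal_mul (sq_nonneg K)]
  exact ⟨memLp_two_of_lintegral_le hm this, integral_sq_le_of_lintegral_le hm
    (mul_nonneg (sq_nonneg K) (integral_nonneg fun _ => sq_nonneg _)) this⟩

lemma inner_apply_eq (h : IsFresh 𝒢 Y κ μ) (hA : Measurable (Function.uncurry A))
    (hx : Measurable[𝒢] x) (hU : Measurable[𝒢] U) (hL2 : ∀ ω, MemLp (A (x ω)) 2 κ)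
    (hK : ∀ ω, ∫ y, ‖A (x ω) y‖ ^ 2 ∂κ ≤ K ^ 2) (hU2 : MemLp U 2 μ) {V : Ω → Eu p}
    (hV : Measurable[𝒢] V) (hV2 : MemLp V 2 μ) :
    ∫ ω, (inner ℝ (A (x ω) (Y ω) (U ω)) (V ω) : ℝ) ∂μ =
      ∫ ω, (inner ℝ ((∫ y, A (x ω) y ∂κ) (U ω)) (V ω) : ℝ) ∂μ := by
  have := h.isProbabilityMeasure
  have hφ : Measurable (Function.uncurry fun (v : Eu n × Eu q) y => A v.1 y v.2) := by
    have h1 : Measurable fun w : (Eu n × Eu q) × C => A w.1.1 w.2 :=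
      hA.comp (measurable_fst.fst.prodMk measurable_snd)
    exact h1.mat_apply measurable_fst.snd
  refine h.integral_inner_eq (V := fun ω => (x ω, U ω)) (hx.prodMk hU) hV hφ (fun ω => ?_)
    (fun ω => ?_) (h.sq_apply_le hA hx hU hL2 hK hU2).1 hV2
  · exact (hL2 ω).integrable_of_two.apply_continuousLinearMap (U ω)
  · exact (ContinuousLinearMap.integral_apply (hL2 ω).integrable_of_two (U ω)).symm

end Matrices

section Noise

variable {s : Eu n → C → Eu q} {f : Eu n → Eu q} {x : Ω → Eu n} {A : Ω → Mat p q} {σ : ℝ}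

/-- The noise is centred given 𝒢, and A is known to 𝒢; hence second moments multiply and the image
is orthogonal to everything known to 𝒢. The matrix is needed for the inner error seen through the
sampled Jacobian. -/
lemma noise_apply (h : IsFresh 𝒢 Y κ μ) (hs : Measurable (Function.uncurry s))
    (hf : Measurable f) (hx : Measurable[𝒢] x) (hA : Measurable[𝒢] A) (hA2 : MemLp A 2 μ)
    (hL2 : ∀ ω, MemLp (s (x ω)) 2 κ) (hmean : ∀ ω, ∫ y, s (x ω) y ∂κ = f (x ω))
    (hσ : ∀ ω, ∫ y, ‖s (x ω) y - f (x ω)‖ ^ 2 ∂κ ≤ σ ^ 2) :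
    MemLp (fun ω => A ω (s (x ω) (Y ω) - f (x ω))) 2 μ ∧
      ∫ ω, ‖A ω (s (x ω) (Y ω) - f (x ω))‖ ^ 2 ∂μ ≤ (∫ ω, ‖A ω‖ ^ 2 ∂μ) * σ ^ 2 ∧
      ∀ V : Ω → Eu p, Measurable[𝒢] V → MemLp V 2 μ →
        ∫ ω, (inner ℝ (A ω (s (x ω) (Y ω) - f (x ω))) (V ω) : ℝ) ∂μ = 0 := by
  have := h.isProbabilityMeasure
  have hL2' : ∀ ω, MemLp (fun y => s (x ω) y - f (x ω)) 2 κ := fun ω =>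
    (hL2 ω).sub (memLp_const _)
  have hφ : Measurable (Function.uncurry fun (v : Eu n × Mat p q) y => v.2 (s v.1 y - f v.1)) := by
    have h1 : Measurable fun w : (Eu n × Mat p q) × C => s w.1.1 w.2 - f w.1.1 :=
      Measurable.sub (hs.comp (measurable_fst.fst.prodMk measurable_snd))
        (hf.comp measurable_fst.fst)
    exact measurable_fst.snd.mat_apply h1
  have hm : AEStronglyMeasurable (fun ω => A ω (s (x ω) (Y ω) - f (x ω))) μ :=
    (hφ.comp (((hx.prodMk hA).mono h.le le_rfl).prodMk h.meas)).aestronglyMeasurable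
  have hle : ∫⁻ ω, ‖A ω (s (x ω) (Y ω) - f (x ω))‖ₑ ^ 2 ∂μ ≤
      ENNReal.ofReal ((∫ ω, ‖A ω‖ ^ 2 ∂μ) * σ ^ 2) := by
    refine (h.lintegral_sq_le (V := fun ω => (x ω, A ω)) (hx.prodMk hA) hφ
      (k := fun ω => ‖A ω‖ₑ ^ 2 * ENNReal.ofReal (σ ^ 2)) fun ω => ?_).trans ?_
    · calc ∫⁻ y, ‖A ω (s (x ω) y - f (x ω))‖ₑ ^ 2 ∂κ
          ≤ ∫⁻ y, ‖A ω‖ₑ ^ 2 * ‖s (x ω) y - f (x ω)‖ₑ ^ 2 ∂κ := by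
            refine lintegral_mono fun y => ?_
            rw [← mul_pow]
            exact pow_le_pow_left₀ zero_le ((A ω).le_opENorm _) 2
        _ = ‖A ω‖ₑ ^ 2 * ∫⁻ y, ‖s (x ω) y - f (x ω)‖ₑ ^ 2 ∂κ :=
            lintegral_const_mul' _ _ (by simp)
        _ ≤ _ := by
            gcongr
            rw [lintegral_enorm_sq_eq (hL2' ω)]
            exact ENNReal.ofReal_le_ofReal (hσ ω)
    · rw [lintegral_mul_const' _ _ ENNReal.ofReal_ne_top, lintegral_enorm_sq_eq hA2,
        ENNReal.ofReal_mul (integral_nonneg fun _ => sq_nonneg _)]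
  have h2 := memLp_two_of_lintegral_le hm hle
  refine ⟨h2, integral_sq_le_of_lintegral_le hm
    (mul_nonneg (integral_nonneg fun _ => sq_nonneg _) (sq_nonneg σ)) hle, fun V hV hV2 => ?_⟩
  rw [h.integral_inner_eq (V := fun ω => (x ω, A ω)) (hx.prodMk hA) hV hφ (ψ := fun _ => 0)
    (fun ω => ?_) (fun ω => ?_) h2 hV2]
  · simp
  · exact (A ω).integrable_comp (hL2' ω).integrable_of_two
  · simp only
    rw [ContinuousLinearMap.integral_comp_comm _ (hL2' ω).integrable_of_two,
      integral_sub (hL2 ω).integrable_of_two (integrable_const _), hmean ω]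
    simp

lemma noise (h : IsFresh 𝒢 Y κ μ) (hs : Measurable (Function.uncurry s))
    (hf : Measurable f) (hx : Measurable[𝒢] x)
    (hL2 : ∀ ω, MemLp (s (x ω)) 2 κ) (hmean : ∀ ω, ∫ y, s (x ω) y ∂κ = f (x ω))
    (hσ : ∀ ω, ∫ y, ‖s (x ω) y - f (x ω)‖ ^ 2 ∂κ ≤ σ ^ 2) :
    MemLp (fun ω => s (x ω) (Y ω) - f (x ω)) 2 μ ∧
      ∫ ω, ‖s (x ω) (Y ω) - f (x ω)‖ ^ 2 ∂μ ≤ σ ^ 2 ∧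
      ∀ V : Ω → Eu q, Measurable[𝒢] V → MemLp V 2 μ →
        ∫ ω, (inner ℝ (s (x ω) (Y ω) - f (x ω)) (V ω) : ℝ) ∂μ = 0 := by
  obtain ⟨h1, h2, h3⟩ := h.noise_apply hs hf hx
    (A := fun _ => ContinuousLinearMap.id ℝ (Eu q)) measurable_const (memLp_const _) hL2 hmean hσ
  refine ⟨h1, h2.trans ?_, h3⟩
  have h4 : ‖ContinuousLinearMap.id ℝ (Eu q)‖ ^ 2 ≤ 1 :=
    pow_le_one₀ (norm_nonneg _) ContinuousLinearMap.norm_id_le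
  rw [integral_const, probReal_univ, one_smul]
  nlinarith [sq_nonneg σ]

end Noise

end IsFresh

/-! ### Moments and means of the sampled directions. -/

namespace CoCRun.Standing

variable {dx dy dz m : ℕ} {Ξ₁ Ξ₂ Z₁ Z₂ Ω : Type*} [MeasurableSpace Ξ₁] [MeasurableSpace Ξ₂]
  [MeasurableSpace Z₁] [MeasurableSpace Z₂] {r : CoCRun dx dy dz m Ξ₁ Ξ₂ Z₁ Z₂ Ω}
  {c : CoCConsts} {xs : Eu dx} {ls : Eu m} {N : ℕ}
  {mΩ : MeasurableSpace Ω} {μ : Measure Ω}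

/-- The exact gradient is the mean of the sampled one, whose second moment is bounded. The next
three bounds rest on the same remark. -/
lemma norm_gradient_le (h : r.Standing c xs ls N μ) (y : Eu dy) : ‖gradient r.P.f₁ y‖ ≤ c.Cf₁ := by
  have := h.oracle.probξ₁
  rw [← h.obj.gradf₁_unbiased y]
  exact norm_integral_le_of_sq (h.obj.gradf₁_L2 y) h.obj.Cf₁_pos.le (h.obj.gradf₁_moment y)

lemma norm_gradMat_le (h : r.Standing c xs ls N μ) (z : Eu dz) : ‖gradMat r.P.g₁ z‖ ≤ c.Cg₁ := by
  have := h.oracle.probζ₁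
  rw [← h.con.gradg₁_unbiased z]
  exact norm_integral_le_of_sq (h.con.gradg₁_L2 z) h.con.Cg₁_pos.le (h.con.gradg₁_moment z)

lemma norm_meanSubF_le (h : r.Standing c xs ls N μ) {x : Eu dx} (hx : x ∈ r.P.X) :
    ‖∫ ξ, r.P.ssubf₂ x ξ ∂r.P.lawξ₂‖ ≤ c.Cf₂ := by
  have := h.oracle.probξ₂
  exact norm_integral_le_of_sq (h.obj.subf₂_L2 x hx) h.obj.Cf₂_pos.le (h.obj.subf₂_moment x hx)

lemma norm_meanSubG_le (h : r.Standing c xs ls N μ) {x : Eu dx} (hx : x ∈ r.P.X) :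
    ‖∫ ζ, r.P.ssubg₂ x ζ ∂r.P.lawζ₂‖ ≤ c.Cg₂ := by
  have := h.oracle.probζ₂
  exact norm_integral_le_of_sq (h.con.subg₂_L2 x hx) h.con.Cg₂_pos.le (h.con.subg₂_moment x hx)

lemma f₂_lipschitz (h : r.Standing c xs ls N μ) : ∀ u ∈ r.P.X, ∀ w ∈ r.P.X,
    ‖r.P.f₂ u - r.P.f₂ w‖ ≤ c.Cf₂ * ‖u - w‖ := fun _ hu _ hw =>
  lipschitz_of_subgradient h.obj.X_convex h.obj.subf₂_unbiased
    (fun _ hx => h.norm_meanSubF_le hx) hu hw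

lemma g₂_lipschitz (h : r.Standing c xs ls N μ) : ∀ u ∈ r.P.X, ∀ w ∈ r.P.X,
    ‖r.P.g₂ u - r.P.g₂ w‖ ≤ c.Cg₂ * ‖u - w‖ := fun _ hu _ hw =>
  lipschitz_of_subgradient h.obj.X_convex h.con.subg₂_unbiased
    (fun _ hx => h.norm_meanSubG_le hx) hu hw

variable [IsProbabilityMeasure μ]

lemma eF_facts (h : r.Standing c xs ls N μ) (t : ℕ) :
    MemLp (r.eF t) 2 μ ∧ ∫ ω, ‖r.eF t ω‖ ^ 2 ∂μ ≤ c.σf₂ ^ 2 ∧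
      ∀ V : Ω → Eu dy, Measurable[pastAlg r.S t] V → MemLp V 2 μ →
        ∫ ω, (inner ℝ (r.eF t ω) (V ω) : ℝ) ∂μ = 0 := by
  obtain ⟨𝒢, hf, hle⟩ := h.fresh_ξ₂1 t
  obtain ⟨h1, h2, h3⟩ := hf.noise (x := r.X t) h.oracle.sf₂ h.continuous_f₂.measurable
    ((h.measurable_state t).1.mono hle le_rfl) (fun ω => h.obj.f₂_L2 _ (h.X_mem t ω))
    (fun ω => h.obj.f₂_unbiased _ (h.X_mem t ω)) (fun ω => h.obj.f₂_var _ (h.X_mem t ω))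
  exact ⟨h1, h2, fun V hV => h3 V (hV.mono hle le_rfl)⟩

lemma eG_facts (h : r.Standing c xs ls N μ) (t : ℕ) :
    MemLp (r.eG t) 2 μ ∧ ∫ ω, ‖r.eG t ω‖ ^ 2 ∂μ ≤ c.σg₂ ^ 2 ∧
      ∀ V : Ω → Eu dz, Measurable[pastAlg r.S t] V → MemLp V 2 μ →
        ∫ ω, (inner ℝ (r.eG t ω) (V ω) : ℝ) ∂μ = 0 := by
  obtain ⟨𝒢, hf, hle⟩ := h.fresh_ζ₂1 t
  obtain ⟨h1, h2, h3⟩ := hf.noise (x := r.X t) h.oracle.sg₂ h.continuous_g₂.measurable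
    ((h.measurable_state t).1.mono hle le_rfl) (fun ω => h.con.g₂_L2 _ (h.X_mem t ω))
    (fun ω => h.con.g₂_unbiased _ (h.X_mem t ω)) (fun ω => h.con.g₂_var _ (h.X_mem t ω))
  exact ⟨h1, h2, fun V hV => h3 V (hV.mono hle le_rfl)⟩

/-- The point y_{t+1} uses ξ₂¹ of the same iteration, but the outer sample ξ₁⁰ is fresh even given
it, so averaging leaves the exact gradient at y_{t+1}. -/
lemma uHat_facts (h : r.Standing c xs ls N μ) (t : ℕ) :
    MemLp (r.uHat t) 2 μ ∧ ∫ ω, ‖r.uHat t ω‖ ^ 2 ∂μ ≤ c.Cf₁ ^ 2 ∧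
      ∀ V : Ω → Eu dy, Measurable[pastAlg r.S t] V → MemLp V 2 μ →
        ∫ ω, (inner ℝ (r.uHat t ω) (V ω) : ℝ) ∂μ = ∫ ω, (inner ℝ (r.gradF t ω) (V ω) : ℝ) ∂μ := by
  obtain ⟨𝒢, hf, hle, hξ⟩ := h.fresh_ξ₁0 t
  have := h.oracle.probξ₁
  obtain ⟨hX, hY, -, -⟩ := h.measurable_state t
  have hY' := h.measurable_Y_succ (hX.mono hle le_rfl) (hY.mono hle le_rfl) hξ
  have hm := (h.oracle.sgradf₁.comp
    ((hY'.mono hf.le le_rfl).prodMk hf.meas)).aestronglyMeasurable (μ := μ)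
  have hb : ∫⁻ ω, ‖r.uHat t ω‖ₑ ^ 2 ∂μ ≤ ENNReal.ofReal (c.Cf₁ ^ 2) := by
    refine (hf.lintegral_sq_le hY' h.oracle.sgradf₁
      (k := fun _ => ENNReal.ofReal (c.Cf₁ ^ 2)) fun ω => ?_).trans (by simp)
    rw [lintegral_enorm_sq_eq (h.obj.gradf₁_L2 _)]
    exact ENNReal.ofReal_le_ofReal (h.obj.gradf₁_moment _)
  have h2 := memLp_two_of_lintegral_le (f := r.uHat t) hm hb
  refine ⟨h2, integral_sq_le_of_lintegral_le (f := r.uHat t) hm (sq_nonneg _) hb, fun V hV hV2 => ?_⟩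
  exact hf.integral_inner_eq hY' (hV.mono hle le_rfl) h.oracle.sgradf₁
    (fun ω => (h.obj.gradf₁_L2 _).integrable_of_two) (fun ω => h.obj.gradf₁_unbiased _) h2 hV2

lemma wHat_facts (h : r.Standing c xs ls N μ) (t : ℕ) (hL2 : MemLp (r.L t) 2 μ) :
    MemLp (r.wHat t) 2 μ ∧ ∫ ω, ‖r.wHat t ω‖ ^ 2 ∂μ ≤ c.Cg₁ ^ 2 * ∫ ω, ‖r.L t ω‖ ^ 2 ∂μ ∧
      ∀ V : Ω → Eu dz, Measurable[pastAlg r.S t] V → MemLp V 2 μ →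
        ∫ ω, (inner ℝ (r.wHat t ω) (V ω) : ℝ) ∂μ =
          ∫ ω, (inner ℝ (r.gradG t ω (r.L t ω)) (V ω) : ℝ) ∂μ := by
  obtain ⟨𝒢, hf, hle, hζ⟩ := h.fresh_ζ₁0 t
  obtain ⟨hX, -, hZ, hL⟩ := h.measurable_state t
  have hZ' := h.measurable_Z_succ (hX.mono hle le_rfl) (hZ.mono hle le_rfl) hζ
  have hL' := hL.mono hle le_rfl
  obtain ⟨h1, h2⟩ := hf.sq_apply_le h.oracle.sgradg₁ hZ' hL' (fun ω => h.con.gradg₁_L2 _)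
    (fun ω => h.con.gradg₁_moment _) hL2
  refine ⟨h1, h2, fun V hV hV2 => ?_⟩
  refine (hf.inner_apply_eq h.oracle.sgradg₁ hZ' hL' (fun ω => h.con.gradg₁_L2 _)
    (fun ω => h.con.gradg₁_moment _) hL2 (hV.mono hle le_rfl) hV2).trans ?_
  refine integral_congr_ae (Filter.Eventually.of_forall fun ω => ?_)
  simp only [h.con.gradg₁_unbiased]; rfl

lemma dF_facts (h : r.Standing c xs ls N μ) (t : ℕ) :
    MemLp (r.dF t) 2 μ ∧ ∫ ω, ‖r.dF t ω‖ ^ 2 ∂μ ≤ c.Cf₁ ^ 2 * c.Cf₂ ^ 2 ∧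
      ∀ V : Ω → Eu dx, Measurable[pastAlg r.S t] V → MemLp V 2 μ →
        ∫ ω, (inner ℝ (r.dF t ω) (V ω) : ℝ) ∂μ =
          ∫ ω, (inner ℝ (r.meanSubF t ω (r.gradF t ω)) (V ω) : ℝ) ∂μ := by
  have hple := pastAlg_le h.sampling.meas t
  obtain ⟨𝒢, hf, hle, hξ, hξ'⟩ := h.fresh_ξ₂0 t
  obtain ⟨hX, hY, -, -⟩ := h.measurable_state t
  have hY' := h.measurable_Y_succ (hX.mono hle le_rfl) (hY.mono hle le_rfl) hξ
  have hu := h.measurable_uHat hY' hξ'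
  obtain ⟨u1, u2, u3⟩ := h.uHat_facts t
  have hL := fun ω => h.obj.subf₂_L2 _ (h.X_mem t ω)
  have hM := fun ω => h.obj.subf₂_moment _ (h.X_mem t ω)
  obtain ⟨h1, h2⟩ := hf.sq_apply_le h.oracle.ssubf₂ (hX.mono hle le_rfl) hu hL hM u1
  refine ⟨h1, h2.trans ?_, fun V hV hV2 => ?_⟩
  · rw [mul_comm]; exact mul_le_mul_of_nonneg_right u2 (sq_nonneg _)
  refine (hf.inner_apply_eq h.oracle.ssubf₂ (hX.mono hle le_rfl) hu hL hM u1
    (hV.mono hle le_rfl) hV2).trans ?_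
  -- Averaging over ξ₂⁰ has replaced the sampled subgradient by its mean. Moving that mean to the
  -- other side by its adjoint turns the test vector into one still known to the past, so the
  -- average over ξ₁⁰ can be taken next.
  have hA := (h.measurable_meanSubF hX).mat_tr
  have hAV := hA.mat_apply hV
  have := u3 _ hAV (hV2.mat_apply_of_bounded (hA.mono hple le_rfl) (K := c.Cf₂) (fun ω => by
    rw [Mat.tr, LinearIsometryEquiv.norm_map]; exact h.norm_meanSubF_le (h.X_mem t ω))
    (hV.mono hple le_rfl))
  simp only [← inner_mat_apply] at this
  exact this

lemma dG_facts (h : r.Standing c xs ls N μ) (t : ℕ) (hL2 : MemLp (r.L t) 2 μ) :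
    MemLp (r.dG t) 2 μ ∧
      ∫ ω, ‖r.dG t ω‖ ^ 2 ∂μ ≤ c.Cg₁ ^ 2 * c.Cg₂ ^ 2 * ∫ ω, ‖r.L t ω‖ ^ 2 ∂μ ∧
      ∀ V : Ω → Eu dx, Measurable[pastAlg r.S t] V → MemLp V 2 μ →
        ∫ ω, (inner ℝ (r.dG t ω) (V ω) : ℝ) ∂μ =
          ∫ ω, (inner ℝ (r.meanSubG t ω (r.gradG t ω (r.L t ω))) (V ω) : ℝ) ∂μ := by
  have hple := pastAlg_le h.sampling.meas t
  obtain ⟨𝒢, hf, hle, hζ, hζ'⟩ := h.fresh_ζ₂0 t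
  obtain ⟨hX, -, hZ, hL'⟩ := h.measurable_state t
  have hZ' := h.measurable_Z_succ (hX.mono hle le_rfl) (hZ.mono hle le_rfl) hζ
  have hu := h.measurable_wHat hZ' hζ' (hL'.mono hle le_rfl)
  obtain ⟨u1, u2, u3⟩ := h.wHat_facts t hL2
  have hL := fun ω => h.con.subg₂_L2 _ (h.X_mem t ω)
  have hM := fun ω => h.con.subg₂_moment _ (h.X_mem t ω)
  obtain ⟨h1, h2⟩ := hf.sq_apply_le h.oracle.ssubg₂ (hX.mono hle le_rfl) hu hL hM u1
  refine ⟨h1, h2.trans ?_, fun V hV hV2 => ?_⟩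
  · calc _ ≤ c.Cg₂ ^ 2 * (c.Cg₁ ^ 2 * ∫ ω, ‖r.L t ω‖ ^ 2 ∂μ) :=
          mul_le_mul_of_nonneg_left u2 (sq_nonneg _)
      _ = _ := by ring
  refine (hf.inner_apply_eq h.oracle.ssubg₂ (hX.mono hle le_rfl) hu hL hM u1
    (hV.mono hle le_rfl) hV2).trans ?_
  have hA := (h.measurable_meanSubG hX).mat_tr
  have hAV := hA.mat_apply hV
  have := u3 _ hAV (hV2.mat_apply_of_bounded (hA.mono hple le_rfl) (K := c.Cg₂) (fun ω => by
    rw [Mat.tr, LinearIsometryEquiv.norm_map]; exact h.norm_meanSubG_le (h.X_mem t ω))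
    (hV.mono hple le_rfl))
  simp only [← inner_mat_apply] at this
  exact this

end CoCRun.Standing

/-! ### The variance of the constraint estimate. -/

lemma integrable_tr_apply {C : Type*} [MeasurableSpace C] {κ : Measure C} {p q : ℕ}
    {A : C → Mat p q} (hA : MemLp A 2 κ) (v : Eu p) :
    MemLp (fun y => Mat.tr (A y) v) 2 κ := by
  have hc : Continuous fun B : Mat p q => Mat.tr B v :=
    ((ContinuousLinearMap.adjoint (𝕜 := ℝ) (E := Eu q) (F := Eu p)).continuous).clm_apply
      continuous_const
  refine MemLp.of_le_mul (c := ‖v‖) hA (hc.comp_aestronglyMeasurable hA.1)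
    (Filter.Eventually.of_forall fun y => ?_)
  rw [mul_comm]; exact norm_tr_le _ _

lemma integral_tr_apply {C : Type*} [MeasurableSpace C] {κ : Measure C} [IsProbabilityMeasure κ]
    {p q : ℕ} {A : C → Mat p q} (hA : MemLp A 2 κ) (v : Eu p) :
    ∫ y, Mat.tr (A y) v ∂κ = Mat.tr (∫ y, A y ∂κ) v := by
  refine ext_inner_left ℝ fun w => ?_
  rw [← integral_inner (integrable_tr_apply hA v).integrable_of_two]
  simp only [← inner_mat_apply]
  rw [ContinuousLinearMap.integral_apply hA.integrable_of_two]
  simp only [real_inner_comm v]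
  rw [integral_inner (hA.integrable_of_two.apply_continuousLinearMap w)]

namespace CoCRun.Standing

variable {dx dy dz m : ℕ} {Ξ₁ Ξ₂ Z₁ Z₂ Ω : Type*} [MeasurableSpace Ξ₁] [MeasurableSpace Ξ₂]
  [MeasurableSpace Z₁] [MeasurableSpace Z₂] {r : CoCRun dx dy dz m Ξ₁ Ξ₂ Z₁ Z₂ Ω}
  {c : CoCConsts} {xs : Eu dx} {ls : Eu m} {N : ℕ}
  {mΩ : MeasurableSpace Ω} {μ : Measure Ω}

lemma g₂_dist_le (h : r.Standing c xs ls N μ) {u w : Eu dx} (hu : u ∈ r.P.X) (hw : w ∈ r.P.X) :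
    ‖r.P.g₂ u - r.P.g₂ w‖ ≤ 2 * c.Cg₂ * c.DX := by
  refine (h.g₂_lipschitz u hu w hw).trans ?_
  have h1 := h.obj.X_bounded u hu
  have h2 := h.obj.X_bounded w hw
  have h3 : ‖u - w‖ ≤ ‖u - xs‖ + ‖w - xs‖ := by
    rw [← sub_sub_sub_cancel_right u w xs]; exact norm_sub_le _ _
  have := mul_le_mul_of_nonneg_left (h3.trans (add_le_add h1 h2)) h.con.Cg₂_pos.le
  linarith

/-- Convexity of the square for the weights 1/(1 + ρ) and ρ/(1 + ρ): averaging keeps a common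
second-moment bound. -/
lemma convex_step_sq {E : Type*} [NormedAddCommGroup E] [NormedSpace ℝ E] {ρ : ℝ} (hρ : 0 ≤ ρ)
    (a b : E) : ‖(1 + ρ)⁻¹ • (a + ρ • b)‖ ^ 2 ≤ (1 + ρ)⁻¹ * (‖a‖ ^ 2 + ρ * ‖b‖ ^ 2) := by
  have h1 : ‖(1 + ρ)⁻¹ • (a + ρ • b)‖ ≤ (1 + ρ)⁻¹ * (‖a‖ + ρ * ‖b‖) := by
    rw [norm_smul, Real.norm_of_nonneg (by positivity)]
    gcongr
    refine (norm_add_le _ _).trans (le_of_eq ?_)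
    rw [norm_smul, Real.norm_of_nonneg hρ]
  refine (pow_le_pow_left₀ (norm_nonneg _) h1 2).trans ?_
  have e : (1 + ρ)⁻¹ * (‖a‖ ^ 2 + ρ * ‖b‖ ^ 2) - ((1 + ρ)⁻¹ * (‖a‖ + ρ * ‖b‖)) ^ 2 =
      ρ * (‖a‖ - ‖b‖) ^ 2 / (1 + ρ) ^ 2 := by field_simp; ring
  have : 0 ≤ ρ * (‖a‖ - ‖b‖) ^ 2 / (1 + ρ) ^ 2 := by positivity
  linarith

lemma outer_noise (h : r.Standing c xs ls N μ) (z v : Eu dz) :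
    MemLp (fun y => r.P.sg₁ z y - r.P.g₁ z
      + (Mat.tr (r.P.sgradg₁ z y) v - Mat.tr (gradMat r.P.g₁ z) v)) 2 r.P.lawζ₁ ∧
    ∫ y, (r.P.sg₁ z y - r.P.g₁ z
      + (Mat.tr (r.P.sgradg₁ z y) v - Mat.tr (gradMat r.P.g₁ z) v)) ∂r.P.lawζ₁ = 0 ∧
    ∫ y, ‖r.P.sg₁ z y - r.P.g₁ z
      + (Mat.tr (r.P.sgradg₁ z y) v - Mat.tr (gradMat r.P.g₁ z) v)‖ ^ 2 ∂r.P.lawζ₁ ≤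
      2 * c.σg₁ ^ 2 + 2 * c.Cg₁ ^ 2 * ‖v‖ ^ 2 := by
  have := h.oracle.probζ₁
  have hA := h.con.gradg₁_L2 z
  have a1 : MemLp (fun y => r.P.sg₁ z y - r.P.g₁ z) 2 r.P.lawζ₁ :=
    (h.con.g₁_L2 z).sub (memLp_const _)
  have a2' := integrable_tr_apply hA v
  have hmean : ∫ y, Mat.tr (r.P.sgradg₁ z y) v ∂r.P.lawζ₁ = Mat.tr (gradMat r.P.g₁ z) v := by
    rw [integral_tr_apply hA v, h.con.gradg₁_unbiased]
  have a2 : MemLp (fun y => Mat.tr (r.P.sgradg₁ z y) v - Mat.tr (gradMat r.P.g₁ z) v) 2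
      r.P.lawζ₁ := a2'.sub (memLp_const _)
  refine ⟨a1.add a2, ?_, ?_⟩
  · rw [integral_add a1.integrable_of_two a2.integrable_of_two,
      integral_sub (h.con.g₁_L2 z).integrable_of_two (integrable_const _),
      integral_sub a2'.integrable_of_two (integrable_const _), hmean, h.con.g₁_unbiased]
    simp
  · have hvar := integral_sq_sub_mean_le a2'
    rw [hmean] at hvar
    have hb : ∫ y, ‖Mat.tr (r.P.sgradg₁ z y) v‖ ^ 2 ∂r.P.lawζ₁ ≤ c.Cg₁ ^ 2 * ‖v‖ ^ 2 := by
      calc _ ≤ ∫ y, ‖r.P.sgradg₁ z y‖ ^ 2 * ‖v‖ ^ 2 ∂r.P.lawζ₁ := by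
            refine integral_mono a2'.integrable_sq_norm (hA.integrable_sq_norm.mul_const _)
              fun y => ?_
            simp only
            rw [← mul_pow]
            exact pow_le_pow_left₀ (norm_nonneg _) (norm_tr_le _ _) 2
        _ = (∫ y, ‖r.P.sgradg₁ z y‖ ^ 2 ∂r.P.lawζ₁) * ‖v‖ ^ 2 := integral_mul_const _ _
        _ ≤ _ := mul_le_mul_of_nonneg_right (h.con.gradg₁_moment z) (sq_nonneg _)
    have hg := h.con.g₁_var z
    calc _ ≤ ∫ y, (2 * ‖r.P.sg₁ z y - r.P.g₁ z‖ ^ 2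
          + 2 * ‖Mat.tr (r.P.sgradg₁ z y) v - Mat.tr (gradMat r.P.g₁ z) v‖ ^ 2) ∂r.P.lawζ₁ := by
          refine integral_mono (a1.add a2).integrable_sq_norm
            ((a1.integrable_sq_norm.const_mul 2).add (a2.integrable_sq_norm.const_mul 2))
            fun y => ?_
          simp only
          have := norm_add_le (r.P.sg₁ z y - r.P.g₁ z)
            (Mat.tr (r.P.sgradg₁ z y) v - Mat.tr (gradMat r.P.g₁ z) v)
          have := pow_le_pow_left₀ (norm_nonneg _) this 2
          nlinarith [sq_nonneg (‖r.P.sg₁ z y - r.P.g₁ z‖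
            - ‖Mat.tr (r.P.sgradg₁ z y) v - Mat.tr (gradMat r.P.g₁ z) v‖)]
      _ = 2 * (∫ y, ‖r.P.sg₁ z y - r.P.g₁ z‖ ^ 2 ∂r.P.lawζ₁)
          + 2 * ∫ y, ‖Mat.tr (r.P.sgradg₁ z y) v - Mat.tr (gradMat r.P.g₁ z) v‖ ^ 2
            ∂r.P.lawζ₁ := by
          rw [integral_add (a1.integrable_sq_norm.const_mul 2)
            (a2.integrable_sq_norm.const_mul 2), integral_const_mul, integral_const_mul]
      _ ≤ _ := by linarith

variable [IsProbabilityMeasure μ]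

/-- The recursion is linear, so z_{t+1} splits into an average M of true values g₂(x_k) and the same
average q of their errors. Both inherit by convexity the bounds of single terms, which yields a
tracking bound uniform in t. -/
lemma Z_tracking (h : r.Standing c xs ls N μ) (t : ℕ) (ht : t < N) :
    ∃ M q : Ω → Eu dz, (∀ ω, r.Z (t + 1) ω = M ω + q ω) ∧ MemLp q 2 μ ∧
      ∫ ω, ‖q ω‖ ^ 2 ∂μ ≤ c.σg₂ ^ 2 ∧
      ∀ ω, ∀ u ∈ r.P.X, ‖r.P.g₂ u - M ω‖ ≤ 2 * c.Cg₂ * c.DX := by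
  induction t with
  | zero =>
    obtain ⟨h1, h2, -⟩ := h.eG_facts 0
    refine ⟨fun ω => r.P.g₂ (r.X 0 ω), r.eG 0, fun ω => ?_, h1, h2, fun ω u hu =>
      h.g₂_dist_le hu (h.X_mem 0 ω)⟩
    -- Since ρ_0 = 0, the first average forgets z_0 entirely; otherwise g₂ would have to be compared
    -- with 0.
    rw [Z_succ, h.hρ 0 ht]; simp
  | succ t ih =>
    obtain ⟨M, q, hZ, hq, hq2, hM⟩ := ih (by omega)
    obtain ⟨h1, h2, -⟩ := h.eG_facts (t + 1)
    have hρ := h.hρ (t + 1) ht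
    have hρ0 : 0 ≤ r.ρ (t + 1) := by rw [hρ]; positivity
    set ρ := r.ρ (t + 1)
    refine ⟨fun ω => (1 + ρ)⁻¹ • (r.P.g₂ (r.X (t + 1) ω) + ρ • M ω),
      fun ω => (1 + ρ)⁻¹ • (r.eG (t + 1) ω + ρ • q ω), fun ω => ?_, ?_, ?_, fun ω u hu => ?_⟩
    · rw [Z_succ, hZ, ← smul_add]; congr 1; rw [smul_add]; abel
    · exact (h1.add (hq.const_smul ρ)).const_smul (1 + ρ)⁻¹
    · have hm : MemLp (fun ω => (1 + ρ)⁻¹ • (r.eG (t + 1) ω + ρ • q ω)) 2 μ :=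
        (h1.add (hq.const_smul ρ)).const_smul (1 + ρ)⁻¹
      calc _ ≤ ∫ ω, (1 + ρ)⁻¹ * (‖r.eG (t + 1) ω‖ ^ 2 + ρ * ‖q ω‖ ^ 2) ∂μ :=
            integral_mono hm.integrable_sq_norm
              ((h1.integrable_sq_norm.add (hq.integrable_sq_norm.const_mul ρ)).const_mul _)
              fun ω => convex_step_sq hρ0 _ _
        _ = (1 + ρ)⁻¹ * (∫ ω, ‖r.eG (t + 1) ω‖ ^ 2 ∂μ + ρ * ∫ ω, ‖q ω‖ ^ 2 ∂μ) := by
            rw [integral_const_mul, integral_add h1.integrable_sq_norm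
              (hq.integrable_sq_norm.const_mul ρ), integral_const_mul]
        _ ≤ (1 + ρ)⁻¹ * (c.σg₂ ^ 2 + ρ * c.σg₂ ^ 2) := by gcongr
        _ = _ := by field_simp
    · have e : r.P.g₂ u - (1 + ρ)⁻¹ • (r.P.g₂ (r.X (t + 1) ω) + ρ • M ω) =
          (1 + ρ)⁻¹ • ((r.P.g₂ u - r.P.g₂ (r.X (t + 1) ω)) + ρ • (r.P.g₂ u - M ω)) := by
        have : r.P.g₂ u = (1 + ρ)⁻¹ • (r.P.g₂ u + ρ • r.P.g₂ u) := by
          rw [smul_add, smul_smul, ← add_smul]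
          have : (1 + ρ)⁻¹ + (1 + ρ)⁻¹ * ρ = 1 := by field_simp
          rw [this, one_smul]
        conv_lhs => rw [this]
        rw [← smul_sub]; congr 1; rw [smul_sub]; abel
      simp only
      rw [e, norm_smul, Real.norm_of_nonneg (by positivity)]
      calc _ ≤ (1 + ρ)⁻¹ * (2 * c.Cg₂ * c.DX + ρ * (2 * c.Cg₂ * c.DX)) := by
            gcongr
            refine (norm_add_le _ _).trans ?_
            rw [norm_smul, Real.norm_of_nonneg hρ0]
            gcongr
            · exact h.g₂_dist_le hu (h.X_mem _ ω)
            · exact hM ω u hu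
        _ = _ := by field_simp

lemma gap_facts (h : r.Standing c xs ls N μ) {t : ℕ} (ht : t < N) :
    MemLp (fun ω => r.P.g₂ (r.X t ω) - r.Z (t + 1) ω) 2 μ ∧
      ∫ ω, ‖r.P.g₂ (r.X t ω) - r.Z (t + 1) ω‖ ^ 2 ∂μ ≤
        2 * c.σg₂ ^ 2 + 8 * c.Cg₂ ^ 2 * c.DX ^ 2 := by
  obtain ⟨M, q, hZ, hq, hq2, hM⟩ := h.Z_tracking t ht
  have hle := pastAlg_le h.sampling.meas
  have hm := h.measurable_gap ((h.measurable_state t).1.mono (hle t) le_rfl)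
    ((h.measurable_state (t + 1)).2.2.1.mono (hle _) le_rfl)
  have hb : ∀ ω, ‖r.P.g₂ (r.X t ω) - r.Z (t + 1) ω‖ ≤ 2 * c.Cg₂ * c.DX + ‖q ω‖ := fun ω => by
    rw [hZ, ← sub_sub]
    exact (norm_sub_le _ _).trans (by gcongr; exact hM ω _ (h.X_mem t ω))
  have h2 : MemLp (fun ω => r.P.g₂ (r.X t ω) - r.Z (t + 1) ω) 2 μ := by
    refine MemLp.of_le ((memLp_const (2 * c.Cg₂ * c.DX)).add hq.norm) hm.aestronglyMeasurable
      (Filter.Eventually.of_forall fun ω => (hb ω).trans (le_abs_self _))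
  refine ⟨h2, ?_⟩
  calc _ ≤ ∫ ω, (2 * ‖q ω‖ ^ 2 + 8 * c.Cg₂ ^ 2 * c.DX ^ 2) ∂μ := by
        refine integral_mono h2.integrable_sq_norm
          ((hq.integrable_sq_norm.const_mul 2).add (integrable_const _)) fun ω => ?_
        have := pow_le_pow_left₀ (norm_nonneg _) (hb ω) 2
        simp only
        nlinarith [sq_nonneg (2 * c.Cg₂ * c.DX - ‖q ω‖)]
    _ = 2 * ∫ ω, ‖q ω‖ ^ 2 ∂μ + 8 * c.Cg₂ ^ 2 * c.DX ^ 2 := by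
        rw [integral_add (hq.integrable_sq_norm.const_mul 2) (integrable_const _),
          integral_const_mul]; simp
    _ ≤ _ := by linarith

lemma eH₁_facts (h : r.Standing c xs ls N μ) {t : ℕ} (ht : t < N) :
    MemLp (r.eH₁ t) 2 μ ∧
      ∫ ω, ‖r.eH₁ t ω‖ ^ 2 ∂μ ≤
        2 * c.σg₁ ^ 2 + 2 * c.Cg₁ ^ 2 * (2 * c.σg₂ ^ 2 + 8 * c.Cg₂ ^ 2 * c.DX ^ 2) ∧
      ∀ V : Ω → Eu m, Measurable[pastAlg r.S t] V → MemLp V 2 μ →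
        ∫ ω, (inner ℝ (r.eH₁ t ω) (V ω) : ℝ) ∂μ = 0 := by
  obtain ⟨g1, g2⟩ := h.gap_facts ht
  have hk : ∫⁻ ω, ENNReal.ofReal (2 * c.σg₁ ^ 2
      + 2 * c.Cg₁ ^ 2 * ‖r.P.g₂ (r.X t ω) - r.Z (t + 1) ω‖ ^ 2) ∂μ ≤ ENNReal.ofReal
      (2 * c.σg₁ ^ 2 + 2 * c.Cg₁ ^ 2 * (2 * c.σg₂ ^ 2 + 8 * c.Cg₂ ^ 2 * c.DX ^ 2)) := by
    have hi := g1.integrable_sq_norm.const_mul (2 * c.Cg₁ ^ 2)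
    have hi' := (integrable_const (2 * c.σg₁ ^ 2)).add hi
    rw [← ofReal_integral_eq_lintegral_ofReal (f := fun ω => 2 * c.σg₁ ^ 2
      + 2 * c.Cg₁ ^ 2 * ‖r.P.g₂ (r.X t ω) - r.Z (t + 1) ω‖ ^ 2) hi'
      (Filter.Eventually.of_forall fun ω => by simp only [Pi.zero_apply]; positivity)]
    refine ENNReal.ofReal_le_ofReal ?_
    rw [integral_add (integrable_const _) hi, integral_const, probReal_univ, one_smul,
      integral_const_mul (2 * c.Cg₁ ^ 2)]
    gcongr
  obtain ⟨𝒢, hf, hle, hζ⟩ := h.fresh_ζ₁1 t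
  have hX := (h.measurable_state t).1.mono hle le_rfl
  have hZ := h.measurable_Z_succ hX ((h.measurable_state t).2.2.1.mono hle le_rfl) hζ
  have hv := h.measurable_gap hX hZ
  have hφ : Measurable (Function.uncurry fun (w : Eu dz × Eu dz) y => r.P.sg₁ w.1 y - r.P.g₁ w.1
      + (Mat.tr (r.P.sgradg₁ w.1 y) w.2 - Mat.tr (gradMat r.P.g₁ w.1) w.2)) := by
    have p1 : Measurable fun w : (Eu dz × Eu dz) × Z₁ => (w.1.1, w.2) :=
      measurable_fst.fst.prodMk measurable_snd
    refine Measurable.add (Measurable.sub (h.oracle.sg₁.comp p1)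
      (h.con.g₁_diff.continuous.measurable.comp measurable_fst.fst)) (Measurable.sub ?_ ?_)
    · exact (h.oracle.sgradg₁.comp p1).mat_tr.mat_apply measurable_fst.snd
    · exact (h.continuous_gradMat.measurable.comp measurable_fst.fst).mat_tr.mat_apply
        measurable_fst.snd
  have hm := (hφ.comp (((hZ.prodMk hv).mono hf.le le_rfl).prodMk hf.meas)).aestronglyMeasurable
    (μ := μ)
  have hb : ∫⁻ ω, ‖r.eH₁ t ω‖ₑ ^ 2 ∂μ ≤ ENNReal.ofReal
      (2 * c.σg₁ ^ 2 + 2 * c.Cg₁ ^ 2 * (2 * c.σg₂ ^ 2 + 8 * c.Cg₂ ^ 2 * c.DX ^ 2)) := by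
    refine (hf.lintegral_sq_le (hZ.prodMk hv) hφ
      (k := fun ω => ENNReal.ofReal (2 * c.σg₁ ^ 2
        + 2 * c.Cg₁ ^ 2 * ‖r.P.g₂ (r.X t ω) - r.Z (t + 1) ω‖ ^ 2)) fun ω => ?_).trans ?_
    · obtain ⟨o1, -, o3⟩ := h.outer_noise (r.Z (t + 1) ω) (r.P.g₂ (r.X t ω) - r.Z (t + 1) ω)
      rw [lintegral_enorm_sq_eq o1]
      exact ENNReal.ofReal_le_ofReal o3
    · exact hk
  have h2 := memLp_two_of_lintegral_le (f := r.eH₁ t) hm hb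
  refine ⟨h2, integral_sq_le_of_lintegral_le (f := r.eH₁ t) hm (by positivity) hb,
    fun V hV hV2 => ?_⟩
  refine (hf.integral_inner_eq (hZ.prodMk hv) (hV.mono hle le_rfl) hφ (ψ := fun _ => 0)
    (fun ω => ?_) (fun ω => ?_) h2 hV2).trans (by simp)
  · have := h.oracle.probζ₁
    exact (h.outer_noise _ _).1.integrable_of_two
  · exact (h.outer_noise _ _).2.1

lemma jac_facts (h : r.Standing c xs ls N μ) (t : ℕ) :
    MemLp (r.jac t) 2 μ ∧ ∫ ω, ‖r.jac t ω‖ ^ 2 ∂μ ≤ c.Cg₁ ^ 2 := by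
  obtain ⟨𝒢, hf, hle, hζ⟩ := h.fresh_ζ₁1 t
  have hX := (h.measurable_state t).1.mono hle le_rfl
  have hZ := h.measurable_Z_succ hX ((h.measurable_state t).2.2.1.mono hle le_rfl) hζ
  exact hf.sq_mat_le h.oracle.sgradg₁ hZ (fun ω => h.con.gradg₁_L2 _)
    (fun ω => h.con.gradg₁_moment _)

/-- The inner sample ζ₂² is fresh given the past, z_{t+1} and the outer sample, so `eH₂` is centred
given all that determines `eH₁`. Both parts are also centred given the past, which makes `eH` a
martingale difference. -/
lemma eH_facts (h : r.Standing c xs ls N μ) {t : ℕ} (ht : t < N) :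
    MemLp (r.eH t) 2 μ ∧
      ∫ ω, ‖r.eH t ω‖ ^ 2 ∂μ ≤
        2 * c.σg₁ ^ 2 + 5 * c.Cg₁ ^ 2 * c.σg₂ ^ 2 + 16 * c.Cg₁ ^ 2 * c.Cg₂ ^ 2 * c.DX ^ 2 ∧
      ∀ V : Ω → Eu m, Measurable[pastAlg r.S t] V → MemLp V 2 μ →
        ∫ ω, (inner ℝ (r.eH t ω) (V ω) : ℝ) ∂μ = 0 := by
  obtain ⟨j1, j2⟩ := h.jac_facts t
  obtain ⟨a1, a2, a3⟩ := h.eH₁_facts ht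
  obtain ⟨𝒢, hf, hle, hζ, hζ'⟩ := h.fresh_ζ₂2 t
  have hX := (h.measurable_state t).1.mono hle le_rfl
  have hZ := h.measurable_Z_succ hX ((h.measurable_state t).2.2.1.mono hle le_rfl) hζ
  have hJ := (h.measurable_jac hZ hζ').mat_tr
  have hn : ∀ ω, ‖Mat.tr (r.jac t ω)‖ = ‖r.jac t ω‖ := fun ω => by
    rw [Mat.tr, LinearIsometryEquiv.norm_map]
  have hJ2 := j1.of_le (hJ.mono hf.le le_rfl).aestronglyMeasurable
    (Filter.Eventually.of_forall fun ω => (hn ω).le)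
  obtain ⟨b1, b2, b3⟩ := hf.noise_apply h.oracle.sg₂ h.continuous_g₂.measurable hX hJ hJ2
    (fun ω => h.con.g₂_L2 _ (h.X_mem t ω)) (fun ω => h.con.g₂_unbiased _ (h.X_mem t ω))
    (fun ω => h.con.g₂_var _ (h.X_mem t ω))
  simp only [hn] at b2
  have horth := b3 _ (h.measurable_eH₁ hX hZ hζ') a1
  have e : r.eH t = fun ω => r.eH₁ t ω + r.eH₂ t ω := funext (r.eH_eq t)
  have b2' : ∫ ω, ‖r.eH₂ t ω‖ ^ 2 ∂μ ≤ c.Cg₁ ^ 2 * c.σg₂ ^ 2 :=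
    b2.trans (mul_le_mul_of_nonneg_right j2 (sq_nonneg _))
  rw [e]
  refine ⟨a1.add b1, ?_, fun V hV hV2 => ?_⟩
  -- Orthogonality adds the two variances without a cross term: the 5 before C_{g₁}² σ_{g₂}² is 4
  -- from the tracking error inside `eH₁` plus 1 from `eH₂`.
  · have := integral_sq_add_of_orthogonal (f := r.eH₂ t) b1 a1 horth
    simp only [add_comm (r.eH₂ t _)] at this
    rw [this]
    linarith
  · have h1 := a3 V hV hV2
    have h2 : ∫ ω, (inner ℝ (r.eH₂ t ω) (V ω) : ℝ) ∂μ = 0 := b3 V (hV.mono hle le_rfl) hV2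
    simp only [inner_add_left]
    rw [integral_add (a1.integrable_inner_two hV2)
      (MemLp.integrable_inner_two (f := r.eH₂ t) b1 hV2), h1, h2, add_zero]

end CoCRun.Standing

/-! ### The saddle point, the one-step progress and the pathwise bound. -/

lemma gradient_inner_comp {p q : ℕ} {g : Eu p → Eu q} {z : Eu p} (hg : DifferentiableAt ℝ g z)
    (w : Eu q) : gradient (fun z => (inner ℝ w (g z) : ℝ)) z = gradMat g z w := by
  have h1 : HasFDerivAt (fun z => (inner ℝ w (g z) : ℝ))
      ((innerSL ℝ w).comp (fderiv ℝ g z)) z := by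
    exact (innerSL ℝ w).hasFDerivAt.comp z hg.hasFDerivAt
  rw [gradient, h1.fderiv]
  refine ext_inner_right ℝ fun v => ?_
  rw [InnerProductSpace.toDual_symm_apply, gradMat, Mat.tr, ContinuousLinearMap.adjoint_inner_left]
  rfl

lemma linAt_inner_comp {p q : ℕ} {g : Eu p → Eu q} (hg : Differentiable ℝ g) (w : Eu q)
    (z u : Eu p) : linAt (fun z => (inner ℝ w (g z) : ℝ)) z u =
      inner ℝ w (g z + Mat.tr (gradMat g z) (u - z)) := by
  rw [linAt, gradient_inner_comp (hg z), inner_mat_apply, inner_add_right]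

lemma CompConvex.convexOn_inner {p q : ℕ} {g : Eu p → Eu q} (hg : CompConvex g) {w : Eu q}
    (hw : ∀ j, 0 ≤ w j) : ConvexOn ℝ Set.univ (fun z => (inner ℝ w (g z) : ℝ)) :=
  AdmissibleWeight.convexOn_inner hg fun j => Or.inl (hw j)

namespace CoCProblem

variable {dx dy dz m : ℕ} {Ξ₁ Ξ₂ Z₁ Z₂ : Type*} [MeasurableSpace Ξ₁] [MeasurableSpace Ξ₂]
  [MeasurableSpace Z₁] [MeasurableSpace Z₂] {P : CoCProblem dx dy dz m Ξ₁ Ξ₂ Z₁ Z₂}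

lemma MonotoneAssumption.admissible (h : P.MonotoneAssumption) (y : Eu dy) :
    AdmissibleWeight P.f₂ (gradient P.f₁ y) := by
  intro i
  by_cases hA : ∃ A : Eu dx →ᵃ[ℝ] Eu dy, ∀ x, P.f₂ x = A x
  · obtain ⟨A, hA⟩ := hA
    refine Or.inr ⟨(EuclideanSpace.proj (𝕜 := ℝ) i).toLinearMap.toAffineMap.comp A, fun x => ?_⟩
    rw [hA]; rfl
  · exact Or.inl (h hA y i)

/-- A nonnegative combination of columns of ∇g₁ is nonnegative in every non-affine coordinate of g₂,
so the constraint weighted by a multiplier can be treated as one scalar outer function. -/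
lemma ConstraintAssumption.admissible {c : CoCConsts} (h : P.ConstraintAssumption c) (z : Eu dz)
    {w : Eu m} (hw : ∀ j, 0 ≤ w j) : AdmissibleWeight P.g₂ (gradMat P.g₁ z w) := by
  intro i
  by_cases hA : ∃ A : Eu dx →ᵃ[ℝ] ℝ, ∀ x, P.g₂ x i = A x
  · exact Or.inr hA
  · left
    have hsum : w = ∑ j, w j • EuclideanSpace.single j (1 : ℝ) := by
      ext k
      simp [Pi.single_apply]
    rw [hsum, map_sum, WithLp.ofLp_sum, Finset.sum_apply]
    refine Finset.sum_nonneg fun j _ => ?_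
    rw [map_smul, PiLp.smul_apply]
    exact mul_nonneg (hw j) (h.g_monotone j i hA z)

lemma IsSaddle.G_nonpos {xs : Eu dx} {ls : Eu m} (h : P.IsSaddle xs ls) (j : Fin m) :
    P.G xs j ≤ 0 := by
  -- Raising one coordinate of λ* must not increase the Lagrangian, which forces that constraint to
  -- be nonpositive.
  have := h.le_left (ls + EuclideanSpace.single j 1) fun k => by
    have := h.nonneg k
    simp only [PiLp.add_apply, PiLp.single_apply]
    split_ifs <;> linarith
  simp only [lagr, inner_add_right] at this
  have e : inner ℝ (P.G xs) (EuclideanSpace.single j (1 : ℝ)) = P.G xs j := by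
    rw [EuclideanSpace.inner_single_right]; simp
  linarith

lemma IsSaddle.F_le {xs : Eu dx} {ls : Eu m} (h : P.IsSaddle xs ls) {x : Eu dx} (hx : x ∈ P.X) :
    P.F xs ≤ P.F x + inner ℝ ls (P.G x) := by
  -- Comparison with the zero multiplier gives ⟨G(x*), λ*⟩ ≥ 0, so F(x*) is at most the saddle
  -- value.
  have h1 := h.le_left 0 fun _ => le_rfl
  have h2 := h.le_right x hx
  simp only [lagr, inner_zero_right, add_zero] at h1 h2
  rw [real_inner_comm]
  linarith

end CoCProblem

namespace CoCRun

variable {dx dy dz m : ℕ} {Ξ₁ Ξ₂ Z₁ Z₂ Ω : Type*} [MeasurableSpace Ξ₁] [MeasurableSpace Ξ₂]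
  [MeasurableSpace Z₁] [MeasurableSpace Z₂]

section Definitions

variable (r : CoCRun dx dy dz m Ξ₁ Ξ₂ Z₁ Z₂ Ω)

/-- The error of the sampled primal direction, tested against `x_t - x*`. -/
noncomputable def eX (xs : Eu dx) (t : ℕ) (ω : Ω) : ℝ :=
  inner ℝ (r.meanSubF t ω (r.gradF t ω) + r.meanSubG t ω (r.gradG t ω (r.L t ω))
    - (r.dF t ω + r.dG t ω)) (r.X t ω - xs)

/-- `∇f₁` at the point `y_{t+1}` would be without the sampling error of step `t`. -/
noncomputable def gradF' (t : ℕ) (ω : Ω) : Eu dy :=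
  gradient r.P.f₁ ((1 + r.τ t)⁻¹ • (r.P.f₂ (r.X t ω) + r.τ t • r.Y t ω))

/-- `∇g₁` at the point `z_{t+1}` would be without the sampling error of step `t`. -/
noncomputable def gradG' (t : ℕ) (ω : Ω) : Mat dz m :=
  gradMat r.P.g₁ ((1 + r.ρ t)⁻¹ • (r.P.g₂ (r.X t ω) + r.ρ t • r.Z t ω))

/-- The average of `x_1, …, x_T`. -/
noncomputable def avg (T : ℕ) (ω : Ω) : Eu dx :=
  (T : ℝ)⁻¹ • ∑ t ∈ Finset.range T, r.X (t + 1) ω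

/-- The contribution of iteration `t` to the error bound. -/
noncomputable def stepBound (c : CoCConsts) (xs : Eu dx) (N : ℕ) (Λ : ℝ) (t : ℕ) (ω : Ω) : ℝ :=
  4 / (5 * √(N : ℝ)) * (‖r.dF t ω‖ ^ 2 + ‖r.dG t ω‖ ^ 2 + (c.Cf₁ * c.Cf₂) ^ 2
      + (c.Cg₁ * c.Cg₂) ^ 2 * Λ ^ 2)
    + ((c.Cg₁ * c.Cg₂) ^ 2 * c.DX ^ 2 + ‖r.eH t ω‖ ^ 2) / (2 * √(N : ℝ))
    + r.eX xs t ω + inner ℝ (r.eH t ω) (r.L t ω) + inner ℝ (r.eF t ω) (r.gradF' t ω)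
    + c.Lf₁ * (1 + (t : ℝ) / 2)⁻¹ * ‖r.eF t ω‖ ^ 2
    + Λ * (c.Lg₁ * (1 + (t : ℝ) / 2)⁻¹ * ‖r.eG t ω‖ ^ 2)

/-- The part of the error bound coming from accumulated sampling errors. -/
noncomputable def sumBound (c : CoCConsts) (Λ : ℝ) (T : ℕ) (ω : Ω) : ℝ :=
  c.Cf₁ * ‖∑ t ∈ Finset.range T, r.eF t ω‖ + Λ * (c.Cg₁ * ‖∑ t ∈ Finset.range T, r.eG t ω‖
    + ‖∑ t ∈ Finset.range T, Mat.tr (r.gradG' t ω) (r.eG t ω)‖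
    + ‖∑ t ∈ Finset.range T, r.eH t ω‖)

end Definitions

namespace Standing

variable {r : CoCRun dx dy dz m Ξ₁ Ξ₂ Z₁ Z₂ Ω} {c : CoCConsts} {xs : Eu dx} {ls : Eu m} {N : ℕ}
  {mΩ : MeasurableSpace Ω} {μ : Measure Ω}

lemma sqrt_pos (h : r.Standing c xs ls N μ) : 0 < √(N : ℝ) :=
  Real.sqrt_pos.2 (Nat.cast_pos.2 h.N_pos)

lemma α_pos (h : r.Standing c xs ls N μ) {t : ℕ} (ht : t < N) : 0 < r.α t := by
  rw [h.hα t ht]; have := h.sqrt_pos; positivity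

lemma η_pos (h : r.Standing c xs ls N μ) {t : ℕ} (ht : t < N) : 0 < r.η t := by
  rw [h.hη t ht]; have := h.sqrt_pos; positivity

lemma norm_pG_le (h : r.Standing c xs ls N μ) (t : ℕ) (ω : Ω) :
    ‖r.pG t ω xs‖ ≤ c.Cg₁ * c.Cg₂ * c.DX := by
  refine (norm_tr_le _ _).trans ?_
  rw [mul_assoc]
  refine mul_le_mul (h.norm_gradMat_le _) ?_ (norm_nonneg _) h.con.Cg₁_pos.le
  exact (h.g₂_lipschitz _ (h.X_mem t ω) _ h.saddle.mem).trans
    (mul_le_mul_of_nonneg_left (h.obj.X_bounded _ (h.X_mem t ω)) h.con.Cg₂_pos.le)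

/-- The difference is the linearisation of g₁ at z_{t+1} evaluated at g₂(x*); convexity bounds it by
G(x*) ≤ 0. It is the part that the dual step discards. -/
lemma linG_sub_pG_nonpos (h : r.Standing c xs ls N μ) (t : ℕ) (ω : Ω) (j : Fin m) :
    (r.P.linG (r.X t ω) (r.Z (t + 1) ω) - r.pG t ω xs) j ≤ 0 := by
  set z := r.Z (t + 1) ω
  have e : r.P.linG (r.X t ω) z - r.pG t ω xs =
      r.P.g₁ z + Mat.tr (gradMat r.P.g₁ z) (r.P.g₂ xs - z) := by
    rw [CoCProblem.linG, pG, gradG]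
    simp only [map_sub]; abel
  have hj : ∀ v : Eu m, inner ℝ (EuclideanSpace.single j (1 : ℝ)) v = v j := fun v => by
    rw [EuclideanSpace.inner_single_left]; simp
  have hpos : ∀ k, 0 ≤ (EuclideanSpace.single j (1 : ℝ) : Eu m) k := fun k => by
    simp only [PiLp.single_apply]; split_ifs <;> norm_num
  have h1 := linAt_le (h.con.g₁_convex.convexOn_inner hpos)
    ((differentiable_const _).inner ℝ h.con.g₁_diff) z (r.P.g₂ xs)
  rw [linAt_inner_comp h.con.g₁_diff, hj, hj] at h1
  rw [e]
  exact h1.trans (h.saddle.G_nonpos j)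

lemma dual_step (h : r.Standing c xs ls N μ) {t : ℕ} (ht : t < N) (ω : Ω) {w : Eu m}
    (hw : ∀ j, 0 ≤ w j) :
    inner ℝ (r.P.linG (r.X t ω) (r.Z (t + 1) ω)) w ≤
      inner ℝ (r.pG t ω xs + r.eH t ω) (r.L t ω) - inner ℝ (r.eH t ω) w
        + ‖r.pG t ω xs + r.eH t ω‖ ^ 2 / (2 * r.α t)
        + r.α t / 2 * (‖r.L t ω - w‖ ^ 2 - ‖r.L (t + 1) ω - w‖ ^ 2) := by
  have e : r.P.linG (r.X t ω) (r.Z (t + 1) ω) - r.pG t ω xs + (r.pG t ω xs + r.eH t ω) =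
      r.H t ω := by
    rw [eH]; abel
  have h1 := posVec_step (h.α_pos ht) (h.linG_sub_pG_nonpos t ω) (r.pG t ω xs + r.eH t ω)
    (r.L t ω) hw
  rw [e, ← L_succ] at h1
  have h2 : inner ℝ (r.P.linG (r.X t ω) (r.Z (t + 1) ω)) w =
      inner ℝ (r.H t ω) w - inner ℝ (r.eH t ω) w := by
    rw [← inner_sub_left]; congr 1; rw [eH]; abel
  rw [h2]; linarith

/-- The remainder kept by the dual step, paired with λ_t, is dominated by the constraint part of the
mean primal direction. This is the cancellation between primal and dual steps. -/
lemma inner_pG_le (h : r.Standing c xs ls N μ) (t : ℕ) (ω : Ω) :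
    inner ℝ (r.pG t ω xs) (r.L t ω) ≤
      inner ℝ (r.meanSubG t ω (r.gradG t ω (r.L t ω))) (r.X t ω - xs) := by
  have h1 := (h.con.subg₂_unbiased _ (h.X_mem t ω)).inner_le
    (h.con.admissible (r.Z (t + 1) ω) (r.L_nonneg t ω)) xs
  rw [real_inner_comm, pG, ← inner_mat_apply]
  rw [← neg_sub (r.X t ω), ← neg_sub (r.P.g₂ (r.X t ω)), inner_neg_right, inner_neg_right] at h1
  exact neg_le_neg_iff.1 h1

lemma linAt_f₁_le (h : r.Standing c xs ls N μ) (t : ℕ) (ω : Ω) :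
    linAt r.P.f₁ (r.Y (t + 1) ω) (r.P.f₂ (r.X t ω)) - r.P.F xs ≤
      inner ℝ (r.meanSubF t ω (r.gradF t ω)) (r.X t ω - xs) := by
  have h1 := (h.obj.subf₂_unbiased _ (h.X_mem t ω)).inner_le
    (h.mono.admissible (r.Y (t + 1) ω)) xs
  have h2 := linAt_le h.obj.f₁_convex h.obj.f₁_diff (r.Y (t + 1) ω) (r.P.f₂ xs)
  rw [← neg_sub (r.X t ω), ← neg_sub (r.P.f₂ (r.X t ω)), inner_neg_right, inner_neg_right] at h1
  have h3 := neg_le_neg_iff.1 h1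
  have h4 : linAt r.P.f₁ (r.Y (t + 1) ω) (r.P.f₂ (r.X t ω)) =
      linAt r.P.f₁ (r.Y (t + 1) ω) (r.P.f₂ xs)
        + inner ℝ (gradient r.P.f₁ (r.Y (t + 1) ω)) (r.P.f₂ (r.X t ω) - r.P.f₂ xs) := by
    simp only [linAt, inner_sub_right]; ring
  rw [h4]
  have h5 : r.P.F xs = r.P.f₁ (r.P.f₂ xs) := rfl
  rw [h5]
  have h6 : inner ℝ (r.meanSubF t ω (r.gradF t ω)) (r.X t ω - xs) =
    inner ℝ ((∫ ξ, r.P.ssubf₂ (r.X t ω) ξ ∂r.P.lawξ₂) (gradient r.P.f₁ (r.Y (t + 1) ω)))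
      (r.X t ω - xs) := rfl
  rw [h6]
  linarith

/-- The progress made by one iteration. -/
lemma step_le (h : r.Standing c xs ls N μ) {t : ℕ} (ht : t < N) (ω : Ω) {w : Eu m}
    (hw : ∀ j, 0 ≤ w j) (K : ℝ) :
    linAt r.P.f₁ (r.Y (t + 1) ω) (r.P.f₂ (r.X t ω)) - r.P.F xs
        + inner ℝ (r.P.linG (r.X t ω) (r.Z (t + 1) ω)) w + K * ‖r.X (t + 1) ω - r.X t ω‖ ≤
      (‖r.dF t ω + r.dG t ω‖ + K) ^ 2 / (5 * √(N : ℝ))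
        + ‖r.pG t ω xs + r.eH t ω‖ ^ 2 / (4 * √(N : ℝ))
        + r.eX xs t ω + inner ℝ (r.eH t ω) (r.L t ω) - inner ℝ (r.eH t ω) w
        + 5 * √(N : ℝ) / 4 * (‖r.X t ω - xs‖ ^ 2 - ‖r.X (t + 1) ω - xs‖ ^ 2)
        + √(N : ℝ) * (‖r.L t ω - w‖ ^ 2 - ‖r.L (t + 1) ω - w‖ ^ 2) := by
  have h1 := h.dual_step ht ω hw
  have h2 := h.inner_pG_le t ω
  have h3 := h.linAt_f₁_le t ω
  have h4 := proj_step h.obj.X_closed h.obj.X_convex (h.η_pos ht) (r.X t ω)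
    (r.dF t ω + r.dG t ω) h.saddle.mem K
  rw [← X_succ] at h4
  rw [h.hη t ht] at h4
  rw [h.hα t ht] at h1
  have e1 : 2 * (5 * √(N : ℝ) / 2) = 5 * √(N : ℝ) := by ring
  have e2 : 5 * √(N : ℝ) / 2 / 2 = 5 * √(N : ℝ) / 4 := by ring
  have e3 : 2 * (2 * √(N : ℝ)) = 4 * √(N : ℝ) := by ring
  have e4 : 2 * √(N : ℝ) / 2 = √(N : ℝ) := by ring
  rw [e1, e2] at h4
  rw [e3, e4, inner_add_left] at h1
  have h5 : r.eX xs t ω = inner ℝ (r.meanSubF t ω (r.gradF t ω)) (r.X t ω - xs)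
      + inner ℝ (r.meanSubG t ω (r.gradG t ω (r.L t ω))) (r.X t ω - xs)
      - inner ℝ (r.dF t ω + r.dG t ω) (r.X t ω - xs) := by
    rw [eX, inner_sub_left, inner_add_left]
  rw [h5]; linarith

/-- The gradient at y_{t+1} is correlated with the error of step t. Removing that error from the
point moves it by ‖`eF`‖/(1 + t/2), so smoothness trades the correlation for a squared error with a
decaying weight. -/
lemma inner_gradF_le (h : r.Standing c xs ls N μ) {t : ℕ} (ht : t < N) (ω : Ω) :
    inner ℝ (r.gradF t ω) (r.eF t ω) ≤ inner ℝ (r.eF t ω) (r.gradF' t ω)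
      + c.Lf₁ * (1 + (t : ℝ) / 2)⁻¹ * ‖r.eF t ω‖ ^ 2 := by
  have h1 : ‖r.gradF t ω - r.gradF' t ω‖ ≤ c.Lf₁ * ((1 + (t : ℝ) / 2)⁻¹ * ‖r.eF t ω‖) := by
    refine (h.obj.f₁_smooth _ _).trans (mul_le_mul_of_nonneg_left (le_of_eq ?_) h.obj.Lf₁_pos.le)
    rw [Y_succ, h.hτ t ht, ← smul_sub, norm_smul, Real.norm_of_nonneg (by positivity)]
    congr 2; abel
  have h2 : inner ℝ (r.gradF t ω) (r.eF t ω) = inner ℝ (r.eF t ω) (r.gradF' t ω)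
      + inner ℝ (r.gradF t ω - r.gradF' t ω) (r.eF t ω) := by
    rw [inner_sub_left, real_inner_comm (r.gradF' t ω)]; ring
  rw [h2]
  have h3 := (real_inner_le_norm (r.gradF t ω - r.gradF' t ω) (r.eF t ω)).trans
    (mul_le_mul_of_nonneg_right h1 (norm_nonneg _))
  nlinarith

lemma norm_gradG_sub_le (h : r.Standing c xs ls N μ) {t : ℕ} (ht : t < N) (ω : Ω) :
    ‖Mat.tr (r.gradG t ω) (r.eG t ω) - Mat.tr (r.gradG' t ω) (r.eG t ω)‖ ≤
      c.Lg₁ * (1 + (t : ℝ) / 2)⁻¹ * ‖r.eG t ω‖ ^ 2 := by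
  have h1 : ‖r.gradG t ω - r.gradG' t ω‖ ≤ c.Lg₁ * ((1 + (t : ℝ) / 2)⁻¹ * ‖r.eG t ω‖) := by
    refine (h.con.g₁_smooth _ _).trans (mul_le_mul_of_nonneg_left (le_of_eq ?_) h.con.Lg₁_pos.le)
    rw [Z_succ, h.hρ t ht, ← smul_sub, norm_smul, Real.norm_of_nonneg (by positivity)]
    congr 2; abel
  have h2 : Mat.tr (r.gradG t ω) (r.eG t ω) - Mat.tr (r.gradG' t ω) (r.eG t ω) =
      Mat.tr (r.gradG t ω - r.gradG' t ω) (r.eG t ω) := by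
    rw [Mat.tr, Mat.tr, Mat.tr, map_sub]; rfl
  rw [h2]
  refine (norm_tr_le _ _).trans ?_
  have := mul_le_mul_of_nonneg_right h1 (norm_nonneg (r.eG t ω))
  nlinarith

/-- The multiplier may depend on the whole path, so the decoupled terms do not average out one by
one. It is factored out of the sum instead, leaving the norm of a sum of past-weighted errors. -/
lemma sum_inner_gradG_le (h : r.Standing c xs ls N μ) {T : ℕ} (hT : T ≤ N) (ω : Ω) {w : Eu m}
    {Λ : ℝ} (hΛ : ‖w‖ ≤ Λ) :
    ∑ t ∈ Finset.range T, inner ℝ (r.gradG t ω w) (r.eG t ω) ≤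
      Λ * ‖∑ t ∈ Finset.range T, Mat.tr (r.gradG' t ω) (r.eG t ω)‖
        + ∑ t ∈ Finset.range T, Λ * (c.Lg₁ * (1 + (t : ℝ) / 2)⁻¹ * ‖r.eG t ω‖ ^ 2) := by
  have hΛ0 : 0 ≤ Λ := (norm_nonneg w).trans hΛ
  simp only [inner_mat_apply]
  have e : ∀ t, inner ℝ w (Mat.tr (r.gradG t ω) (r.eG t ω)) =
      inner ℝ w (Mat.tr (r.gradG' t ω) (r.eG t ω))
      + inner ℝ w (Mat.tr (r.gradG t ω) (r.eG t ω) - Mat.tr (r.gradG' t ω) (r.eG t ω)) :=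
    fun t => by rw [← inner_add_right]; congr 1; abel
  simp only [e, Finset.sum_add_distrib, ← inner_sum]
  refine add_le_add ((real_inner_le_norm _ _).trans
    (mul_le_mul_of_nonneg_right hΛ (norm_nonneg _))) ?_
  rw [inner_sum]
  refine Finset.sum_le_sum fun t ht => (real_inner_le_norm _ _).trans ?_
  exact mul_le_mul hΛ (h.norm_gradG_sub_le ((Finset.mem_range.1 ht).trans_le hT) ω)
    (norm_nonneg _) hΛ0

/-- The four terms are separated by (a + b + p + q)² ≤ 4(a² + b² + p² + q²). Λ replaces ‖w‖ so that
the bound stays deterministic in w. -/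
lemma dir_sq_le (h : r.Standing c xs ls N μ) (t : ℕ) (ω : Ω) {w : Eu m} {Λ : ℝ} (hΛ : ‖w‖ ≤ Λ) :
    (‖r.dF t ω + r.dG t ω‖ + (c.Cf₁ * c.Cf₂ + c.Cg₁ * ‖w‖ * c.Cg₂)) ^ 2 ≤
      4 * (‖r.dF t ω‖ ^ 2 + ‖r.dG t ω‖ ^ 2 + (c.Cf₁ * c.Cf₂) ^ 2
        + (c.Cg₁ * c.Cg₂) ^ 2 * Λ ^ 2) := by
  have hΛ0 : 0 ≤ Λ := (norm_nonneg w).trans hΛ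
  have hCf₁ := h.obj.Cf₁_pos
  have hCf₂ := h.obj.Cf₂_pos
  have hCg₁ := h.con.Cg₁_pos
  have hCg₂ := h.con.Cg₂_pos
  have hn := norm_add_le (r.dF t ω) (r.dG t ω)
  have hK : c.Cf₁ * c.Cf₂ + c.Cg₁ * ‖w‖ * c.Cg₂ ≤ c.Cf₁ * c.Cf₂ + c.Cg₁ * c.Cg₂ * Λ := by
    rw [mul_right_comm]; gcongr
  have hpow := pow_le_pow_left₀ (by positivity) (add_le_add hn hK) 2
  refine hpow.trans ?_
  generalize ‖r.dF t ω‖ = a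
  generalize ‖r.dG t ω‖ = b
  generalize c.Cf₁ * c.Cf₂ = p
  rw [← mul_pow (c.Cg₁ * c.Cg₂) Λ]
  generalize c.Cg₁ * c.Cg₂ * Λ = q
  linarith [sq_nonneg (a - b), sq_nonneg (a - p), sq_nonneg (a - q), sq_nonneg (b - p),
    sq_nonneg (b - q), sq_nonneg (p - q)]

lemma residual_sq_le (h : r.Standing c xs ls N μ) (t : ℕ) (ω : Ω) :
    ‖r.pG t ω xs + r.eH t ω‖ ^ 2 ≤
      2 * ((c.Cg₁ * c.Cg₂) ^ 2 * c.DX ^ 2 + ‖r.eH t ω‖ ^ 2) := by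
  have hn := (norm_add_le (r.pG t ω xs) (r.eH t ω)).trans
    (add_le_add_left (h.norm_pG_le t ω) _)
  refine (pow_le_pow_left₀ (norm_nonneg _) hn 2).trans ?_
  rw [← mul_pow (c.Cg₁ * c.Cg₂) c.DX]
  linarith [sq_nonneg (c.Cg₁ * c.Cg₂ * c.DX - ‖r.eH t ω‖)]

lemma step_le_stepBound (h : r.Standing c xs ls N μ) {t : ℕ} (ht : t < N) (ω : Ω) {w : Eu m}
    (hw : ∀ j, 0 ≤ w j) {Λ : ℝ} (hΛ : ‖w‖ ≤ Λ) :
    linAt r.P.f₁ (r.Y (t + 1) ω) (r.P.f₂ (r.X t ω))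
        + inner ℝ (r.gradF t ω) (r.eF t ω)
        + c.Cf₁ * c.Cf₂ * ‖r.X (t + 1) ω - r.X t ω‖ - r.P.F xs
        + (inner ℝ (r.P.linG (r.X t ω) (r.Z (t + 1) ω)) w
          + c.Cg₁ * ‖w‖ * c.Cg₂ * ‖r.X (t + 1) ω - r.X t ω‖) ≤
      r.stepBound c xs N Λ t ω - Λ * (c.Lg₁ * (1 + (t : ℝ) / 2)⁻¹ * ‖r.eG t ω‖ ^ 2)
        - inner ℝ (r.eH t ω) w
        + 5 * √(N : ℝ) / 4 * (‖r.X t ω - xs‖ ^ 2 - ‖r.X (t + 1) ω - xs‖ ^ 2)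
        + √(N : ℝ) * (‖r.L t ω - w‖ ^ 2 - ‖r.L (t + 1) ω - w‖ ^ 2) := by
  have hs := h.sqrt_pos
  -- K collects the step-length penalties that the composite gap charges for f₁ ∘ f₂ and for ⟨w, g₁
  -- ∘ g₂⟩.
  have h1 := h.step_le ht ω hw (c.Cf₁ * c.Cf₂ + c.Cg₁ * ‖w‖ * c.Cg₂)
  have h2 := h.inner_gradF_le ht ω
  have b1 := div_le_div_of_nonneg_right (h.dir_sq_le t ω hΛ)
    (show 0 ≤ 5 * √(N : ℝ) by positivity)
  rw [mul_div_right_comm] at b1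
  have b2 := div_le_div_of_nonneg_right (h.residual_sq_le t ω)
    (show 0 ≤ 4 * √(N : ℝ) by positivity)
  have e : ∀ a : ℝ, 2 * a / (4 * √(N : ℝ)) = a / (2 * √(N : ℝ)) := fun a => by
    field_simp; ring
  rw [e] at b2
  rw [stepBound]
  linarith

/-- The error bound along a path, for every multiplier `w ≥ 0`. -/
lemma path_bound (h : r.Standing c xs ls N μ) {T : ℕ} (hT : T ≤ N) (ω : Ω) {w : Eu m}
    (hw : ∀ j, 0 ≤ w j) {Λ : ℝ} (hΛ : ‖w‖ ≤ Λ) :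
    (T : ℝ) * (r.P.F (r.avg T ω) - r.P.F xs + inner ℝ w (r.P.G (r.avg T ω)))
        + √(N : ℝ) * ‖r.L T ω - w‖ ^ 2 ≤
      5 * √(N : ℝ) / 4 * ‖r.x₀ - xs‖ ^ 2 + √(N : ℝ) * ‖0 - w‖ ^ 2
        + ∑ t ∈ Finset.range T, r.stepBound c xs N Λ t ω + r.sumBound c Λ T ω := by
  have hs := h.sqrt_pos
  have hΛ0 : 0 ≤ Λ := (norm_nonneg w).trans hΛ
  have hCf₁ := h.obj.Cf₁_pos
  have hCf₂ := h.obj.Cf₂_pos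
  have hCg₁ := h.con.Cg₁_pos
  have hCg₂ := h.con.Cg₂_pos
  have hF := sum_comp_le h.obj.f₁_convex h.obj.f₁_diff h.obj.f₂_convex h.mono.admissible
    hCf₁.le h.norm_gradient_le h.f₂_lipschitz (fun t => r.X t ω) (fun t => h.X_mem t ω)
    (fun t => r.eF t ω) (fun t => r.Y t ω) T
    (fun t ht => by rw [Y_succ, h.hτ t (by omega)])
  have hgr : ∀ a, gradient (fun z => (inner ℝ w (r.P.g₁ z) : ℝ)) a = gradMat r.P.g₁ a w :=
    fun a => gradient_inner_comp (h.con.g₁_diff a) w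
  -- The argument is pathwise, so the outer function ⟨w, g₁⟩ may vary with ω.
  have hG := sum_comp_le (h.con.g₁_convex.convexOn_inner hw)
    ((differentiable_const w).inner ℝ h.con.g₁_diff) h.con.g₂_convex
    (fun a => by rw [hgr]; exact h.con.admissible a hw) (C := c.Cg₁ * ‖w‖) (by positivity)
    (fun a => by
      rw [hgr]
      exact ((gradMat r.P.g₁ a).le_opNorm w).trans
        (mul_le_mul_of_nonneg_right (h.norm_gradMat_le a) (norm_nonneg _)))
    h.g₂_lipschitz (fun t => r.X t ω) (fun t => h.X_mem t ω)
    (fun t => r.eG t ω) (fun t => r.Z t ω) T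
    (fun t ht => by rw [Z_succ, h.hρ t (by omega)])
  simp only [hgr, linAt_inner_comp h.con.g₁_diff] at hG
  have e1 : ∀ t, inner ℝ w (r.P.g₁ (r.Z (t + 1) ω) + Mat.tr (gradMat r.P.g₁ (r.Z (t + 1) ω))
      (r.P.g₂ (r.X t ω) - r.Z (t + 1) ω)) =
      inner ℝ (r.P.linG (r.X t ω) (r.Z (t + 1) ω)) w := fun t => by
    rw [real_inner_comm]; rfl
  simp only [e1] at hG
  have e2 : ∀ t, gradient r.P.f₁ (r.Y (t + 1) ω) = r.gradF t ω := fun t => rfl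
  simp only [e2] at hF
  have hsum := Finset.sum_le_sum fun t ht =>
    h.step_le_stepBound ((Finset.mem_range.1 ht).trans_le hT) ω hw hΛ
  have t1 := Finset.sum_range_sub' (fun t => ‖r.X t ω - xs‖ ^ 2) T
  have t2 := Finset.sum_range_sub' (fun t => ‖r.L t ω - w‖ ^ 2) T
  simp only [Finset.sum_add_distrib, Finset.sum_sub_distrib, ← Finset.mul_sum, Finset.sum_const,
    Finset.card_range, nsmul_eq_mul] at hsum hF hG t1 t2
  rw [t1, t2] at hsum
  have g1 := h.sum_inner_gradG_le hT ω hΛ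
  rw [← Finset.mul_sum] at g1
  have g2 : -∑ t ∈ Finset.range T, inner ℝ (r.eH t ω) w ≤
      Λ * ‖∑ t ∈ Finset.range T, r.eH t ω‖ := by
    rw [← sum_inner, ← inner_neg_left]
    refine (real_inner_le_norm _ _).trans ?_
    rw [norm_neg, mul_comm]
    exact mul_le_mul_of_nonneg_right hΛ (norm_nonneg _)
  have g3 : c.Cg₁ * ‖w‖ * ‖∑ t ∈ Finset.range T, r.eG t ω‖ ≤
      Λ * (c.Cg₁ * ‖∑ t ∈ Finset.range T, r.eG t ω‖) := by
    rw [mul_comm c.Cg₁ ‖w‖, mul_assoc]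
    exact mul_le_mul_of_nonneg_right hΛ (by positivity)
  have e3 : r.P.F (r.avg T ω) = r.P.f₁ (r.P.f₂ ((T : ℝ)⁻¹ • ∑ t ∈ Finset.range T, r.X (t + 1) ω)) :=
    rfl
  have e4 : r.P.G (r.avg T ω) = r.P.g₁ (r.P.g₂ ((T : ℝ)⁻¹ • ∑ t ∈ Finset.range T, r.X (t + 1) ω)) :=
    rfl
  have e5 : r.X 0 ω = r.x₀ := rfl
  have e6 : r.L 0 ω = 0 := rfl
  have e7 : ∀ t, r.gradG t ω = gradMat r.P.g₁ (r.Z (t + 1) ω) := fun t => rfl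
  -- The final primal distance left by telescoping is discarded; the final dual distance is kept for
  -- the multiplier recursion.
  have nn : 0 ≤ 5 * √(N : ℝ) / 4 * ‖r.X T ω - xs‖ ^ 2 := by positivity
  simp only [e7] at g1
  rw [e5, e6] at hsum
  rw [e3, e4, sumBound]
  linarith

/-- The dual step against w = 0 completes to a square. As the nonpositive part is discarded, growth
is governed by the bounded remainder and `eH` alone, which propagates square integrability. -/
lemma norm_L_succ_le (h : r.Standing c xs ls N μ) {t : ℕ} (ht : t < N) (ω : Ω) :
    ‖r.L (t + 1) ω‖ ≤ ‖r.L t ω‖ + (r.α t)⁻¹ * (c.Cg₁ * c.Cg₂ * c.DX + ‖r.eH t ω‖) := by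
  have hα := h.α_pos ht
  have h1 := h.dual_step ht ω (w := 0) (fun _ => le_rfl)
  simp only [inner_zero_right, sub_zero] at h1
  have hn := (norm_add_le (r.pG t ω xs) (r.eH t ω)).trans (add_le_add_left (h.norm_pG_le t ω) _)
  have h3 := real_inner_le_norm (r.pG t ω xs + r.eH t ω) (r.L t ω)
  generalize r.pG t ω xs + r.eH t ω = u at h1 hn h3
  have h2 : ‖r.L (t + 1) ω‖ ≤ ‖r.L t ω‖ + (r.α t)⁻¹ * ‖u‖ := by
    refine (abs_le_of_sq_le_sq' ?_ (by positivity)).2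
    have h4 : r.α t / 2 * ‖r.L (t + 1) ω‖ ^ 2 ≤
        r.α t / 2 * (‖r.L t ω‖ + (r.α t)⁻¹ * ‖u‖) ^ 2 := by
      have : r.α t / 2 * (‖r.L t ω‖ + (r.α t)⁻¹ * ‖u‖) ^ 2 =
          r.α t / 2 * ‖r.L t ω‖ ^ 2 + ‖u‖ * ‖r.L t ω‖ + ‖u‖ ^ 2 / (2 * r.α t) := by
        field_simp; ring
      rw [this]; linarith
    exact le_of_mul_le_mul_left h4 (by positivity)
  exact h2.trans (by gcongr)

lemma memLp_L_succ [IsFiniteMeasure μ] (h : r.Standing c xs ls N μ) {t : ℕ} (ht : t < N)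
    (hL : MemLp (r.L t) 2 μ) (he : MemLp (r.eH t) 2 μ) : MemLp (r.L (t + 1)) 2 μ := by
  have hple := pastAlg_le h.sampling.meas (t + 1)
  have hLm := (h.measurable_state (t + 1)).2.2.2.mono hple le_rfl
  have hg : MemLp (fun ω => ‖r.L t ω‖ + (r.α t)⁻¹ * (c.Cg₁ * c.Cg₂ * c.DX + ‖r.eH t ω‖)) 2 μ :=
    hL.norm.add (((memLp_const (c.Cg₁ * c.Cg₂ * c.DX)).add he.norm).const_mul (r.α t)⁻¹)
  exact hg.of_le hLm.aestronglyMeasurable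
    (Filter.Eventually.of_forall fun ω => (h.norm_L_succ_le ht ω).trans (le_abs_self _))

end Standing

end CoCRun

/-! ### Expectation of the error terms. -/

lemma sum_inv_le_two_sqrt (T : ℕ) :
    ∑ t ∈ Finset.range T, (1 + (t : ℝ) / 2)⁻¹ ≤ 2 * √(T : ℝ) := by
  induction T with
  | zero => simp
  | succ n ih =>
    rw [Finset.sum_range_succ]
    have h0 : (0 : ℝ) ≤ n := Nat.cast_nonneg n
    have ha : 0 ≤ √(n : ℝ) := Real.sqrt_nonneg _
    have hb : 0 < √((n : ℝ) + 1) := Real.sqrt_pos.2 (by positivity)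
    have ha2 : √(n : ℝ) ^ 2 = n := Real.sq_sqrt h0
    have hb2 : √((n : ℝ) + 1) ^ 2 = n + 1 := Real.sq_sqrt (by positivity)
    -- Each summand is 2/(n + 2), and this inequality bounds it by twice the increment of the square
    -- root. The harmonic sum is only logarithmic, but order √T suffices.
    have hab : √(n : ℝ) + √((n : ℝ) + 1) ≤ n + 2 := by
      nlinarith [sq_nonneg (√(n : ℝ) - 1), sq_nonneg (√((n : ℝ) + 1) - 1)]
    have key : (1 + (n : ℝ) / 2)⁻¹ ≤ 2 * (√((n : ℝ) + 1) - √(n : ℝ)) := by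
      have e : √((n : ℝ) + 1) - √(n : ℝ) = 1 / (√(n : ℝ) + √((n : ℝ) + 1)) := by
        rw [eq_div_iff (by positivity)]; ring_nf; rw [add_comm 1 (n : ℝ), ha2, hb2]; ring
      have e2 : (1 + (n : ℝ) / 2)⁻¹ = 2 * (1 / ((n : ℝ) + 2)) := by field_simp; ring
      rw [e, e2]
      gcongr
    push_cast
    linarith

namespace CoCRun.Standing

variable {dx dy dz m : ℕ} {Ξ₁ Ξ₂ Z₁ Z₂ Ω : Type*} [MeasurableSpace Ξ₁] [MeasurableSpace Ξ₂]
  [MeasurableSpace Z₁] [MeasurableSpace Z₂] {r : CoCRun dx dy dz m Ξ₁ Ξ₂ Z₁ Z₂ Ω}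
  {c : CoCConsts} {xs : Eu dx} {ls : Eu m} {N : ℕ}
  {mΩ : MeasurableSpace Ω} {μ : Measure Ω}

lemma measurable_state' (h : r.Standing c xs ls N μ) (t : ℕ) :
    Measurable (r.X t) ∧ Measurable (r.Y t) ∧ Measurable (r.Z t) ∧ Measurable (r.L t) := by
  have hle := pastAlg_le h.sampling.meas t
  obtain ⟨h1, h2, h3, h4⟩ := h.measurable_state t
  exact ⟨h1.mono hle le_rfl, h2.mono hle le_rfl, h3.mono hle le_rfl, h4.mono hle le_rfl⟩

/-- The errors of step `t` are known after step `t`. -/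
lemma measurable_errors (h : r.Standing c xs ls N μ) (t : ℕ) :
    Measurable[pastAlg r.S (t + 1)] (r.eF t) ∧ Measurable[pastAlg r.S (t + 1)] (r.eG t) ∧
      Measurable[pastAlg r.S (t + 1)] (r.eH t) := by
  obtain ⟨-, h2, -, -, h5, h6, -, h8⟩ :=
    measurable_draw (measurable_pastAlg r.S (Nat.lt_succ_self t))
  have hle := pastAlg_mono r.S (Nat.le_succ t)
  have hX := (h.measurable_state t).1.mono hle le_rfl
  exact ⟨h.measurable_eF hX h2, h.measurable_eG hX h5,
    h.measurable_eH hX (h.measurable_state (t + 1)).2.2.1 h8 h6⟩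

lemma measurable_gradF' (h : r.Standing c xs ls N μ) (t : ℕ) :
    Measurable[pastAlg r.S t] (r.gradF' t) :=
  h.continuous_gradient.measurable.comp (Measurable.const_smul
    (Measurable.add (h.continuous_f₂.measurable.comp (h.measurable_state t).1)
      (Measurable.const_smul (h.measurable_state t).2.1 (r.τ t))) (1 + r.τ t)⁻¹)

lemma measurable_gradG' (h : r.Standing c xs ls N μ) (t : ℕ) :
    Measurable[pastAlg r.S t] (r.gradG' t) :=
  h.continuous_gradMat.measurable.comp (Measurable.const_smul
    (Measurable.add (h.continuous_g₂.measurable.comp (h.measurable_state t).1)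
      (Measurable.const_smul (h.measurable_state t).2.2.1 (r.ρ t))) (1 + r.ρ t)⁻¹)

variable [IsProbabilityMeasure μ]

lemma memLp_L (h : r.Standing c xs ls N μ) {t : ℕ} (ht : t ≤ N) : MemLp (r.L t) 2 μ := by
  induction t with
  | zero => exact memLp_const (0 : Eu m)
  | succ t ih => exact h.memLp_L_succ ht (ih (by omega)) (h.eH_facts ht).1

/-- Both sampled directions have the right mean when tested against x_t - x*, which is known before
the draw. -/
lemma eX_facts (h : r.Standing c xs ls N μ) {t : ℕ} (ht : t < N) :
    Integrable (r.eX xs t) μ ∧ ∫ ω, r.eX xs t ω ∂μ = 0 := by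
  have hL := h.memLp_L ht.le
  obtain ⟨f1, -, f3⟩ := h.dF_facts t
  obtain ⟨g1, -, g3⟩ := h.dG_facts t hL
  obtain ⟨hX, -, -, hLm⟩ := h.measurable_state' t
  obtain ⟨-, hY, hZ, -⟩ := h.measurable_state' (t + 1)
  have hV : Measurable[pastAlg r.S t] fun ω => r.X t ω - xs :=
    Measurable.sub (h.measurable_state t).1 measurable_const
  have hV2 : MemLp (fun ω => r.X t ω - xs) 2 μ :=
    MemLp.of_bound (hX.sub measurable_const).aestronglyMeasurable c.DX
      (Filter.Eventually.of_forall fun ω => h.obj.X_bounded _ (h.X_mem t ω))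
  have hu : MemLp (r.gradF t) 2 μ :=
    MemLp.of_bound (h.measurable_gradF hY).aestronglyMeasurable c.Cf₁
      (Filter.Eventually.of_forall fun ω => h.norm_gradient_le _)
  have hAu := hu.mat_apply_of_bounded (h.measurable_meanSubF hX)
    (fun ω => h.norm_meanSubF_le (h.X_mem t ω)) (h.measurable_gradF hY)
  have hW := hL.mat_apply_of_bounded (h.measurable_gradG hZ)
    (fun ω => h.norm_gradMat_le _) hLm
  have hBW := hW.mat_apply_of_bounded (h.measurable_meanSubG hX)
    (fun ω => h.norm_meanSubG_le (h.X_mem t ω)) ((h.measurable_gradG hZ).mat_apply hLm)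
  have i1 := hAu.integrable_inner_two hV2
  have i2 := hBW.integrable_inner_two hV2
  have i3 := f1.integrable_inner_two hV2
  have i4 := g1.integrable_inner_two hV2
  have e : r.eX xs t = fun ω => (inner ℝ (r.meanSubF t ω (r.gradF t ω)) (r.X t ω - xs)
      + inner ℝ (r.meanSubG t ω (r.gradG t ω (r.L t ω))) (r.X t ω - xs))
      - (inner ℝ (r.dF t ω) (r.X t ω - xs) + inner ℝ (r.dG t ω) (r.X t ω - xs)) := by
    funext ω
    rw [eX, inner_sub_left, inner_add_left, inner_add_left]
  have j1 : Integrable (fun ω => (inner ℝ (r.meanSubF t ω (r.gradF t ω)) (r.X t ω - xs) : ℝ)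
      + inner ℝ (r.meanSubG t ω (r.gradG t ω (r.L t ω))) (r.X t ω - xs)) μ := i1.add i2
  have j2 : Integrable (fun ω => (inner ℝ (r.dF t ω) (r.X t ω - xs) : ℝ)
      + inner ℝ (r.dG t ω) (r.X t ω - xs)) μ := i3.add i4
  simp only [e]
  refine ⟨j1.sub j2, ?_⟩
  rw [integral_sub j1 j2, integral_add i1 i2, integral_add i3 i4, f3 _ hV hV2,
    g3 _ hV hV2, sub_self]

lemma noise_inner_facts (h : r.Standing c xs ls N μ) {t : ℕ} (ht : t < N) :
    (Integrable (fun ω => (inner ℝ (r.eH t ω) (r.L t ω) : ℝ)) μ ∧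
      ∫ ω, (inner ℝ (r.eH t ω) (r.L t ω) : ℝ) ∂μ = 0) ∧
    (Integrable (fun ω => (inner ℝ (r.eF t ω) (r.gradF' t ω) : ℝ)) μ ∧
      ∫ ω, (inner ℝ (r.eF t ω) (r.gradF' t ω) : ℝ) ∂μ = 0) := by
  have hL := h.memLp_L ht.le
  obtain ⟨a1, -, a3⟩ := h.eH_facts ht
  obtain ⟨b1, -, b3⟩ := h.eF_facts t
  have hle := pastAlg_le h.sampling.meas t
  have hu : MemLp (r.gradF' t) 2 μ :=
    MemLp.of_bound ((h.measurable_gradF' t).mono hle le_rfl).aestronglyMeasurable c.Cf₁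
      (Filter.Eventually.of_forall fun ω => h.norm_gradient_le _)
  exact ⟨⟨a1.integrable_inner_two hL, a3 _ (h.measurable_state t).2.2.2 hL⟩,
    b1.integrable_inner_two hu, b3 _ (h.measurable_gradF' t) hu⟩

lemma integral_stepBound_le (h : r.Standing c xs ls N μ) {t : ℕ} (ht : t < N) {σ : ℝ}
    (hσ : ∫ ω, ‖r.eH t ω‖ ^ 2 ∂μ ≤ σ ^ 2) {Λ : ℝ} (hΛ : 0 ≤ Λ) :
    Integrable (r.stepBound c xs N Λ t) μ ∧ ∫ ω, r.stepBound c xs N Λ t ω ∂μ ≤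
      4 / (5 * √(N : ℝ)) * (2 * (c.Cf₁ * c.Cf₂) ^ 2
        + (c.Cg₁ * c.Cg₂) ^ 2 * ∫ ω, ‖r.L t ω‖ ^ 2 ∂μ + (c.Cg₁ * c.Cg₂) ^ 2 * Λ ^ 2)
      + ((c.Cg₁ * c.Cg₂) ^ 2 * c.DX ^ 2 + σ ^ 2) / (2 * √(N : ℝ))
      + (c.Lf₁ * c.σf₂ ^ 2 + Λ * (c.Lg₁ * c.σg₂ ^ 2)) * (1 + (t : ℝ) / 2)⁻¹ := by
  have hs := h.sqrt_pos
  have hLf := h.obj.Lf₁_pos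
  have hLg := h.con.Lg₁_pos
  have hL := h.memLp_L ht.le
  obtain ⟨f1, f2, -⟩ := h.dF_facts t
  obtain ⟨g1, g2, -⟩ := h.dG_facts t hL
  obtain ⟨x1, x2⟩ := h.eX_facts ht
  obtain ⟨⟨n1, n2⟩, n3, n4⟩ := h.noise_inner_facts ht
  have e1 := (h.eH_facts ht).1
  obtain ⟨a1, a2, -⟩ := h.eF_facts t
  obtain ⟨b1, b2, -⟩ := h.eG_facts t
  set p : ℝ := (1 + (t : ℝ) / 2)⁻¹ with hp
  have hp0 : 0 ≤ p := by positivity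
  have i1 : Integrable (fun ω => 4 / (5 * √(N : ℝ)) * (‖r.dF t ω‖ ^ 2 + ‖r.dG t ω‖ ^ 2
      + (c.Cf₁ * c.Cf₂) ^ 2 + (c.Cg₁ * c.Cg₂) ^ 2 * Λ ^ 2)) μ :=
    (((f1.integrable_sq_norm.add g1.integrable_sq_norm).add (integrable_const _)).add
      (integrable_const _)).const_mul _
  have i2 : Integrable (fun ω => ((c.Cg₁ * c.Cg₂) ^ 2 * c.DX ^ 2 + ‖r.eH t ω‖ ^ 2)
      / (2 * √(N : ℝ))) μ := ((integrable_const _).add e1.integrable_sq_norm).div_const _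
  have i3 : Integrable (fun ω => c.Lf₁ * p * ‖r.eF t ω‖ ^ 2) μ :=
    a1.integrable_sq_norm.const_mul _
  have i4 : Integrable (fun ω => Λ * (c.Lg₁ * p * ‖r.eG t ω‖ ^ 2)) μ :=
    (b1.integrable_sq_norm.const_mul _).const_mul _
  have v1 : ∫ ω, 4 / (5 * √(N : ℝ)) * (‖r.dF t ω‖ ^ 2 + ‖r.dG t ω‖ ^ 2
      + (c.Cf₁ * c.Cf₂) ^ 2 + (c.Cg₁ * c.Cg₂) ^ 2 * Λ ^ 2) ∂μ ≤
      4 / (5 * √(N : ℝ)) * (2 * (c.Cf₁ * c.Cf₂) ^ 2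
        + (c.Cg₁ * c.Cg₂) ^ 2 * ∫ ω, ‖r.L t ω‖ ^ 2 ∂μ + (c.Cg₁ * c.Cg₂) ^ 2 * Λ ^ 2) := by
    rw [integral_const_mul]
    refine mul_le_mul_of_nonneg_left ?_ (by positivity)
    have k1 : Integrable (fun ω => ‖r.dF t ω‖ ^ 2 + ‖r.dG t ω‖ ^ 2) μ :=
      f1.integrable_sq_norm.add g1.integrable_sq_norm
    have k2 : Integrable (fun ω => ‖r.dF t ω‖ ^ 2 + ‖r.dG t ω‖ ^ 2 + (c.Cf₁ * c.Cf₂) ^ 2) μ :=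
      k1.add (integrable_const _)
    rw [integral_add k2 (integrable_const _), integral_add k1 (integrable_const _),
      integral_add f1.integrable_sq_norm g1.integrable_sq_norm, integral_const, integral_const,
      probReal_univ, one_smul, one_smul, mul_pow c.Cf₁, mul_pow c.Cg₁]
    linarith
  have v2 : ∫ ω, ((c.Cg₁ * c.Cg₂) ^ 2 * c.DX ^ 2 + ‖r.eH t ω‖ ^ 2) / (2 * √(N : ℝ)) ∂μ ≤
      ((c.Cg₁ * c.Cg₂) ^ 2 * c.DX ^ 2 + σ ^ 2) / (2 * √(N : ℝ)) := by
    rw [integral_div, integral_add (integrable_const _) e1.integrable_sq_norm, integral_const,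
      probReal_univ, one_smul]
    gcongr
  have v3 : ∫ ω, c.Lf₁ * p * ‖r.eF t ω‖ ^ 2 ∂μ ≤ c.Lf₁ * p * c.σf₂ ^ 2 := by
    rw [integral_const_mul]; gcongr
  have v4 : ∫ ω, Λ * (c.Lg₁ * p * ‖r.eG t ω‖ ^ 2) ∂μ ≤ Λ * (c.Lg₁ * p * c.σg₂ ^ 2) := by
    rw [integral_const_mul, integral_const_mul]; gcongr
  refine ⟨(((((i1.add i2).add x1).add n1).add n3).add i3).add i4, ?_⟩
  have e := integral_add' (((((i1.add i2).add x1).add n1).add n3).add i3) i4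
  rw [integral_add' ((((i1.add i2).add x1).add n1).add n3) i3,
    integral_add' (((i1.add i2).add x1).add n1) n3, integral_add' ((i1.add i2).add x1) n1,
    integral_add' (i1.add i2) x1, integral_add' i1 i2, x2, n2, n4] at e
  refine (le_of_eq e).trans ?_
  linarith

lemma sum_noise_facts (h : r.Standing c xs ls N μ) {T : ℕ} (hT : T ≤ N) {σ : ℝ} (hσ0 : 0 ≤ σ)
    (hσ : ∀ t < N, ∫ ω, ‖r.eH t ω‖ ^ 2 ∂μ ≤ σ ^ 2) :
    ∫ ω, ‖∑ t ∈ Finset.range T, r.eF t ω‖ ∂μ ≤ c.σf₂ * √(T : ℝ) ∧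
    ∫ ω, ‖∑ t ∈ Finset.range T, r.eG t ω‖ ∂μ ≤ c.σg₂ * √(T : ℝ) ∧
    ∫ ω, ‖∑ t ∈ Finset.range T, r.eH t ω‖ ∂μ ≤ σ * √(T : ℝ) := by
  -- Partial sums before t are known at time t, which supplies the orthogonality of the next
  -- increment.
  have hpast : ∀ (q : ℕ) (e : ℕ → Ω → Eu q), (∀ t, Measurable[pastAlg r.S (t + 1)] (e t)) →
      ∀ t, Measurable[pastAlg r.S t] fun ω => ∑ k ∈ Finset.range t, e k ω := fun q e he t =>
    Finset.measurable_fun_sum _ fun k hk =>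
      (he k).mono (pastAlg_mono r.S (Finset.mem_range.1 hk)) le_rfl
  refine ⟨?_, ?_, ?_⟩
  · exact integral_norm_sum_le h.obj.σf₂_pos.le (fun t _ => (h.eF_facts t).1)
      (fun t _ => (h.eF_facts t).2.1) fun t _ => (h.eF_facts t).2.2 _
        (hpast _ _ (fun t => (h.measurable_errors t).1) t)
        (memLp_sum_range fun k _ => (h.eF_facts k).1)
  · exact integral_norm_sum_le h.con.σg₂_pos.le (fun t _ => (h.eG_facts t).1)
      (fun t _ => (h.eG_facts t).2.1) fun t _ => (h.eG_facts t).2.2 _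
        (hpast _ _ (fun t => (h.measurable_errors t).2.1) t)
        (memLp_sum_range fun k _ => (h.eG_facts k).1)
  · exact integral_norm_sum_le hσ0 (fun t ht => (h.eH_facts (ht.trans_le hT)).1)
      (fun t ht => hσ t (ht.trans_le hT)) fun t ht => (h.eH_facts (ht.trans_le hT)).2.2 _
        (hpast _ _ (fun t => (h.measurable_errors t).2.2) t)
        (memLp_sum_range fun k hk => (h.eH_facts (hk.trans (ht.trans_le hT))).1)

/-- The decoupled gradient is known before step t and its norm is at most C_{g₁}, so it may multiply
the error without destroying the martingale property. -/
lemma tr_eG_facts (h : r.Standing c xs ls N μ) (t : ℕ) :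
    MemLp (fun ω => Mat.tr (r.gradG' t ω) (r.eG t ω)) 2 μ ∧
    ∫ ω, ‖Mat.tr (r.gradG' t ω) (r.eG t ω)‖ ^ 2 ∂μ ≤ (c.Cg₁ * c.σg₂) ^ 2 ∧
    (Measurable[pastAlg r.S (t + 1)] fun ω => Mat.tr (r.gradG' t ω) (r.eG t ω)) ∧
    ∀ V : Ω → Eu m, Measurable[pastAlg r.S t] V → MemLp V 2 μ →
      ∫ ω, (inner ℝ (Mat.tr (r.gradG' t ω) (r.eG t ω)) (V ω) : ℝ) ∂μ = 0 := by
  have hle := pastAlg_le h.sampling.meas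
  obtain ⟨b1, b2, b3⟩ := h.eG_facts t
  have hW := h.measurable_gradG' t
  have hb : ∀ ω, ‖r.gradG' t ω‖ ≤ c.Cg₁ := fun ω => h.norm_gradMat_le _
  have hb' : ∀ ω, ‖Mat.tr (r.gradG' t ω)‖ ≤ c.Cg₁ := fun ω => by
    rw [Mat.tr, LinearIsometryEquiv.norm_map]; exact hb ω
  have h2 : MemLp (fun ω => Mat.tr (r.gradG' t ω) (r.eG t ω)) 2 μ :=
    b1.mat_apply_of_bounded (hW.mat_tr.mono (hle t) le_rfl) hb'
      ((h.measurable_errors t).2.1.mono (hle _) le_rfl)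
  refine ⟨h2, ?_, ?_, fun V hV hV2 => ?_⟩
  · calc _ ≤ ∫ ω, c.Cg₁ ^ 2 * ‖r.eG t ω‖ ^ 2 ∂μ := by
          refine integral_mono h2.integrable_sq_norm (b1.integrable_sq_norm.const_mul _)
            fun ω => ?_
          simp only
          rw [← mul_pow]
          exact pow_le_pow_left₀ (norm_nonneg _) (((Mat.tr (r.gradG' t ω)).le_opNorm _).trans
            (mul_le_mul_of_nonneg_right (hb' ω) (norm_nonneg _))) 2
      _ = c.Cg₁ ^ 2 * ∫ ω, ‖r.eG t ω‖ ^ 2 ∂μ := integral_const_mul _ _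
      _ ≤ _ := by rw [mul_pow]; gcongr
  · exact (hW.mat_tr.mono (pastAlg_mono r.S (Nat.le_succ t)) le_rfl).mat_apply
      (h.measurable_errors t).2.1
  · have := b3 _ (hW.mat_apply hV) (hV2.mat_apply_of_bounded (hW.mono (hle t) le_rfl) hb
      (hV.mono (hle t) le_rfl))
    simp only [real_inner_comm (V _), ← inner_mat_apply]
    simp only [real_inner_comm] at this ⊢
    exact this

lemma integral_sumBound_le (h : r.Standing c xs ls N μ) {T : ℕ} (hT : T ≤ N) {σ : ℝ} (hσ0 : 0 ≤ σ)
    (hσ : ∀ t < N, ∫ ω, ‖r.eH t ω‖ ^ 2 ∂μ ≤ σ ^ 2) {Λ : ℝ} (hΛ : 0 ≤ Λ) :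
    Integrable (r.sumBound c Λ T) μ ∧ ∫ ω, r.sumBound c Λ T ω ∂μ ≤
      √(N : ℝ) * (c.Cf₁ * c.σf₂ + Λ * (2 * c.Cg₁ * c.σg₂ + σ)) := by
  have hCf := h.obj.Cf₁_pos
  have hCg := h.con.Cg₁_pos
  have hσf := h.obj.σf₂_pos
  have hσg := h.con.σg₂_pos
  obtain ⟨s1, s2, s3⟩ := h.sum_noise_facts hT hσ0 hσ
  have s4 : ∫ ω, ‖∑ t ∈ Finset.range T, Mat.tr (r.gradG' t ω) (r.eG t ω)‖ ∂μ ≤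
      c.Cg₁ * c.σg₂ * √(T : ℝ) := by
    refine integral_norm_sum_le (by positivity) (fun t _ => (h.tr_eG_facts t).1)
      (fun t _ => (h.tr_eG_facts t).2.1) fun t _ => (h.tr_eG_facts t).2.2.2 _ ?_
        (memLp_sum_range fun k _ => (h.tr_eG_facts k).1)
    exact Finset.measurable_fun_sum _ fun k hk =>
      (h.tr_eG_facts k).2.2.1.mono (pastAlg_mono r.S (Finset.mem_range.1 hk)) le_rfl
  have hTN : √(T : ℝ) ≤ √(N : ℝ) := Real.sqrt_le_sqrt (by exact_mod_cast hT)
  have i1 : Integrable (fun ω => c.Cf₁ * ‖∑ t ∈ Finset.range T, r.eF t ω‖) μ :=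
    ((memLp_sum_range fun k _ => (h.eF_facts k).1).integrable_of_two.norm).const_mul _
  have i2 : Integrable (fun ω => c.Cg₁ * ‖∑ t ∈ Finset.range T, r.eG t ω‖) μ :=
    ((memLp_sum_range fun k _ => (h.eG_facts k).1).integrable_of_two.norm).const_mul _
  have i3 : Integrable (fun ω => ‖∑ t ∈ Finset.range T, Mat.tr (r.gradG' t ω) (r.eG t ω)‖) μ :=
    (memLp_sum_range fun k _ => (h.tr_eG_facts k).1).integrable_of_two.norm
  have i4 : Integrable (fun ω => ‖∑ t ∈ Finset.range T, r.eH t ω‖) μ :=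
    (memLp_sum_range fun k hk => (h.eH_facts (hk.trans_le hT)).1).integrable_of_two.norm
  have e : r.sumBound c Λ T = fun ω => c.Cf₁ * ‖∑ t ∈ Finset.range T, r.eF t ω‖
      + Λ * (c.Cg₁ * ‖∑ t ∈ Finset.range T, r.eG t ω‖
        + ‖∑ t ∈ Finset.range T, Mat.tr (r.gradG' t ω) (r.eG t ω)‖
        + ‖∑ t ∈ Finset.range T, r.eH t ω‖) := rfl
  simp only [e]
  have i6 : Integrable (fun ω => c.Cg₁ * ‖∑ t ∈ Finset.range T, r.eG t ω‖
      + ‖∑ t ∈ Finset.range T, Mat.tr (r.gradG' t ω) (r.eG t ω)‖) μ := i2.add i3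
  have i5 : Integrable (fun ω => c.Cg₁ * ‖∑ t ∈ Finset.range T, r.eG t ω‖
      + ‖∑ t ∈ Finset.range T, Mat.tr (r.gradG' t ω) (r.eG t ω)‖
      + ‖∑ t ∈ Finset.range T, r.eH t ω‖) μ := i6.add i4
  refine ⟨i1.add (i5.const_mul Λ), ?_⟩
  rw [integral_add i1 (i5.const_mul Λ), integral_const_mul, integral_const_mul,
    integral_add i6 i4, integral_add i2 i3, integral_const_mul]
  -- Two contributions C_{g₁} σ_{g₂} arise: one from the gradient at the inner value of the average,
  -- one from the decoupled gradients. For f₁ the second kind has mean zero and sits in `stepBound`.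
  calc _ ≤ c.Cf₁ * (c.σf₂ * √(N : ℝ)) + Λ * (c.Cg₁ * (c.σg₂ * √(N : ℝ))
        + c.Cg₁ * c.σg₂ * √(N : ℝ) + σ * √(N : ℝ)) := by
        gcongr
        · exact s1.trans (by gcongr)
        · exact s2.trans (by gcongr)
        · exact s4.trans (by gcongr)
        · exact s3.trans (by gcongr)
    _ = _ := by ring

/-- The expected error bound after `T` iterations. -/
lemma integral_bound_le (h : r.Standing c xs ls N μ) {T : ℕ} (hT : T ≤ N) {σ : ℝ} (hσ0 : 0 ≤ σ)
    (hσ : ∀ t < N, ∫ ω, ‖r.eH t ω‖ ^ 2 ∂μ ≤ σ ^ 2) {Λ : ℝ} (hΛ : 0 ≤ Λ) :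
    Integrable (fun ω => ∑ t ∈ Finset.range T, r.stepBound c xs N Λ t ω + r.sumBound c Λ T ω) μ ∧
    ∫ ω, (∑ t ∈ Finset.range T, r.stepBound c xs N Λ t ω + r.sumBound c Λ T ω) ∂μ ≤
      √(N : ℝ) * (4 / 5 * (2 * (c.Cf₁ * c.Cf₂) ^ 2 + (c.Cg₁ * c.Cg₂) ^ 2 * Λ ^ 2
          + (c.Cg₁ * c.Cg₂) ^ 2 * ((∑ t ∈ Finset.range T, ∫ ω, ‖r.L t ω‖ ^ 2 ∂μ) / N))
        + ((c.Cg₁ * c.Cg₂) ^ 2 * c.DX ^ 2 + σ ^ 2) / 2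
        + 2 * (c.Lf₁ * c.σf₂ ^ 2 + Λ * (c.Lg₁ * c.σg₂ ^ 2))
        + c.Cf₁ * c.σf₂ + Λ * (2 * c.Cg₁ * c.σg₂ + σ)) := by
  have hs := h.sqrt_pos
  have hLf := h.obj.Lf₁_pos
  have hLg := h.con.Lg₁_pos
  have hN : (0 : ℝ) < N := Nat.cast_pos.2 h.N_pos
  have hss : √(N : ℝ) * √(N : ℝ) = N := Real.mul_self_sqrt hN.le
  obtain ⟨u1, u2⟩ := h.integral_sumBound_le hT hσ0 hσ hΛ
  have i1 : ∀ t ∈ Finset.range T, Integrable (r.stepBound c xs N Λ t) μ := fun t ht =>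
    (h.integral_stepBound_le ((Finset.mem_range.1 ht).trans_le hT)
      (hσ t ((Finset.mem_range.1 ht).trans_le hT)) hΛ).1
  have i2 : Integrable (fun ω => ∑ t ∈ Finset.range T, r.stepBound c xs N Λ t ω) μ :=
    integrable_finsetSum _ i1
  refine ⟨i2.add u1, ?_⟩
  rw [integral_add i2 u1, integral_finsetSum _ i1]
  have v := Finset.sum_le_sum fun t (ht : t ∈ Finset.range T) =>
    (h.integral_stepBound_le ((Finset.mem_range.1 ht).trans_le hT)
      (hσ t ((Finset.mem_range.1 ht).trans_le hT)) hΛ).2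
  simp only [Finset.sum_add_distrib, ← Finset.mul_sum, Finset.sum_const, Finset.card_range,
    nsmul_eq_mul] at v
  have hsum := (sum_inv_le_two_sqrt T).trans
    (mul_le_mul_of_nonneg_left (Real.sqrt_le_sqrt (Nat.cast_le.2 hT)) (by norm_num) :
      2 * √(T : ℝ) ≤ 2 * √(N : ℝ))
  have hTN : (T : ℝ) ≤ N := Nat.cast_le.2 hT
  set A := 2 * (c.Cf₁ * c.Cf₂) ^ 2
  set B := (c.Cg₁ * c.Cg₂) ^ 2
  have hA : 0 ≤ A := by positivity
  have hB : 0 ≤ B := by positivity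
  set E := ∑ t ∈ Finset.range T, ∫ ω, ‖r.L t ω‖ ^ 2 ∂μ
  have w1 : 4 / (5 * √(N : ℝ)) * (T * A + B * E + T * (B * Λ ^ 2)) ≤
      √(N : ℝ) * (4 / 5 * (A + B * Λ ^ 2 + B * (E / N))) := by
    have e1 : √(N : ℝ) * (4 / 5 * (A + B * Λ ^ 2 + B * (E / N))) =
        4 / (5 * √(N : ℝ)) * (N * A + B * E + N * (B * Λ ^ 2)) := by
      generalize √(N : ℝ) = s at hs hss
      rw [← hss]
      field_simp
      ring
    rw [e1]
    gcongr
  have w2 : T * ((B * c.DX ^ 2 + σ ^ 2) / (2 * √(N : ℝ))) ≤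
      √(N : ℝ) * ((B * c.DX ^ 2 + σ ^ 2) / 2) := by
    have e1 : √(N : ℝ) * ((B * c.DX ^ 2 + σ ^ 2) / 2) =
        N * ((B * c.DX ^ 2 + σ ^ 2) / (2 * √(N : ℝ))) := by
      nth_rewrite 2 [← hss]
      field_simp
    rw [e1]
    gcongr
  have w3 : (c.Lf₁ * c.σf₂ ^ 2 + Λ * (c.Lg₁ * c.σg₂ ^ 2))
      * ∑ t ∈ Finset.range T, (1 + (t : ℝ) / 2)⁻¹ ≤
      (c.Lf₁ * c.σf₂ ^ 2 + Λ * (c.Lg₁ * c.σg₂ ^ 2)) * (2 * √(N : ℝ)) :=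
    mul_le_mul_of_nonneg_left hsum (by positivity)
  linarith

end CoCRun.Standing

/-! ### Mean-square boundedness of the multipliers and the two final bounds. -/

/-- The discrete Grönwall inequality with constant coefficients. -/
lemma le_mul_pow_of_le_add_mul_sum {e : ℕ → ℝ} {a b : ℝ} (hb : 0 ≤ b) {N : ℕ}
    (h : ∀ T ≤ N, e T ≤ a + b * ∑ t ∈ Finset.range T, e t) :
    ∀ T ≤ N, e T ≤ a * (1 + b) ^ T := by
  -- Induction on the majorant instead of e avoids any sign condition on a or e.
  have key : ∀ T ≤ N, a + b * ∑ t ∈ Finset.range T, e t ≤ a * (1 + b) ^ T := by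
    intro T
    induction T with
    | zero => intro _; simp
    | succ T ih =>
      intro hT
      have h1 := ih (by omega)
      have h2 := mul_le_mul_of_nonneg_left ((h T (by omega)).trans h1) hb
      rw [Finset.sum_range_succ, pow_succ]
      linarith
  exact fun T hT => (h T hT).trans (key T hT)

lemma inner_posVec_self {n : ℕ} (v : Eu n) : (inner ℝ (posVec v) v : ℝ) = ‖posVec v‖ ^ 2 := by
  rw [← real_inner_self_eq_norm_sq, PiLp.inner_apply, PiLp.inner_apply]
  refine Finset.sum_congr rfl fun j _ => ?_
  simp only [posVec, RCLike.inner_apply, conj_trivial]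
  rcases le_total (v j) 0 with hj | hj
  · rw [max_eq_right hj]; simp
  · rw [max_eq_left hj]

lemma inner_le_inner_posVec {n : ℕ} {w : Eu n} (hw : ∀ j, 0 ≤ w j) (v : Eu n) :
    (inner ℝ w v : ℝ) ≤ inner ℝ w (posVec v) := by
  rw [PiLp.inner_apply, PiLp.inner_apply]
  refine Finset.sum_le_sum fun j _ => ?_
  simp only [posVec, RCLike.inner_apply, conj_trivial]
  exact mul_le_mul_of_nonneg_right (le_max_left _ _) (hw j)

namespace CoCRun.Standing

variable {dx dy dz m : ℕ} {Ξ₁ Ξ₂ Z₁ Z₂ Ω : Type*} [MeasurableSpace Ξ₁] [MeasurableSpace Ξ₂]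
  [MeasurableSpace Z₁] [MeasurableSpace Z₂] {r : CoCRun dx dy dz m Ξ₁ Ξ₂ Z₁ Z₂ Ω}
  {c : CoCConsts} {xs : Eu dx} {ls : Eu m} {N : ℕ}
  {mΩ : MeasurableSpace Ω} {μ : Measure Ω}

lemma avg_mem (h : r.Standing c xs ls N μ) {T : ℕ} (hT : 0 < T) (ω : Ω) : r.avg T ω ∈ r.P.X := by
  have hT' : (0 : ℝ) < T := Nat.cast_pos.2 hT
  rw [avg, Finset.smul_sum]
  refine h.obj.X_convex.sum_mem (fun _ _ => by positivity) ?_ fun t _ => h.X_mem (t + 1) ω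
  rw [Finset.sum_const, Finset.card_range, nsmul_eq_mul, mul_inv_cancel₀ hT'.ne']

lemma measurable_avg (h : r.Standing c xs ls N μ) (T : ℕ) : Measurable (r.avg T) :=
  Measurable.const_smul (g := fun ω => ∑ t ∈ Finset.range T, r.X (t + 1) ω)
    (Finset.measurable_fun_sum _ fun t _ => (h.measurable_state' (t + 1)).1) ((T : ℝ)⁻¹)

lemma isCompact_X (h : r.Standing c xs ls N μ) : IsCompact r.P.X :=
  Metric.isCompact_of_isClosed_isBounded h.obj.X_closed
    ((Metric.isBounded_closedBall (x := xs) (r := c.DX)).subset fun x hx => by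
      rw [mem_closedBall_iff_norm]; exact h.obj.X_bounded x hx)

lemma integrable_comp_avg [IsFiniteMeasure μ] (h : r.Standing c xs ls N μ) {φ : Eu dx → ℝ}
    (hφ : Continuous φ) : Integrable (fun ω => φ (r.avg N ω)) μ := by
  obtain ⟨C, hC⟩ := h.isCompact_X.exists_bound_of_continuousOn hφ.continuousOn
  exact Integrable.of_bound (hφ.measurable.comp (h.measurable_avg N)).aestronglyMeasurable C
    (Filter.Eventually.of_forall fun ω => hC _ (h.avg_mem h.N_pos ω))

lemma continuous_F (h : r.Standing c xs ls N μ) : Continuous r.P.F :=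
  h.obj.f₁_diff.continuous.comp h.continuous_f₂

lemma continuous_G (h : r.Standing c xs ls N μ) : Continuous r.P.G :=
  h.con.g₁_diff.continuous.comp h.continuous_g₂

variable [IsProbabilityMeasure μ]

lemma integral_norm_L_sq_le (h : r.Standing c xs ls N μ) {t : ℕ} (ht : t ≤ N) :
    ∫ ω, ‖r.L t ω‖ ^ 2 ∂μ ≤ 2 * ‖ls‖ ^ 2 + 2 * ∫ ω, ‖r.L t ω - ls‖ ^ 2 ∂μ := by
  have i1 : Integrable (fun ω => 2 * ‖r.L t ω - ls‖ ^ 2) μ :=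
    ((h.memLp_L ht).sub (memLp_const ls)).integrable_sq_norm.const_mul 2
  calc _ ≤ ∫ ω, (2 * ‖ls‖ ^ 2 + 2 * ‖r.L t ω - ls‖ ^ 2) ∂μ := by
        refine integral_mono (h.memLp_L ht).integrable_sq_norm ((integrable_const _).add i1)
          fun ω => ?_
        have h1 : ‖r.L t ω‖ ≤ ‖r.L t ω - ls‖ + ‖ls‖ := norm_le_norm_sub_add _ _
        have h2 := pow_le_pow_left₀ (norm_nonneg _) h1 2
        simp only
        linarith [sq_nonneg (‖r.L t ω - ls‖ - ‖ls‖)]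
    _ = _ := by
        rw [integral_add (integrable_const _) i1, integral_const, probReal_univ, one_smul,
          integral_const_mul]

/-- The multipliers stay bounded in mean square, uniformly in the number of iterations. -/
lemma integral_norm_L_sub_sq_le (h : r.Standing c xs ls N μ) {σ : ℝ} (hσ0 : 0 ≤ σ)
    (hσ : ∀ t < N, ∫ ω, ‖r.eH t ω‖ ^ 2 ∂μ ≤ σ ^ 2) {T : ℕ} (hT : T ≤ N) :
    ∫ ω, ‖r.L T ω - ls‖ ^ 2 ∂μ ≤ c.R σ ‖ls‖ ‖r.x₀ - xs‖ ‖0 - ls‖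
      * Real.exp (4 * c.Cg₁ ^ 2 * c.Cg₂ ^ 2) := by
  have hs := h.sqrt_pos
  have hN : (0 : ℝ) < N := Nat.cast_pos.2 h.N_pos
  have hCf₁ := h.obj.Cf₁_pos
  have hCf₂ := h.obj.Cf₂_pos
  have hCg₁ := h.con.Cg₁_pos
  have hCg₂ := h.con.Cg₂_pos
  have hσf := h.obj.σf₂_pos
  have hσg := h.con.σg₂_pos
  have hLf := h.obj.Lf₁_pos
  have hLg := h.con.Lg₁_pos
  set l := ‖ls‖ with hl
  have hl0 : 0 ≤ l := norm_nonneg _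
  set B := (c.Cg₁ * c.Cg₂) ^ 2 with hB
  have hB0 : 0 ≤ B := by positivity
  set A := (c.Cf₁ * c.Cf₂) ^ 2 with hA
  have hA0 : 0 ≤ A := by positivity
  set d := ‖r.x₀ - xs‖
  set e : ℕ → ℝ := fun t => ∫ ω, ‖r.L t ω - ls‖ ^ 2 ∂μ with he
  have iL : ∀ t ≤ N, Integrable (fun ω => ‖r.L t ω - ls‖ ^ 2) μ := fun t ht =>
    ((h.memLp_L ht).sub (memLp_const ls)).integrable_sq_norm
  -- The constant a is the expected bound with Λ = ‖λ*‖, after splitting ‖λ_t‖² ≤ 2‖λ*‖² + 2‖λ_t -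
  -- λ*‖²; the second half provides the coefficient 8B/(5N) of the recursion.
  set a := 5 / 4 * d ^ 2 + l ^ 2 + 4 / 5 * (2 * A + B * l ^ 2 + 2 * (B * l ^ 2))
    + (B * c.DX ^ 2 + σ ^ 2) / 2 + 2 * (c.Lf₁ * c.σf₂ ^ 2 + l * (c.Lg₁ * c.σg₂ ^ 2))
    + c.Cf₁ * c.σf₂ + l * (2 * c.Cg₁ * c.σg₂ + σ) with ha
  have key : ∀ T ≤ N, e T ≤ a + 8 / 5 * B / N * ∑ t ∈ Finset.range T, e t := by
    intro T hT
    obtain ⟨b1, b2⟩ := h.integral_bound_le hT hσ0 hσ hl0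
    have hp : ∀ ω, √(N : ℝ) * ‖r.L T ω - ls‖ ^ 2 ≤
        (5 * √(N : ℝ) / 4 * d ^ 2 + √(N : ℝ) * l ^ 2)
          + (∑ t ∈ Finset.range T, r.stepBound c xs N l t ω + r.sumBound c l T ω) := by
      intro ω
      have h1 := h.path_bound hT ω h.saddle.nonneg hl.ge
      -- At w = λ* the saddle property makes the Lagrangian gap nonnegative, so only the dual
      -- distance remains on the left.
      have h2 : 0 ≤ (T : ℝ) * (r.P.F (r.avg T ω) - r.P.F xs
          + inner ℝ ls (r.P.G (r.avg T ω))) := by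
        rcases Nat.eq_zero_or_pos T with rfl | hT0
        · simp
        · have := h.saddle.F_le (h.avg_mem hT0 ω)
          exact mul_nonneg (Nat.cast_nonneg _) (by linarith)
      rw [zero_sub, norm_neg] at h1
      linarith
    have h3 := integral_mono ((iL T hT).const_mul √(N : ℝ)) ((integrable_const _).add b1) hp
    rw [integral_const_mul] at h3
    have h4 := integral_add (integrable_const (5 * √(N : ℝ) / 4 * d ^ 2 + √(N : ℝ) * l ^ 2)) b1
    rw [integral_const, probReal_univ, one_smul] at h4
    have h5 : √(N : ℝ) * e T ≤ (5 * √(N : ℝ) / 4 * d ^ 2 + √(N : ℝ) * l ^ 2)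
        + ∫ ω, (∑ t ∈ Finset.range T, r.stepBound c xs N l t ω + r.sumBound c l T ω) ∂μ :=
      h3.trans (le_of_eq h4)
    have h6 : (∑ t ∈ Finset.range T, ∫ ω, ‖r.L t ω‖ ^ 2 ∂μ) / N ≤
        2 * l ^ 2 + 2 * (∑ t ∈ Finset.range T, e t) / N := by
      have h7 := Finset.sum_le_sum fun t (ht : t ∈ Finset.range T) =>
        h.integral_norm_L_sq_le ((Finset.mem_range.1 ht).le.trans hT)
      simp only [Finset.sum_add_distrib, ← Finset.mul_sum, Finset.sum_const, Finset.card_range,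
        nsmul_eq_mul] at h7
      have h8 : (T : ℝ) * l ^ 2 ≤ N * l ^ 2 := by gcongr
      rw [div_le_iff₀ hN, add_mul, div_mul_cancel₀ _ hN.ne']
      linarith
    have h9 := mul_le_mul_of_nonneg_left h6 hB0
    refine le_of_mul_le_mul_left (h5.trans ?_) hs
    have h10 : 5 * √(N : ℝ) / 4 * d ^ 2 + √(N : ℝ) * l ^ 2 =
      √(N : ℝ) * (5 / 4 * d ^ 2 + l ^ 2) := by ring
    rw [h10]
    refine (add_le_add_right b2 _).trans ?_
    rw [← mul_add]
    refine mul_le_mul_of_nonneg_left ?_ hs.le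
    have h11 : 8 / 5 * B / N * ∑ t ∈ Finset.range T, e t =
      4 / 5 * (B * (2 * (∑ t ∈ Finset.range T, e t) / N)) := by ring
    rw [h11, ha]
    linarith
  have hb0 : 0 ≤ 8 / 5 * B / N := by positivity
  have g := le_mul_pow_of_le_add_mul_sum hb0 key T hT
  set R := c.R σ l d ‖0 - ls‖ with hR
  have hR2 : R = 18 * (B * l) + 19 * A + (B * c.DX ^ 2 + σ ^ 2) / 2 + 5 / 4 * d ^ 2 + l ^ 2
      + (2 * (l * (c.Lg₁ * c.σg₂ ^ 2)) + 3 * (l * (c.Cg₁ * c.σg₂)) + l * σ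
        + 2 * (c.Lf₁ * c.σf₂ ^ 2) + 3 * (c.Cf₁ * c.σf₂)) := by
    rw [hR, CoCConsts.R, CoCConsts.Q, zero_sub, norm_neg, ← hl, hA, hB]; ring
  have hlR : l ^ 2 ≤ R := by
    rw [hR2]
    have : 0 ≤ 18 * (B * l) + 19 * A + (B * c.DX ^ 2 + σ ^ 2) / 2 + 5 / 4 * d ^ 2
      + (2 * (l * (c.Lg₁ * c.σg₂ ^ 2)) + 3 * (l * (c.Cg₁ * c.σg₂)) + l * σ
        + 2 * (c.Lf₁ * c.σf₂ ^ 2) + 3 * (c.Cf₁ * c.σf₂)) := by positivity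
    linarith
  have hR0 : 0 ≤ R := (sq_nonneg l).trans hlR
  -- The terms B‖λ*‖² of a are absorbed through ‖λ*‖² ≤ R, turning a into R(1 + 12B/5) ≤ R
  -- exp(12B/5). With exp(8B/5) from the recursion the exponent is 4B.
  have haR : a ≤ R * (12 / 5 * B + 1) := by
    have h1 := mul_le_mul_of_nonneg_left hlR hB0
    have h2 : a ≤ R + 12 / 5 * (B * l ^ 2) := by
      rw [ha, hR2]
      have : 0 ≤ 18 * (B * l) + 87 / 5 * A + l * (c.Cg₁ * c.σg₂) + 2 * (c.Cf₁ * c.σf₂) := by positivity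
      linarith
    linarith
  have haE : a ≤ R * Real.exp (12 / 5 * B) :=
    haR.trans (mul_le_mul_of_nonneg_left (Real.add_one_le_exp _) hR0)
  have hpow : (1 + 8 / 5 * B / N) ^ T ≤ Real.exp (8 / 5 * B) := by
    calc (1 + 8 / 5 * B / N) ^ T ≤ (1 + 8 / 5 * B / N) ^ N :=
          pow_le_pow_right₀ (by linarith) hT
      _ ≤ Real.exp (8 / 5 * B / N) ^ N := by
          refine pow_le_pow_left₀ (by positivity) ?_ N
          rw [add_comm]; exact Real.add_one_le_exp _
      _ = Real.exp (8 / 5 * B) := by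
          rw [← Real.exp_nat_mul, mul_div_cancel₀ _ hN.ne']
  refine g.trans ?_
  calc a * (1 + 8 / 5 * B / N) ^ T
      ≤ R * Real.exp (12 / 5 * B) * Real.exp (8 / 5 * B) :=
        mul_le_mul haE hpow (by positivity) (by positivity)
    _ = R * Real.exp (4 * c.Cg₁ ^ 2 * c.Cg₂ ^ 2) := by
        rw [mul_assoc, ← Real.exp_add, hB]; congr 2; ring

/-- The expected error bound after all iterations, as a function of the bound `Λ` on the
multiplier and the bound `E` on the mean squared distance of the multipliers to `λ*`. -/
noncomputable def errorBound (c : CoCConsts) (σ l E Λ : ℝ) : ℝ :=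
  4 / 5 * (2 * (c.Cf₁ * c.Cf₂) ^ 2 + (c.Cg₁ * c.Cg₂) ^ 2 * Λ ^ 2
      + (c.Cg₁ * c.Cg₂) ^ 2 * (2 * l ^ 2 + 2 * E))
    + ((c.Cg₁ * c.Cg₂) ^ 2 * c.DX ^ 2 + σ ^ 2) / 2
    + 2 * (c.Lf₁ * c.σf₂ ^ 2 + Λ * (c.Lg₁ * c.σg₂ ^ 2))
    + c.Cf₁ * c.σf₂ + Λ * (2 * c.Cg₁ * c.σg₂ + σ)

lemma integral_bound_le_errorBound (h : r.Standing c xs ls N μ) {σ : ℝ} (hσ0 : 0 ≤ σ)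
    (hσ : ∀ t < N, ∫ ω, ‖r.eH t ω‖ ^ 2 ∂μ ≤ σ ^ 2) {E : ℝ}
    (hE : ∀ t < N, ∫ ω, ‖r.L t ω - ls‖ ^ 2 ∂μ ≤ E) {Λ : ℝ} (hΛ : 0 ≤ Λ) :
    ∫ ω, (∑ t ∈ Finset.range N, r.stepBound c xs N Λ t ω + r.sumBound c Λ N ω) ∂μ ≤
      √(N : ℝ) * errorBound c σ ‖ls‖ E Λ := by
  have hN : (0 : ℝ) < N := Nat.cast_pos.2 h.N_pos
  refine (h.integral_bound_le le_rfl hσ0 hσ hΛ).2.trans ?_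
  have h1 : (∑ t ∈ Finset.range N, ∫ ω, ‖r.L t ω‖ ^ 2 ∂μ) / N ≤ 2 * ‖ls‖ ^ 2 + 2 * E := by
    rw [div_le_iff₀ hN]
    refine (Finset.sum_le_card_nsmul _ _ (2 * ‖ls‖ ^ 2 + 2 * E) fun t ht => ?_).trans ?_
    · have ht' := Finset.mem_range.1 ht
      linarith [h.integral_norm_L_sq_le ht'.le, hE t ht']
    · rw [Finset.card_range, nsmul_eq_mul, mul_comm]
  rw [errorBound]
  gcongr

/-- A pathwise bound of `φ` by the path bound turns into a bound in expectation. -/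
lemma integral_le_of_path_bound (h : r.Standing c xs ls N μ) {σ : ℝ} (hσ0 : 0 ≤ σ)
    (hσ : ∀ t < N, ∫ ω, ‖r.eH t ω‖ ^ 2 ∂μ ≤ σ ^ 2) {E : ℝ}
    (hE : ∀ t < N, ∫ ω, ‖r.L t ω - ls‖ ^ 2 ∂μ ≤ E) {Λ : ℝ} (hΛ : 0 ≤ Λ) {φ : Ω → ℝ}
    (hφ : Integrable φ μ) {a : ℝ}
    (hle : ∀ ω, N * φ ω ≤ √(N : ℝ) * a
      + (∑ t ∈ Finset.range N, r.stepBound c xs N Λ t ω + r.sumBound c Λ N ω)) :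
    ∫ ω, φ ω ∂μ ≤ 1 / √(N : ℝ) * (a + errorBound c σ ‖ls‖ E Λ) := by
  have hs := h.sqrt_pos
  have hss : √(N : ℝ) * √(N : ℝ) = N := Real.mul_self_sqrt (Nat.cast_nonneg _)
  obtain ⟨b1, -⟩ := h.integral_bound_le le_rfl hσ0 hσ hΛ
  have b2 := h.integral_bound_le_errorBound hσ0 hσ hE hΛ
  have h3 := integral_mono (hφ.const_mul (N : ℝ)) ((integrable_const _).add b1) hle
  have h4 := integral_add (integrable_const (√(N : ℝ) * a)) b1
  rw [integral_const, probReal_univ, one_smul] at h4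
  rw [integral_const_mul] at h3
  have h5 := (h3.trans (le_of_eq h4)).trans (add_le_add_right b2 _)
  rw [← mul_add] at h5
  nth_rewrite 1 [← hss] at h5
  rw [mul_assoc] at h5
  rw [one_div, inv_mul_eq_div, le_div_iff₀' hs]
  exact le_of_mul_le_mul_left h5 hs

/-- The comparison multiplier is w = 0, so Λ = 0 and every error carrying the multiplier bound
disappears. -/
lemma integral_F_avg_sub_le (h : r.Standing c xs ls N μ) {σ : ℝ} (hσ0 : 0 ≤ σ)
    (hσ : ∀ t < N, ∫ ω, ‖r.eH t ω‖ ^ 2 ∂μ ≤ σ ^ 2) {E : ℝ}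
    (hE : ∀ t < N, ∫ ω, ‖r.L t ω - ls‖ ^ 2 ∂μ ≤ E) :
    (∫ ω, r.P.F (r.avg N ω) ∂μ) - r.P.F xs ≤
      1 / √(N : ℝ) * (5 / 4 * ‖r.x₀ - xs‖ ^ 2 + errorBound c σ ‖ls‖ E 0) := by
  have iF := h.integrable_comp_avg h.continuous_F
  have h1 := h.integral_le_of_path_bound hσ0 hσ hE le_rfl (iF.sub (integrable_const (r.P.F xs)))
    (a := 5 / 4 * ‖r.x₀ - xs‖ ^ 2) fun ω => by
      have h2 := h.path_bound le_rfl ω (w := 0) (fun _ => le_rfl) (norm_zero.le)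
      have h3 : 0 ≤ √(N : ℝ) * ‖r.L N ω - 0‖ ^ 2 := by positivity
      rw [inner_zero_left, sub_self, norm_zero, add_zero] at h2
      simp only [Pi.sub_apply]
      linarith
  have h4 := integral_sub iF (integrable_const (r.P.F xs))
  rw [integral_const, probReal_univ, one_smul] at h4
  rw [← h4]
  exact h1

lemma integral_norm_posVec_G_avg_le (h : r.Standing c xs ls N μ) {σ : ℝ} (hσ0 : 0 ≤ σ)
    (hσ : ∀ t < N, ∫ ω, ‖r.eH t ω‖ ^ 2 ∂μ ≤ σ ^ 2) {E : ℝ}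
    (hE : ∀ t < N, ∫ ω, ‖r.L t ω - ls‖ ^ 2 ∂μ ≤ E) :
    ∫ ω, ‖posVec (r.P.G (r.avg N ω))‖ ∂μ ≤
      1 / √(N : ℝ) * (5 / 4 * ‖r.x₀ - xs‖ ^ 2 + (‖ls‖ + 1) ^ 2
        + errorBound c σ ‖ls‖ E (‖ls‖ + 1)) := by
  refine h.integral_le_of_path_bound hσ0 hσ hE (by positivity)
    (h.integrable_comp_avg (continuous_posVec.comp h.continuous_G).norm) fun ω => ?_
  simp only [Function.comp_apply]
  set v := r.P.G (r.avg N ω) with hv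
  set p := posVec v with hp
  have hpn : ∀ j, 0 ≤ p j := fun j => le_max_right _ _
  -- The multiplier points along G(x̄)₊ with length ‖λ*‖ + 1. If G(x̄)₊ = 0, the inverse of 0 makes
  -- w = 0, which still satisfies all three conditions.
  obtain ⟨w, hw0, hwn, hwi⟩ : ∃ w : Eu m, (∀ j, 0 ≤ w j) ∧ ‖w‖ ≤ ‖ls‖ + 1 ∧
      (inner ℝ w v : ℝ) = (‖ls‖ + 1) * ‖p‖ := by
    refine ⟨((‖ls‖ + 1) * ‖p‖⁻¹) • p, fun j => ?_, ?_, ?_⟩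
    · rw [PiLp.smul_apply, smul_eq_mul]
      exact mul_nonneg (by positivity) (hpn j)
    · rw [norm_smul, Real.norm_of_nonneg (by positivity), mul_assoc]
      exact mul_le_of_le_one_right (by positivity) (inv_mul_le_one_of_le₀ le_rfl (norm_nonneg _))
    · rw [real_inner_smul_left, inner_posVec_self]
      rcases eq_or_ne ‖p‖ 0 with h0 | h0
      · simp [← hp, h0]
      · rw [← hp]; field_simp
  have h1 := h.path_bound le_rfl ω hw0 hwn
  rw [zero_sub, norm_neg, ← hv, hwi] at h1
  have h2 := h.saddle.F_le (h.avg_mem h.N_pos ω)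
  have h3 := (inner_le_inner_posVec h.saddle.nonneg v).trans (real_inner_le_norm ls (posVec v))
  rw [← hv] at h2
  rw [← hp] at h3
  -- The saddle property loses at most ‖λ*‖ ‖p‖, so one copy of ‖p‖ survives out of ‖λ*‖ + 1.
  have h4 : ‖p‖ ≤ r.P.F (r.avg N ω) - r.P.F xs + (‖ls‖ + 1) * ‖p‖ := by linarith
  have h5 := mul_le_mul_of_nonneg_left h4 (Nat.cast_nonneg (α := ℝ) N)
  have h6 : 0 ≤ √(N : ℝ) * ‖r.L N ω - w‖ ^ 2 := by positivity
  have h7 : √(N : ℝ) * ‖w‖ ^ 2 ≤ √(N : ℝ) * (‖ls‖ + 1) ^ 2 := by gcongr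
  linarith

end CoCRun.Standing

/-! ### Assembly of the theorem. -/

lemma CoCRun.avg_eq_xbar {dx dy dz m : ℕ} {Ξ₁ Ξ₂ Z₁ Z₂ Ω : Type*} [MeasurableSpace Ξ₁]
    [MeasurableSpace Ξ₂] [MeasurableSpace Z₁] [MeasurableSpace Z₂]
    (r : CoCRun dx dy dz m Ξ₁ Ξ₂ Z₁ Z₂ Ω) (N : ℕ) (ω : Ω) :
    r.avg N ω = r.P.xbar r.α r.η r.τ r.ρ r.x₀ 0 (fun t => r.S t ω) N := by
  rw [CoCRun.avg, CoCProblem.xbar, Finset.range_eq_Ico,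
    Finset.sum_Ico_add' (fun t => r.X t ω) 0 N 1]
  rfl

lemma CoCConsts.sigmaH_sq (c : CoCConsts) : c.sigmaH ^ 2 =
    2 * c.σg₁ ^ 2 + 5 * c.Cg₁ ^ 2 * c.σg₂ ^ 2 + 16 * c.Cg₁ ^ 2 * c.Cg₂ ^ 2 * c.DX ^ 2 :=
  Real.sq_sqrt (by positivity)

theorem mainTheorem2 {dx dy dz m : ℕ} {Ξ₁ Ξ₂ Z₁ Z₂ Ω : Type*} [MeasurableSpace Ξ₁]
    [MeasurableSpace Ξ₂] [MeasurableSpace Z₁] [MeasurableSpace Z₂] [MeasurableSpace Ω]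
    (P : CoCProblem dx dy dz m Ξ₁ Ξ₂ Z₁ Z₂) (c : CoCConsts)
    (xs : Eu dx) (ls : Eu m) (hsaddle : P.IsSaddle xs ls)
    (hmeas : P.MeasurableOracle)
    (hobj : P.ObjectiveAssumption c xs)
    (hmono : P.MonotoneAssumption)
    (hcon : P.ConstraintAssumption c)
    (μ : Measure Ω) [IsProbabilityMeasure μ]
    (S : ℕ → Ω → Draw Ξ₁ Ξ₂ Z₁ Z₂) (hS : P.IsSampling μ S)
    (x₀ : Eu dx) (hx₀ : x₀ ∈ P.X)
    (N : ℕ) (hN : 2 * c.Cg₁ ^ 2 * c.Cg₂ ^ 2 ≤ (N : ℝ))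
    (α η τ ρ : ℕ → ℝ)
    (hα : ∀ t < N, α t = 2 * √(N : ℝ)) (hη : ∀ t < N, η t = 5 * √(N : ℝ) / 2)
    (hτ : ∀ t < N, τ t = (t : ℝ) / 2) (hρ : ∀ t < N, ρ t = (t : ℝ) / 2)
    (xb : Ω → Eu dx) (hxb : ∀ ω, xb ω = P.xbar α η τ ρ x₀ 0 (fun t => S t ω) N) :
    Integrable (fun ω => P.F (xb ω)) μ ∧
    Integrable (fun ω => ‖posVec (P.G (xb ω))‖) μ ∧
    0 < c.sigmaH ∧
    (∀ t < N, P.varH α η τ ρ x₀ 0 μ S t ≤ ENNReal.ofReal (c.sigmaH ^ 2)) ∧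
    ∀ σH : ℝ, 0 < σH → (∀ t < N, P.varH α η τ ρ x₀ 0 μ S t ≤ ENNReal.ofReal (σH ^ 2)) →
      (∫ ω, P.F (xb ω) ∂μ) - P.F xs ≤
          1 / √(N : ℝ) *
            (5 / 4 * ‖x₀ - xs‖ ^ 2 + 19 * c.Cf₁ ^ 2 * c.Cf₂ ^ 2
              + (c.DX ^ 2 * c.Cg₁ ^ 2 * c.Cg₂ ^ 2 + σH ^ 2) / 2
              + 2 * c.Lf₁ * c.σf₂ ^ 2 + 3 * c.Cf₁ * c.σf₂)
          + 4 * c.Cg₁ ^ 2 * c.Cg₂ ^ 2 / √(N : ℝ) *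
            (‖ls‖ ^ 2 + 2 * c.R σH ‖ls‖ ‖x₀ - xs‖ ‖(0 : Eu m) - ls‖
              * Real.exp (6 * c.Cg₁ ^ 2 * c.Cg₂ ^ 2)) ∧
      (∫ ω, ‖posVec (P.G (xb ω))‖ ∂μ) ≤
          1 / √(N : ℝ) *
            (16 * c.Cg₁ ^ 2 * c.Cg₂ ^ 2 * (‖ls‖ + 1) ^ 2
              + 2 * c.Lg₁ * c.σg₂ ^ 2 * (‖ls‖ + 1) + 3 * c.Cg₁ * c.σg₂ * (‖ls‖ + 1)
              + 5 / 4 * ‖x₀ - xs‖ ^ 2 + 19 * c.Cf₁ ^ 2 * c.Cf₂ ^ 2)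
          + 1 / √(N : ℝ) *
            ((c.DX ^ 2 * c.Cg₁ ^ 2 * c.Cg₂ ^ 2 + σH ^ 2) / 2
              + (‖ls‖ + 1) ^ 2 + σH * (‖ls‖ + 1)
              + 2 * c.Lf₁ * c.σf₂ ^ 2 + 3 * c.Cf₁ * c.σf₂)
          + 3 * c.Cg₁ ^ 2 * c.Cg₂ ^ 2 / √(N : ℝ) *
            ((‖ls‖ + 1) + ‖ls‖ ^ 2 + 2 * c.R σH ‖ls‖ ‖x₀ - xs‖ ‖(0 : Eu m) - ls‖
              * Real.exp (6 * c.Cg₁ ^ 2 * c.Cg₂ ^ 2)) := by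
  have hCf₁ := hobj.Cf₁_pos
  have hCf₂ := hobj.Cf₂_pos
  have hCg₁ := hcon.Cg₁_pos
  have hCg₂ := hcon.Cg₂_pos
  have hσf := hobj.σf₂_pos
  have hσg₁ := hcon.σg₁_pos
  have hσg := hcon.σg₂_pos
  have hLf := hobj.Lf₁_pos
  have hLg := hcon.Lg₁_pos
  have hN0 : 0 < N := Nat.cast_pos.1 (lt_of_lt_of_le (by positivity) hN)
  let r : CoCRun dx dy dz m Ξ₁ Ξ₂ Z₁ Z₂ Ω := ⟨P, α, η, τ, ρ, x₀, S⟩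
  have h : r.Standing c xs ls N μ :=
    ⟨hsaddle, hmeas, hobj, hmono, hcon, hS, hx₀, hN0, hα, hη, hτ, hρ⟩
  obtain rfl : xb = r.avg N := funext fun ω => by rw [hxb, r.avg_eq_xbar]
  have hv : ∀ t, P.varH α η τ ρ x₀ 0 μ S t = ∫⁻ ω, ‖r.eH t ω‖ₑ ^ 2 ∂μ := fun t => rfl
  refine ⟨h.integrable_comp_avg h.continuous_F,
    h.integrable_comp_avg (continuous_posVec.comp h.continuous_G).norm,
    Real.sqrt_pos.2 (by positivity), fun t ht => ?_, fun σH hσH hσ => ?_⟩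
  · rw [hv, lintegral_enorm_sq_eq (h.eH_facts ht).1, c.sigmaH_sq]
    exact ENNReal.ofReal_le_ofReal (h.eH_facts ht).2.1
  have hσ' : ∀ t < N, ∫ ω, ‖r.eH t ω‖ ^ 2 ∂μ ≤ σH ^ 2 := fun t ht =>
    integral_sq_le_of_lintegral_le (h.eH_facts ht).1.1 (sq_nonneg _) (hσ t ht)
  have hR : 0 ≤ c.R σH ‖ls‖ ‖x₀ - xs‖ ‖0 - ls‖ := by
    rw [CoCConsts.R, CoCConsts.Q]; positivity
  have hE : ∀ t < N, ∫ ω, ‖r.L t ω - ls‖ ^ 2 ∂μ ≤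
      -- The Grönwall exponent 4 C_{g₁}² C_{g₂}² is relaxed to 6 C_{g₁}² C_{g₂}².
      c.R σH ‖ls‖ ‖x₀ - xs‖ ‖0 - ls‖ * Real.exp (6 * c.Cg₁ ^ 2 * c.Cg₂ ^ 2) := fun t ht =>
    (h.integral_norm_L_sub_sq_le hσH.le hσ' ht.le).trans (mul_le_mul_of_nonneg_left
      (Real.exp_le_exp.2 (by gcongr; norm_num)) hR)
  have hE0 : 0 ≤ c.R σH ‖ls‖ ‖x₀ - xs‖ ‖0 - ls‖ * Real.exp (6 * c.Cg₁ ^ 2 * c.Cg₂ ^ 2) := by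
    positivity
  have gap := h.integral_F_avg_sub_le hσH.le hσ' hE
  have feas := h.integral_norm_posVec_G_avg_le hσH.le hσ' hE
  simp only [mul_assoc 2 (c.R _ _ _ _)]
  generalize c.R σH ‖ls‖ ‖x₀ - xs‖ ‖0 - ls‖ * Real.exp (6 * c.Cg₁ ^ 2 * c.Cg₂ ^ 2) = E
    at gap feas hE0 ⊢
  have hl : 0 ≤ ‖ls‖ := norm_nonneg _
  have key : ∀ a b : ℝ, a / √(N : ℝ) * b = 1 / √(N : ℝ) * (a * b) := fun a b => by ring
  have p1 : 0 ≤ (c.Cf₁ * c.Cf₂) ^ 2 := by positivity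
  have p2 : 0 ≤ c.Cf₁ * c.σf₂ := by positivity
  have p3 : 0 ≤ (c.Cg₁ * c.Cg₂) ^ 2 * ‖ls‖ ^ 2 := by positivity
  have p4 : 0 ≤ (c.Cg₁ * c.Cg₂) ^ 2 * E := by positivity
  refine ⟨gap.trans ?_, feas.trans ?_⟩
  · rw [key (4 * _ * _), ← mul_add, CoCRun.Standing.errorBound]
    refine mul_le_mul_of_nonneg_left ?_ (by positivity)
    change 5 / 4 * ‖x₀ - xs‖ ^ 2 + _ ≤ _
    linarith
  · have p5 : 0 ≤ (c.Cg₁ * c.Cg₂) ^ 2 * (‖ls‖ + 1) ^ 2 := by positivity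
    have p6 : 0 ≤ (c.Cg₁ * c.Cg₂) ^ 2 * (‖ls‖ + 1) := by positivity
    have p7 : 0 ≤ c.Cg₁ * c.σg₂ * (‖ls‖ + 1) := by positivity
    rw [key (3 * _ * _), ← mul_add, ← mul_add, CoCRun.Standing.errorBound]
    refine mul_le_mul_of_nonneg_left ?_ (by positivity)
    change 5 / 4 * ‖x₀ - xs‖ ^ 2 + _ + _ ≤ _
    linarith
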